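/- **Setting.** For $k\ge 2$ and $m_1,\dots,m_k\ge 2$ let $G=(V,E)$ be the $m_1\times\dots\times m_k$ grid graph, with $|V|=\prod_{i=1}^k m_i\ge 6$. There are $|V|$ labeled robots; a configuration is an injective map from robots to vertices. In one synchronous move from a configuration $X$ to a configuration $Y$, each robot stays or moves to an adjacent vertex, and no two robots swap: for robots $i\ne j$, if $X(i)=Y(j)$ then $X(j)\ne Y(i)$. An instance is a triple $(G,X_I,X_G)$ of the grid with an initial and a goal configuration. A solution of makespan $T$ is a sequence of configurations $X_I=X_0,X_1,\dots,X_T=X_G$ in which each $(X_t,X_{t+1})$ is a valid move. Time is measured on a unit-cost word RAM with words of $O(\log|V|)$ bits; the input is $k$, the $m_i$, and $X_I,X_G$ as lists of vertex numbers, and the output is the explicit list $X_0,\dots,X_T$. **Statement.** There is one algorithm (program), which takes all such instances as input, with the following property. For every $c>0$ there is a constant $C>0$, depending only on $c$ (and not on $k$), such that on every instance whose grid satisfies $m_i\le c\,|V|^{1/k}$ for all $i$ (in particular, whenever $m_i\le c\,m_j$ for all $i,j$), the algorithm outputs a solution such that * for $k=2$, the makespan is at most $C\sqrt{|V|}$ and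 the running time is at most $C|V|^{3/2}$; * for $k=3$, the makespan is at most $C|V|^{1/3}$ and the running time is at most $C|V|^{4/3}$; * for general $k\ge 2$, the makespan is at most $C k^2|V|^{1/k}$ and the running time is at most $C k^2|V|^{(k+1)/k}$. -/

import Mathlib

namespace MPP

/-! ## Multi-robot path planning on graphs -/

/-- A configuration: every robot (elements of `R`) occupies its own vertex. -/
abbrev Config (R V : Type*) := R ↪ V

/-- A valid synchronous move from `X` to `Y`: each robot stays or moves along an edge, and no two
robots exchange their positions along an edge. (That the robots occupy distinct vertices before and
after the move is part of the type `Config`.) -/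
def IsMove {R V : Type*} (G : SimpleGraph V) (X Y : Config R V) : Prop :=
  (∀ i, Y i = X i ∨ G.Adj (X i) (Y i)) ∧
  (∀ i j, i ≠ j → X i = Y j → X j ≠ Y i)

/-- `X 0, …, X T` is a solution of the instance `(G, XI, XG)` with makespan `T`. -/
def IsSolution {R V : Type*} (G : SimpleGraph V) (XI XG : Config R V)
    (T : ℕ) (X : ℕ → Config R V) : Prop :=
  X 0 = XI ∧ X T = XG ∧ ∀ t < T, IsMove G (X t) (X (t + 1))

/-! ## Grids -/

/-- Vertices of the `m 0 × ⋯ × m (k-1)` grid. -/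
abbrev GridVertex {k : ℕ} (m : Fin k → ℕ) := ∀ i : Fin k, Fin (m i)

/-- The number `|V| = ∏ i, m i` of vertices of the grid. -/
abbrev gridSize {k : ℕ} (m : Fin k → ℕ) : ℕ := ∏ i, m i

/-- The grid graph: two vertices are adjacent iff they differ in exactly one coordinate, and there
by exactly one. -/
def gridGraph {k : ℕ} (m : Fin k → ℕ) : SimpleGraph (GridVertex m) where
  Adj x y := ∃ i, (SimpleGraph.pathGraph (m i)).Adj (x i) (y i) ∧ ∀ j, j ≠ i → x j = y j
  symm := ⟨fun _ _ ⟨i, hi, hj⟩ => ⟨i, hi.symm, fun j h => (hj j h).symm⟩⟩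
  loopless := ⟨fun _ ⟨_, hi, _⟩ => hi.ne rfl⟩

/-- The standing assumptions on grids: at least two dimensions, all sides at least `2`, and at least
`6` vertices. -/
def IsGrid {k : ℕ} (m : Fin k → ℕ) : Prop :=
  2 ≤ k ∧ (∀ i, 2 ≤ m i) ∧ 6 ≤ gridSize m

/-- All sides are `O(|V|^(1/k))`, with implied constant `c`. This holds in particular when
`m i ≤ c * m j` for all `i` and `j`. -/
def SimilarSides (c : ℝ) {k : ℕ} (m : Fin k → ℕ) : Prop :=
  ∀ i, (m i : ℝ) ≤ c * (gridSize m : ℝ) ^ ((1 : ℝ) / k)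

/-- A configuration of a fully occupied grid: as many robots as vertices. -/
abbrev GridConfig {k : ℕ} (m : Fin k → ℕ) := Config (Fin (gridSize m)) (GridVertex m)

/-! ## A word RAM

A program uses finitely many registers and finitely many arrays (both named by natural
numbers that are fixed in the program text), all of whose cells hold natural numbers up to a word
bound `B`. Each constant, register access, array access, arithmetic operation, assignment and
branching costs one unit of time. -/

/-- Binary operations of the machine. -/
inductive Op where
  | add | sub | mul | div | mod | lt | eq

/-- `sub` is truncated, division by zero gives `0`, and the comparisons return `1` or `0`. -/
def Op.apply : Op → ℕ → ℕ → ℕ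
  | .add, a, b => a + b
  | .sub, a, b => a - b
  | .mul, a, b => a * b
  | .div, a, b => a / b
  | .mod, a, b => a % b
  | .lt, a, b => if a < b then 1 else 0
  | .eq, a, b => if a = b then 1 else 0

/-- Expressions: constants, registers, array reads `a[e]`, and binary operations. -/
inductive Term where
  | const (n : ℕ)
  | reg (x : ℕ)
  | read (a : ℕ) (e : Term)
  | bin (o : Op) (e₁ e₂ : Term)

/-- A machine state: the contents of the registers, and of the cells of the arrays. -/
@[ext]
structure State where
  reg : ℕ → ℕ
  arr : ℕ → ℕ → ℕ

/-- Assign `v` to the register `x`. -/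
def State.setReg (s : State) (x v : ℕ) : State :=
  ⟨Function.update s.reg x v, s.arr⟩

/-- Store `v` in cell `i` of the array `a`. -/
def State.setArr (s : State) (a i v : ℕ) : State :=
  ⟨s.reg, Function.update s.arr a (Function.update (s.arr a) i v)⟩

/-- The value of an expression. -/
def Term.eval (s : State) : Term → ℕ
  | const n => n
  | reg x => s.reg x
  | read a e => s.arr a (e.eval s)
  | bin o e₁ e₂ => o.apply (e₁.eval s) (e₂.eval s)

/-- The time to evaluate an expression: the number of its nodes. -/
def Term.cost : Term → ℕ
  | const _ => 1
  | reg _ => 1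
  | read _ e => e.cost + 1
  | bin _ e₁ e₂ => e₁.cost + e₂.cost + 1

/-- No value that occurs in the evaluation of the expression exceeds the word bound `B`. -/
def Term.Fits (B : ℕ) (s : State) : Term → Prop
  | const n => n ≤ B
  | reg x => s.reg x ≤ B
  | read a e => e.Fits B s ∧ s.arr a (e.eval s) ≤ B
  | bin o e₁ e₂ => e₁.Fits B s ∧ e₂.Fits B s ∧ o.apply (e₁.eval s) (e₂.eval s) ≤ B

/-- Programs. Conditions are expressions, with nonzero meaning true. -/
inductive Prog where
  | skip
  | assign (x : ℕ) (e : Term)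
  | store (a : ℕ) (i e : Term)
  | seq (p q : Prog)
  | branch (e : Term) (p q : Prog)
  | loop (e : Term) (p : Prog)

/-- `Exec B p s s' t`: with word bound `B`, the program `p` started in state `s` halts in state `s'`
after time `t`. An execution in which some value exceeds `B` is stuck. -/
inductive Exec (B : ℕ) : Prog → State → State → ℕ → Prop
  | skip (s : State) : Exec B .skip s s 1
  | assign (s : State) (x : ℕ) (e : Term) (he : e.Fits B s) :
      Exec B (.assign x e) s (s.setReg x (e.eval s)) (e.cost + 1)
  | store (s : State) (a : ℕ) (i e : Term) (hi : i.Fits B s) (he : e.Fits B s) :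
      Exec B (.store a i e) s (s.setArr a (i.eval s) (e.eval s)) (i.cost + e.cost + 1)
  | seq {p q : Prog} {s s' s'' : State} {t t' : ℕ}
      (hp : Exec B p s s' t) (hq : Exec B q s' s'' t') :
      Exec B (.seq p q) s s'' (t + t')
  | branch_true {e : Term} {p q : Prog} {s s' : State} {t : ℕ} (he : e.Fits B s)
      (h : e.eval s ≠ 0) (hp : Exec B p s s' t) :
      Exec B (.branch e p q) s s' (e.cost + 1 + t)
  | branch_false {e : Term} {p q : Prog} {s s' : State} {t : ℕ} (he : e.Fits B s)
      (h : e.eval s = 0) (hq : Exec B q s s' t) :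
      Exec B (.branch e p q) s s' (e.cost + 1 + t)
  | loop_done {e : Term} {p : Prog} {s : State} (he : e.Fits B s) (h : e.eval s = 0) :
      Exec B (.loop e p) s s (e.cost + 1)
  | loop_step {e : Term} {p : Prog} {s s' s'' : State} {t t' : ℕ} (he : e.Fits B s)
      (h : e.eval s ≠ 0) (hp : Exec B p s s' t) (hl : Exec B (.loop e p) s' s'' t') :
      Exec B (.loop e p) s s'' (e.cost + 1 + t + t')

/-! ## Solving instances on the machine -/

/-- The number of a grid vertex in the (mixed radix) enumeration of the vertices by
`0, …, |V| - 1`. -/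
def vertexCode {k : ℕ} {m : Fin k → ℕ} (v : GridVertex m) : ℕ := (finPiFinEquiv v : ℕ)

/-- The contents of an array holding the list `f 0, …, f (n-1)`, all other cells being zero. -/
def tabulate {n : ℕ} (f : Fin n → ℕ) : ℕ → ℕ := fun i => if h : i < n then f ⟨i, h⟩ else 0

/-- The initial state for the instance `(G, XI, XG)`: register `0` holds the dimension `k`, array
`0` the side lengths, arrays `1` and `2` the initial and goal vertices of the robots. Everything
else is zero. -/
def inputState {k : ℕ} (m : Fin k → ℕ) (XI XG : GridConfig m) : State where
  reg x := if x = 0 then k else 0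
  arr a :=
    if a = 0 then tabulate m
    else if a = 1 then tabulate (fun r => vertexCode (XI r))
    else if a = 2 then tabulate (fun r => vertexCode (XG r))
    else fun _ => 0

/-- The state `s` contains the sequence `X 0, …, X T` as output: register `0` holds `T`, and array
`3` holds, one configuration after the other, the vertices of all robots. -/
def IsOutput {k : ℕ} {m : Fin k → ℕ} (s : State) (T : ℕ) (X : ℕ → GridConfig m) : Prop :=
  s.reg 0 = T ∧
  ∀ t ≤ T, ∀ r : Fin (gridSize m), s.arr 3 (t * gridSize m + r) = vertexCode (X t r)

/-- With word bound `B`, the program `p` halts on the instance `(G, XI, XG)` within time at most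
`τ`, and outputs a solution of makespan at most `μ`. -/
def Solves (B : ℕ) (p : Prog) {k : ℕ} (m : Fin k → ℕ) (XI XG : GridConfig m) (μ τ : ℝ) : Prop :=
  ∃ (s : State) (t T : ℕ) (X : ℕ → GridConfig m),
    Exec B p (inputState m XI XG) s t ∧ (t : ℝ) ≤ τ ∧
    IsOutput s T X ∧ IsSolution (gridGraph m) XI XG T X ∧ (T : ℝ) ≤ μ

end MPP

/-! The robots are routed by halving blocks. Let σ be a power of two that is at least every side and
at most twice the largest one. The grid is cut into blocks, at first a single one, whose sides are
halved one coordinate at a time, and every robot is kept in the block of its goal; once the blocks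
are single vertices, all robots have arrived. At the level with block side σ each of the k halvings
takes k phases of O(σ) moves, so the level costs O(k² σ) moves, and the sum over σ, σ/2, σ/4, … is
geometric. Every move is written out in time O(N) for N = |V|, and the largest side is O(N^(1/k)),
which gives both bounds; for k = 2 and k = 3 the factor k² is absorbed by the constant.

Halving coordinate i gives each robot a bit: the half of its block in which its goal lies. A phase
permutes the robots within lines of one direction. In the phases in directions j ≠ i the robots with
bit 0 are spread evenly over the values of coordinate j, so that every slice of a block receives as
many of them as it has vertices in the first half (`Balanced.phase`). Afterwards every line in
direction i contains the right number of zeros, and a last phase in direction i moves them to the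
front (`Balanced.final`). The spreading is a round robin over all robots of a group. It can be
realised inside lines because zeros are dealt forwards and ones backwards, so that the robots of one
segment get distinct places (`Segments.dest_inj`).

A phase is a sorting problem in all segments at once. A boustrophedon enumeration of the other
coordinates makes the lines in direction j the rows of a two-dimensional array that is a subgraph of
the grid (`cellVertex_adj`). Two neighbours cannot be exchanged in one move, but in a ladder of six
cells at most five rotations along cycles exchange the ends of any edge and restore the other cells
(`ladderRun_five`). The 126 classes of disjoint ladders cover all edges inside rows
(`BlockClass.exists_covers`), so a round of compare-exchange steps costs 126 · 5 = 630 moves. A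
threshold argument as for odd-even transposition sort shows that 2σ rounds sort segments of length
at most σ (`SortInv.step`, `SortInv.sorted`).

The program is verified in a weakest-precondition calculus in which all cells stay below W = N^9.
Its expressions have at most 100 nodes, so no intermediate value exceeds W^100. -/

namespace MPP

/-! ## A weakest-precondition calculus for the word RAM -/

/-- All cells of the state are bounded by `W`. -/
structure Bdd (W : ℕ) (s : State) : Prop where
  reg : ∀ x, s.reg x ≤ W
  arr : ∀ a i, s.arr a i ≤ W

/-- All constants of the expression are at most `1000`. -/
def Term.smallConsts : Term → Bool
  | .const n => decide (n ≤ 1000)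
  | .reg _ => true
  | .read _ e => e.smallConsts
  | .bin _ e₁ e₂ => e₁.smallConsts && e₂.smallConsts

/-- The expression has small constants and at most `100` nodes. -/
def Term.small (e : Term) : Bool := e.smallConsts && decide (e.cost ≤ 100)

/-- All expressions of the program are small. -/
def Prog.small : Prog → Bool
  | .skip => true
  | .assign _ e => e.small
  | .store _ i e => i.small && e.small
  | .seq p q => p.small && q.small
  | .branch e p q => e.small && p.small && q.small
  | .loop e p => e.small && p.small

theorem Term.one_le_cost (e : Term) : 1 ≤ e.cost := by
  cases e <;> simp [Term.cost]

/-- The bounds `A` and `B` have to be at least 2 for their product to dominate a sum. -/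
theorem Op.apply_le {o : Op} {a b A B : ℕ} (ha : a ≤ A) (hb : b ≤ B) (hA : 2 ≤ A) (hB : 2 ≤ B) :
    o.apply a b ≤ A * B := by
  have h1 : a ≤ A * B := ha.trans (Nat.le_mul_of_pos_right _ (by omega))
  have h2 : 1 ≤ A * B := Nat.mul_pos (by omega) (by omega)
  cases o <;> simp only [Op.apply]
  · nlinarith
  · omega
  · exact Nat.mul_le_mul ha hb
  · exact (Nat.div_le_self _ _).trans h1
  · exact (Nat.mod_le _ _).trans h1
  · split_ifs <;> omega
  · split_ifs <;> omega

/-- Each operation at most multiplies the bounds of its operands, so a tree with n nodes evaluates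
to at most W^n. The separate exponent `d` lets all subexpressions share the word bound of the whole
expression. -/
theorem Term.eval_le_fits {W d : ℕ} {s : State} (hW : 1000 ≤ W) (hs : Bdd W s) (e : Term)
    (hc : e.smallConsts = true) (hd : e.cost ≤ d) :
    e.eval s ≤ W ^ e.cost ∧ e.Fits (W ^ d) s := by
  have mono : ∀ {a b : ℕ}, a ≤ b → W ^ a ≤ W ^ b := fun h => Nat.pow_le_pow_right (by omega) h
  have hWd : W ≤ W ^ d := by simpa using mono ((Term.one_le_cost e).trans hd)
  induction e with
  | const n =>
    simp only [Term.smallConsts, decide_eq_true_eq] at hc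
    simp only [Term.eval, Term.cost, Term.Fits, pow_one]
    omega
  | reg x =>
    have := hs.reg x
    simp only [Term.eval, Term.cost, Term.Fits, pow_one]
    omega
  | read a e ih =>
    simp only [Term.cost] at hd
    have h := ih hc (by omega)
    have := hs.arr a (e.eval s)
    have h3 : W ≤ W ^ (e.cost + 1) := by simpa using mono (show 1 ≤ e.cost + 1 by omega)
    exact ⟨this.trans h3, h.2, by omega⟩
  | bin o e₁ e₂ ih₁ ih₂ =>
    simp only [Term.smallConsts, Bool.and_eq_true] at hc
    simp only [Term.cost] at hd
    have h₁ := ih₁ hc.1 (by omega)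
    have h₂ := ih₂ hc.2 (by omega)
    have two : ∀ e : Term, 2 ≤ W ^ e.cost := fun e => by
      have := mono (Term.one_le_cost e)
      simp only [pow_one] at this
      omega
    have h := Op.apply_le (o := o) h₁.1 h₂.1 (two e₁) (two e₂)
    rw [← pow_add] at h
    exact ⟨h.trans (mono (by simp [Term.cost])), h₁.2, h₂.2, h.trans (mono (by omega))⟩

theorem Term.small.fits {W : ℕ} {s : State} (hW : 1000 ≤ W) (hs : Bdd W s) {e : Term}
    (he : e.small = true) : e.Fits (W ^ 100) s := by
  simp only [Term.small, Bool.and_eq_true, decide_eq_true_eq] at he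
  exact (e.eval_le_fits hW hs he.1 he.2).2

theorem Bdd.setReg {W : ℕ} {s : State} (hs : Bdd W s) {x v : ℕ} (hv : v ≤ W) :
    Bdd W (s.setReg x v) :=
  ⟨fun y => by
    simp only [State.setReg, Function.update_apply]
    split_ifs
    exacts [hv, hs.reg y], hs.arr⟩

theorem Bdd.setArr {W : ℕ} {s : State} (hs : Bdd W s) {a i v : ℕ} (hv : v ≤ W) :
    Bdd W (s.setArr a i v) :=
  ⟨hs.reg, fun b j => by
    simp only [State.setArr, Function.update_apply]
    split_ifs
    · simp only [Function.update_apply]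
      split_ifs
      exacts [hv, hs.arr a j]
    · exact hs.arr b j⟩

/-- With all cells bounded by `W`, the program halts within time `τ` in a state satisfying `Q`, and
with all cells bounded by `W`. -/
def Wp (W : ℕ) (p : Prog) (τ : ℕ) (Q : State → Prop) (s : State) : Prop :=
  Bdd W s → ∃ s' t, Exec (W ^ 100) p s s' t ∧ t ≤ τ ∧ Bdd W s' ∧ Q s'

theorem Wp.mono {W : ℕ} {p : Prog} {τ τ' : ℕ} {Q Q' : State → Prop} {s : State}
    (h : Wp W p τ Q s) (hτ : τ ≤ τ') (hQ : ∀ s', Bdd W s' → Q s' → Q' s') : Wp W p τ' Q' s := fun hs =>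
  let ⟨s', t, h1, h2, h3, h4⟩ := h hs
  ⟨s', t, h1, h2.trans hτ, h3, hQ s' h3 h4⟩

theorem Wp.seq {W : ℕ} {p q : Prog} {τ τ' : ℕ} {Q R : State → Prop} {s : State}
    (hp : Wp W p τ R s) (hq : ∀ s', R s' → Wp W q τ' Q s') :
    Wp W (.seq p q) (τ + τ') Q s := fun hs =>
  let ⟨_, _, h1, h2, h3, h4⟩ := hp hs
  let ⟨s'', _, k1, k2, k3, k4⟩ := hq _ h4 h3
  ⟨s'', _, .seq h1 k1, Nat.add_le_add h2 k2, k3, k4⟩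

theorem Wp.bdd {W : ℕ} {p : Prog} {τ : ℕ} {Q : State → Prop} {s : State}
    (h : Bdd W s → Wp W p τ Q s) : Wp W p τ Q s := fun hs => h hs hs

/-- The weakest precondition of a loop-free program. -/
def Prog.vc (W : ℕ) : Prog → (State → Prop) → State → Prop
  | .skip, Q, s => Q s
  | .assign x e, Q, s => e.eval s ≤ W ∧ Q (s.setReg x (e.eval s))
  | .store a i e, Q, s => e.eval s ≤ W ∧ Q (s.setArr a (i.eval s) (e.eval s))
  | .seq p q, Q, s => p.vc W (q.vc W Q) s
  | .branch e p q, Q, s => (e.eval s ≠ 0 → p.vc W Q s) ∧ (e.eval s = 0 → q.vc W Q s)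
  | .loop _ _, _, _ => False

/-- A bound for the time of a loop-free program. -/
def Prog.time : Prog → ℕ
  | .skip => 1
  | .assign _ e => e.cost + 1
  | .store _ i e => i.cost + e.cost + 1
  | .seq p q => p.time + q.time
  | .branch e p q => e.cost + 1 + (p.time + q.time)
  | .loop _ _ => 0

/-- Only stored values have to be compared with `W`; intermediate values are taken care of by
`Term.small.fits`. -/
theorem Wp.block {W : ℕ} (hW : 1000 ≤ W) {p : Prog} {Q : State → Prop} {s : State}
    (hp : p.small = true) (h : p.vc W Q s) : Wp W p p.time Q s := by
  induction p generalizing Q s with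
  | skip => exact fun hs => ⟨s, 1, .skip s, le_rfl, hs, h⟩
  | assign x e =>
    exact fun hs => ⟨_, _, .assign s x e (Term.small.fits hW hs hp), le_rfl, hs.setReg h.1, h.2⟩
  | store a i e =>
    simp only [Prog.small, Bool.and_eq_true] at hp
    exact fun hs => ⟨_, _, .store s a i e (Term.small.fits hW hs hp.1) (Term.small.fits hW hs hp.2),
      le_rfl, hs.setArr h.1, h.2⟩
  | seq p q ihp ihq =>
    simp only [Prog.small, Bool.and_eq_true] at hp
    exact Wp.seq (ihp hp.1 h) (fun s' h' => ihq hp.2 h')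
  | branch e p q ihp ihq =>
    simp only [Prog.small, Bool.and_eq_true] at hp
    intro hs
    by_cases he : e.eval s = 0
    · obtain ⟨s', t, h1, h2, h3⟩ := ihq hp.2 (h.2 he) hs
      exact ⟨s', _, .branch_false (Term.small.fits hW hs hp.1.1) he h1,
        by simp only [Prog.time]; omega, h3⟩
    · obtain ⟨s', t, h1, h2, h3⟩ := ihp hp.1.2 (h.1 he) hs
      exact ⟨s', _, .branch_true (Term.small.fits hW hs hp.1.1) he h1,
        by simp only [Prog.time]; omega, h3⟩
  | loop e p => exact h.elim

theorem Wp.branch {W : ℕ} (hW : 1000 ≤ W) {e : Term} {p q : Prog} {τ : ℕ} {Q : State → Prop}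
    {s : State} (he : e.small = true) (hp : e.eval s ≠ 0 → Wp W p τ Q s)
    (hq : e.eval s = 0 → Wp W q τ Q s) : Wp W (.branch e p q) (101 + τ) Q s := by
  intro hs
  have hc : e.cost ≤ 100 := by
    simp only [Term.small, Bool.and_eq_true, decide_eq_true_eq] at he
    exact he.2
  by_cases h : e.eval s = 0
  · obtain ⟨s', t, h1, h2, h3⟩ := hq h hs
    exact ⟨s', _, .branch_false (Term.small.fits hW hs he) h h1, by omega, h3⟩
  · obtain ⟨s', t, h1, h2, h3⟩ := hp h hs
    exact ⟨s', _, .branch_true (Term.small.fits hW hs he) h h1, by omega, h3⟩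

/-- The registers written by a program. -/
def Prog.wr : Prog → List ℕ
  | .skip => []
  | .assign x _ => [x]
  | .store _ _ _ => []
  | .seq p q => p.wr ++ q.wr
  | .branch _ p q => p.wr ++ q.wr
  | .loop _ p => p.wr

/-- The arrays written by a program. -/
def Prog.wa : Prog → List ℕ
  | .skip => []
  | .assign _ _ => []
  | .store a _ _ => [a]
  | .seq p q => p.wa ++ q.wa
  | .branch _ p q => p.wa ++ q.wa
  | .loop _ p => p.wa

/-- The states agree outside the registers `L` and the arrays `K`. -/
structure Agree (L K : List ℕ) (s s' : State) : Prop where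
  reg : ∀ x, x ∉ L → s'.reg x = s.reg x
  arr : ∀ a, a ∉ K → s'.arr a = s.arr a

theorem Agree.refl (L K : List ℕ) (s : State) : Agree L K s s := ⟨fun _ _ => rfl, fun _ _ => rfl⟩

theorem Agree.trans {L K : List ℕ} {s s' s'' : State} (h : Agree L K s s') (h' : Agree L K s' s'') :
    Agree L K s s'' :=
  ⟨fun x hx => (h'.reg x hx).trans (h.reg x hx), fun a ha => (h'.arr a ha).trans (h.arr a ha)⟩

theorem Agree.mono {L K L' K' : List ℕ} {s s' : State} (h : Agree L K s s') (hL : L ⊆ L')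
    (hK : K ⊆ K') : Agree L' K' s s' :=
  ⟨fun x hx => h.reg x fun hx' => hx (hL hx'), fun a ha => h.arr a fun ha' => ha (hK ha')⟩

theorem Agree.setReg {L K : List ℕ} (s : State) {x v : ℕ} (hx : x ∈ L) :
    Agree L K s (s.setReg x v) :=
  ⟨fun y hy => by
    simp only [State.setReg]
    exact Function.update_of_ne (by rintro rfl; exact hy hx) _ _, fun _ _ => rfl⟩

theorem Exec.agree {B : ℕ} {p : Prog} {s s' : State} {t : ℕ} (h : Exec B p s s' t) :
    Agree p.wr p.wa s s' := by
  induction h with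
  | skip s => exact Agree.refl _ _ _
  | assign s x e _ => exact Agree.setReg s (by simp [Prog.wr])
  | store s a i e _ _ =>
    refine ⟨fun _ _ => rfl, fun b hb => ?_⟩
    simp only [Prog.wa, List.mem_singleton] at hb
    simp only [State.setArr]
    exact Function.update_of_ne hb _ _
  | seq _ _ ihp ihq =>
    exact (ihp.mono (by simp [Prog.wr]) (by simp [Prog.wa])).trans
      (ihq.mono (by simp [Prog.wr]) (by simp [Prog.wa]))
  | branch_true _ _ _ ih => exact ih.mono (by simp [Prog.wr]) (by simp [Prog.wa])
  | branch_false _ _ _ ih => exact ih.mono (by simp [Prog.wr]) (by simp [Prog.wa])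
  | loop_done _ _ => exact Agree.refl _ _ _
  | loop_step _ _ _ _ ihp ihl => exact Agree.trans ihp ihl

/-- The frame rule. The written registers and arrays are computed from the program text, so the side
conditions can be decided. -/
theorem Wp.agree {W : ℕ} {p : Prog} {τ : ℕ} {Q : State → Prop} {s : State} (L K : List ℕ)
    (h : Wp W p τ Q s) (hL : p.wr ⊆ L := by decide) (hK : p.wa ⊆ K := by decide) :
    Wp W p τ (fun s' => Agree L K s s' ∧ Q s') s := fun hs =>
  let ⟨s', t, h1, h2, h3, h4⟩ := h hs
  ⟨s', t, h1, h2, h3, h1.agree.mono hL hK, h4⟩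

/-- The number `n` of iterations is known beforehand and indexes the invariant, which yields
termination and the time bound together. -/
theorem Wp.while {W : ℕ} (hW : 1000 ≤ W) {e : Term} {body : Prog} {s : State}
    (he : e.small = true) {I : ℕ → State → Prop} {n τ : ℕ} (h0 : I 0 s)
    (htrue : ∀ j < n, ∀ s', I j s' → e.eval s' ≠ 0)
    (hfalse : ∀ s', I n s' → e.eval s' = 0)
    (hstep : ∀ j < n, ∀ s', I j s' → Wp W body τ (I (j + 1)) s') :
    Wp W (.loop e body) ((n + 1) * (τ + 101)) (I n) s := by
  have hc : e.cost ≤ 100 := by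
    simp only [Term.small, Bool.and_eq_true, decide_eq_true_eq] at he
    exact he.2
  suffices H : ∀ d j s', j + d = n → I j s' →
      Wp W (.loop e body) ((d + 1) * (τ + 101)) (I n) s' from H n 0 s (by omega) h0
  intro d
  induction d with
  | zero =>
    intro j s' hj hI hs'
    obtain rfl : j = n := by omega
    exact ⟨s', _, .loop_done (Term.small.fits hW hs' he) (hfalse s' hI), by omega, hs', hI⟩
  | succ d ih =>
    intro j s' hj hI hs'
    obtain ⟨s₁, t₁, h1, h2, h3, h4⟩ := hstep j (by omega) s' hI hs'
    obtain ⟨s₂, t₂, k1, k2, k3, k4⟩ := ih (j + 1) s₁ (by omega) h4 h3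
    exact ⟨s₂, _, .loop_step (Term.small.fits hW hs' he) (htrue j (by omega) s' hI) h1 k1,
      by linarith, k3, k4⟩

/-! ### Arithmetic notation for expressions, and counting loops -/

instance : Add Term := ⟨.bin .add⟩
instance : Sub Term := ⟨.bin .sub⟩
instance : Mul Term := ⟨.bin .mul⟩
instance : Div Term := ⟨.bin .div⟩
instance : Mod Term := ⟨.bin .mod⟩
instance (n : ℕ) : OfNat Term n := ⟨.const n⟩

@[simp] theorem Term.eval_ofNat (s : State) (n : ℕ) :
    Term.eval s (no_index (OfNat.ofNat n)) = n := rfl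
@[simp] theorem Term.eval_const (s : State) (n : ℕ) : Term.eval s (.const n) = n := rfl
@[simp] theorem Term.eval_reg (s : State) (x : ℕ) : Term.eval s (.reg x) = s.reg x := rfl
@[simp] theorem Term.eval_read (s : State) (a : ℕ) (e : Term) :
    Term.eval s (.read a e) = s.arr a (e.eval s) := rfl
@[simp] theorem Term.eval_add (s : State) (e f : Term) : (e + f).eval s = e.eval s + f.eval s := rfl
@[simp] theorem Term.eval_sub (s : State) (e f : Term) : (e - f).eval s = e.eval s - f.eval s := rfl
@[simp] theorem Term.eval_mul (s : State) (e f : Term) : (e * f).eval s = e.eval s * f.eval s := rfl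
@[simp] theorem Term.eval_div (s : State) (e f : Term) : (e / f).eval s = e.eval s / f.eval s := rfl
@[simp] theorem Term.eval_mod (s : State) (e f : Term) : (e % f).eval s = e.eval s % f.eval s := rfl
@[simp] theorem Term.eval_lt (s : State) (e f : Term) :
    Term.eval s (.bin .lt e f) = if e.eval s < f.eval s then 1 else 0 := rfl
@[simp] theorem Term.eval_eq (s : State) (e f : Term) :
    Term.eval s (.bin .eq e f) = if e.eval s = f.eval s then 1 else 0 := rfl

@[simp] theorem State.setReg_reg (s : State) (x v y : ℕ) :
    (s.setReg x v).reg y = if y = x then v else s.reg y := by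
  simp [State.setReg, Function.update_apply]
@[simp] theorem State.setReg_arr (s : State) (x v : ℕ) : (s.setReg x v).arr = s.arr := rfl
@[simp] theorem State.setArr_reg (s : State) (a i v : ℕ) : (s.setArr a i v).reg = s.reg := rfl
@[simp] theorem State.setArr_arr (s : State) (a i v b : ℕ) :
    (s.setArr a i v).arr b =
      if b = a then Function.update (s.arr a) i v else s.arr b := by
  simp [State.setArr, Function.update_apply]

/-- `for x < e do body`. -/
def Prog.for (x : ℕ) (e : Term) (body : Prog) : Prog :=
  .seq (.assign x 0) (.loop (.bin .lt (.reg x) e) (.seq body (.assign x (.reg x + 1))))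

/-- The body may not write to the loop variable `x`, and the invariant may not depend on it. -/
theorem Wp.for {W : ℕ} (hW : 1000 ≤ W) {x : ℕ} {e : Term} {body : Prog} {s : State}
    (L K : List ℕ) (I : ℕ → State → Prop) (n τ : ℕ) (hnW : n ≤ W)
    (hstep : ∀ j < n, ∀ s', Agree (x :: L) K s s' → s'.reg x = j → I j s' →
      Wp W body τ (I (j + 1)) s')
    (h0 : I 0 s)
    (hn : ∀ s', Agree (x :: L) K s s' → e.eval s' = n)
    (hI : ∀ j v s', I j s' → I j (s'.setReg x v))
    (he : (Term.bin .lt (.reg x) e).small = true := by decide)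
    (hx : x ∉ body.wr := by decide)
    (hL : body.wr ⊆ L := by decide) (hK : body.wa ⊆ K := by decide) :
    Wp W (.for x e body) ((n + 1) * (τ + 110))
      (fun s' => Agree (x :: L) K s s' ∧ s'.reg x = n ∧ I n s') s := by
  have H : Wp W (.loop (.bin .lt (.reg x) e) (.seq body (.assign x (.reg x + 1))))
      ((n + 1) * (τ + 4 + 101)) (fun s' => Agree (x :: L) K s s' ∧ s'.reg x = n ∧ I n s')
      (s.setReg x 0) := by
    refine Wp.while hW he (I := fun j s' => Agree (x :: L) K s s' ∧ s'.reg x = j ∧ I j s')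
      ⟨Agree.setReg s (by simp), by simp, hI _ _ _ h0⟩ ?_ ?_ ?_
    · rintro j hj s' ⟨h1, h2, h3⟩
      simp [hn s' h1, h2, hj]
    · rintro s' ⟨h1, h2, h3⟩
      simp [hn s' h1, h2]
    · rintro j hj s' ⟨h1, h2, h3⟩
      refine Wp.seq (Wp.agree body.wr K (hstep j hj s' h1 h2 h3) (List.Subset.refl _) hK) ?_
      rintro s₁ ⟨k1, k2⟩
      have hx1 : s₁.reg x = j := (k1.reg x hx).trans h2
      refine (Wp.block hW (p := .assign x (.reg x + 1)) rfl ?_)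
      refine ⟨by simp [hx1]; omega, ?_⟩
      refine ⟨(h1.trans (k1.mono ?_ (List.Subset.refl _))).trans (Agree.setReg _ (by simp)),
        by simp [hx1], hI _ _ _ k2⟩
      exact fun y hy => List.mem_cons_of_mem _ (hL hy)
  refine Wp.mono (Wp.seq (τ := 2) (τ' := (n + 1) * (τ + 4 + 101)) (R := fun s' => s' = s.setReg x 0)
    (Wp.block hW (p := .assign x 0) (s := s) rfl ⟨by simp, rfl⟩) ?_) ?_ (fun _ _ h => h)
  · rintro s' rfl
    exact H
  · nlinarith

/-! ## Sorting by parallel compare-exchange steps -/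

/-- `p` and `a` are mutually inverse permutations of `0, …, N - 1`. -/
structure InvPair (N : ℕ) (p a : ℕ → ℕ) : Prop where
  lt : ∀ r < N, p r < N
  lt' : ∀ z < N, a z < N
  right : ∀ z < N, p (a z) = z
  left : ∀ r < N, a (p r) = r

theorem InvPair.inj {N : ℕ} {p a : ℕ → ℕ} (h : InvPair N p a) {r r' : ℕ} (hr : r < N) (hr' : r' < N)
    (e : p r = p r') : r = r' := by
  rw [← h.left r hr, e, h.left r' hr']

theorem InvPair.symm {N : ℕ} {p a : ℕ → ℕ} (h : InvPair N p a) : InvPair N a p :=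
  ⟨h.lt', h.lt, h.left, h.right⟩

theorem InvPair.image {N : ℕ} {p a : ℕ → ℕ} (h : InvPair N p a) :
    (Finset.range N).image p = Finset.range N := by
  ext z
  simp only [Finset.mem_image, Finset.mem_range]
  exact ⟨fun ⟨r, hr, e⟩ => e ▸ h.lt r hr, fun hz => ⟨a z, h.lt' z hz, h.right z hz⟩⟩

theorem InvPair.of_inj {N : ℕ} {p : ℕ → ℕ} (h : ∀ r < N, p r < N)
    (hi : ∀ r < N, ∀ r' < N, p r = p r' → r = r') : ∃ a, InvPair N p a := by
  have hs : ∀ z < N, ∃ r < N, p r = z := by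
    have : (Finset.range N).image p = Finset.range N := by
      apply Finset.eq_of_subset_of_card_le
      · intro z
        simp only [Finset.mem_image, Finset.mem_range]
        exact fun ⟨r, hr, e⟩ => e ▸ h r hr
      · rw [Finset.card_image_of_injOn]
        intro r hr r' hr' e
        simp only [Finset.coe_range, Set.mem_Iio] at hr hr'
        exact hi r hr r' hr' e
    intro z hz
    have hz' := Finset.mem_range.2 hz
    rw [← this, Finset.mem_image] at hz'
    obtain ⟨r, hr, e⟩ := hz'
    exact ⟨r, Finset.mem_range.1 hr, e⟩
  refine ⟨fun z => if hz : z < N then (hs z hz).choose else 0, h, ?_, ?_, ?_⟩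
  · intro z hz
    simp only [hz, dif_pos]
    exact (hs z hz).choose_spec.1
  · intro z hz
    simp only [hz, dif_pos]
    exact (hs z hz).choose_spec.2
  · intro r hr
    simp only [h r hr, dif_pos]
    exact hi _ (hs _ (h r hr)).choose_spec.1 _ hr (hs _ (h r hr)).choose_spec.2

theorem InvPair.card_ge {N : ℕ} {p a : ℕ → ℕ} (h : InvPair N p a) (q : ℕ) :
    ((Finset.range N).filter fun r => q ≤ p r).card = N - q := by
  rw [← Nat.card_Ico, ← Finset.card_image_of_injOn (f := p)]
  · congr 1
    ext z
    simp only [Finset.mem_image, Finset.mem_filter, Finset.mem_range, Finset.mem_Ico]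
    exact ⟨fun ⟨r, ⟨hr, hq⟩, e⟩ => e ▸ ⟨hq, h.lt r hr⟩,
      fun ⟨h1, h2⟩ => ⟨a z, ⟨h.lt' z h2, (h.right z h2).symm ▸ h1⟩, h.right z h2⟩⟩
  · intro r hr r' hr' e
    simp only [Finset.coe_filter, Finset.mem_range, Set.mem_ofPred_eq] at hr hr'
    exact h.inj hr.1 hr'.1 e

/-- The items at positions from `q` on whose destination is at least `θ`. -/
def heavy (N : ℕ) (D p : ℕ → ℕ) (θ q : ℕ) : Finset ℕ :=
  (Finset.range N).filter fun r => q ≤ p r ∧ θ ≤ D r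

theorem mem_heavy {N : ℕ} {D p : ℕ → ℕ} {θ q r : ℕ} :
    r ∈ heavy N D p θ q ↔ r < N ∧ q ≤ p r ∧ θ ≤ D r := by
  simp [heavy]

/-- Some disjoint pairs of items that are in the wrong order are exchanged, among them all such
pairs at neighbouring positions `z`, `z + 1` with `E z`. -/
structure SortStep (N : ℕ) (D p p' : ℕ → ℕ) (E : ℕ → Prop) : Prop where
  swap : ∀ r < N, p' r = p r ∨ ∃ r' < N, p' r = p r' ∧ p' r' = p r ∧
    ((p r < p r' ∧ D r' < D r) ∨ (p r' < p r ∧ D r < D r'))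
  cov : ∀ r < N, ∀ r' < N, p r' = p r + 1 → D r' < D r → E (p r) → p' r = p r + 1

/-- An item that an exchange moves below `q` is replaced by its partner, whose destination is
larger. Sending each such item to its partner, and every other item to itself, is therefore an
injection of the old heavy set into the new one. The final alternative is recorded for
`SortStep.card_lt`. -/
theorem SortStep.exists_map {N : ℕ} {D p p' a' : ℕ → ℕ} {E : ℕ → Prop}
    (h : SortStep N D p p' E) (hp' : InvPair N p' a') (θ q : ℕ) :
    ∃ f : ℕ → ℕ, Set.InjOn f (heavy N D p θ q) ∧ ∀ r ∈ heavy N D p θ q,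
      f r ∈ heavy N D p' θ q ∧ (f r = r ∨ p' (f r) = p r) := by
  classical
  have key : ∀ r ∈ heavy N D p θ q, ∃ r', r' ∈ heavy N D p' θ q ∧
      ((r' = r ∧ q ≤ p' r) ∨ (p' r' = p r ∧ p' r = p r' ∧ p' r < q)) := by
    intro r hr
    rw [mem_heavy] at hr
    by_cases hq : q ≤ p' r
    · exact ⟨r, mem_heavy.2 ⟨hr.1, hq, hr.2.2⟩, Or.inl ⟨rfl, hq⟩⟩
    · rcases h.swap r hr.1 with h1 | ⟨r', h1, h2, h3, h4⟩
      · omega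
      · exact ⟨r', mem_heavy.2 ⟨h1, by omega, by omega⟩, Or.inr ⟨h3, h2, by omega⟩⟩
  choose! f hf using key
  refine ⟨f, ?_, fun r hr => ⟨(hf r hr).1, ?_⟩⟩
  · intro r hr r' hr' e
    have h1 := hf r hr
    have h2 := hf r' hr'
    rw [← e] at h2
    have hr := mem_heavy.1 hr
    have hr' := mem_heavy.1 hr'
    rcases h1.2 with ⟨k1, k2⟩ | ⟨k1, k2, k3⟩ <;> rcases h2.2 with ⟨l1, l2⟩ | ⟨l1, l2, l3⟩
    · omega
    · rw [k1] at l2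
      omega
    · rw [l1] at k2
      omega
    · exact hp'.inj hr.1 hr'.1 (k2.trans l2.symm)
  · rcases (hf r hr).2 with h1 | h1
    exacts [Or.inl h1.1, Or.inr h1.1]

theorem SortStep.card_le {N : ℕ} {D p p' a' : ℕ → ℕ} {E : ℕ → Prop}
    (h : SortStep N D p p' E) (hp' : InvPair N p' a') (θ q : ℕ) :
    (heavy N D p θ q).card ≤ (heavy N D p' θ q).card := by
  obtain ⟨f, hf, hf'⟩ := h.exists_map hp' θ q
  exact Finset.card_le_card_of_injOn f (fun r hr => (hf' r hr).1) hf

/-- The item `r` enters the region and is missed by the injection of `SortStep.exists_map`: it was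
outside the region before, and the item whose place it takes is `r'`, which is not heavy. -/
theorem SortStep.card_lt {N : ℕ} {D p p' a a' : ℕ → ℕ} {E : ℕ → Prop}
    (h : SortStep N D p p' E) (hp : InvPair N p a) (hp' : InvPair N p' a') {θ r r' : ℕ} (hr : r < N)
    (hr' : r' < N) (e : p r' = p r + 1) (hD : θ ≤ D r) (hD' : D r' < θ) (hE : E (p r)) :
    (heavy N D p θ (p r + 1)).card + 1 ≤ (heavy N D p' θ (p r + 1)).card := by
  have hm : p' r = p r + 1 := h.cov r hr r' hr' e (by omega) hE
  obtain ⟨f, hf, hf'⟩ := h.exists_map hp' θ (p r + 1)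
  rw [← Finset.card_erase_add_one (mem_heavy.2 ⟨hr, hm.ge, hD⟩ : r ∈ heavy N D p' θ (p r + 1))]
  refine Nat.add_le_add_right (Finset.card_le_card_of_injOn f (fun x hx => ?_) hf) 1
  have hx' := mem_heavy.1 hx
  refine Finset.mem_coe.2 (Finset.mem_erase.2 ⟨?_, (hf' x hx).1⟩)
  intro hfx
  rcases (hf' x hx).2 with h1 | h1
  · rw [hfx] at h1
    rw [← h1] at hx'
    omega
  · rw [hfx, hm, ← e] at h1
    have := hp.inj hr' hx'.1 h1
    rw [← this] at hx'
    omega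

theorem heavy_anti {N : ℕ} {D p : ℕ → ℕ} {θ q q' : ℕ} (h : q ≤ q') :
    heavy N D p θ q' ⊆ heavy N D p θ q := fun r hr => by
  rw [mem_heavy] at hr ⊢
  omega

/-- Progress of sorting after `τ` rounds and the first `κ` steps of the next round. -/
def SortInv (N : ℕ) (Seg : ℕ → ℕ → Prop) (E : ℕ → ℕ → Prop) (D p : ℕ → ℕ) (τ κ : ℕ) : Prop :=
  ∀ a b θ, Seg a b → a ≤ θ → θ < b →
    N - θ ≤ (heavy N D p θ a).card ∧ N - b ≤ (heavy N D p θ b).card ∧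
    ∀ q j, a ≤ q → q + j + 1 ≤ b → j + θ < b →
      (q + 2 * j ≤ a + τ ∨ (q + 2 * j ≤ a + τ + 1 ∧ a < q ∧ ∃ κ' < κ, E κ' (q - 1))) →
      N - b + j + 1 ≤ (heavy N D p θ q).card

/-- Before the first round the last clause concerns only `q = a` and `j = 0`. The counts hold since
items outside a segment are already on the correct side of it. -/
theorem SortInv.init {N : ℕ} {Seg : ℕ → ℕ → Prop} {E : ℕ → ℕ → Prop} {D d p a : ℕ → ℕ}
    (hD : InvPair N D d) (hp : InvPair N p a) (hb : ∀ a b, Seg a b → b ≤ N)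
    (ha : ∀ a b r, Seg a b → r < N → p r < a → D r < a)
    (hb' : ∀ a b r, Seg a b → r < N → b ≤ p r → b ≤ D r) : SortInv N Seg E D p 0 0 := by
  intro a b θ hs h1 h2
  have e1 : N - θ ≤ (heavy N D p θ a).card := by
    rw [← hD.card_ge θ]
    refine Finset.card_le_card fun r hr => ?_
    simp only [Finset.mem_filter, Finset.mem_range] at hr
    refine mem_heavy.2 ⟨hr.1, ?_, hr.2⟩
    by_contra h
    have := ha a b r hs hr.1 (by omega)
    omega
  refine ⟨e1, ?_, ?_⟩
  · rw [← hp.card_ge b]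
    refine Finset.card_le_card fun r hr => ?_
    simp only [Finset.mem_filter, Finset.mem_range] at hr
    have := hb' a b r hs hr.1 hr.2
    exact mem_heavy.2 ⟨hr.1, hr.2, by omega⟩
  · rintro q j h3 h4 h5 (h6 | ⟨_, _, _, h6, _⟩)
    · obtain rfl : q = a := by omega
      have := hb _ _ hs
      omega
    · omega

/-- The 0-1 argument for transposition sort, for all thresholds `θ` at once. The items from `b` on
are all heavy and account for `N - b`, so the clause says that at least `j + 1` heavy items of the
segment have reached the positions from `q` on. Each heavy item in front may delay the next one,
hence `q + 2 * j`. The bound for `q` in a new round follows from those for `q - 1` with `j` and `q +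
1` with `j - 1`: if it does not hold yet, the item at `q - 1` is heavy and the one at `q` is not,
and the step that covers this pair exchanges them. -/
theorem SortInv.step {N : ℕ} {Seg : ℕ → ℕ → Prop} {E : ℕ → ℕ → Prop} {D p p' a a' : ℕ → ℕ}
    {τ κ : ℕ} (h : SortInv N Seg E D p τ κ) (hp : InvPair N p a) (hp' : InvPair N p' a')
    (hb : ∀ a b, Seg a b → b ≤ N) (hs : SortStep N D p p' (E κ)) :
    SortInv N Seg E D p' τ (κ + 1) := by
  intro x b θ hS h1 h2
  have hbN := hb _ _ hS
  obtain ⟨i1, i2, i3⟩ := h x b θ hS h1 h2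
  refine ⟨i1.trans (hs.card_le hp' _ _), i2.trans (hs.card_le hp' _ _), ?_⟩
  intro q j h3 h4 h5 h6
  by_cases old : (q + 2 * j ≤ x + τ ∨ (q + 2 * j ≤ x + τ + 1 ∧ x < q ∧ ∃ κ' < κ, E κ' (q - 1)))
  · exact (i3 q j h3 h4 h5 old).trans (hs.card_le hp' _ _)
  push Not at old
  obtain ⟨o1, o2⟩ := old
  rcases h6 with h6 | ⟨h6, h7, κ', h8, h9⟩
  · omega
  have hκ : κ' = κ := by
    by_contra hne
    exact o2 h6 h7 κ' (by omega) h9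
  subst hκ
  -- the item just before `q` is heavy, the one at `q` is not, or the bound holds already
  by_cases done : N - b + j + 1 ≤ (heavy N D p θ q).card
  · exact done.trans (hs.card_le hp' _ _)
  have c1 : N - b + j + 1 ≤ (heavy N D p θ (q - 1)).card :=
    i3 (q - 1) j (by omega) (by omega) h5 (Or.inl (by omega))
  have c2 : N - b + j ≤ (heavy N D p θ (q + 1)).card := by
    rcases Nat.eq_zero_or_pos j with rfl | hj
    · exact i2.trans (Finset.card_le_card (heavy_anti (by omega)))
    · have := i3 (q + 1) (j - 1) (by omega) (by omega) (by omega) (Or.inl (by omega))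
      omega
  have c3 := Finset.card_le_card (heavy_anti (N := N) (D := D) (p := p) (θ := θ)
    (show q ≤ q + 1 by omega))
  have hq : q < N := by omega
  have hq' : q - 1 < N := by omega
  have e1 : θ ≤ D (a (q - 1)) := by
    by_contra hlt
    have : (heavy N D p θ (q - 1)) ⊆ heavy N D p θ q := fun r hr => by
      rw [mem_heavy] at hr ⊢
      refine ⟨hr.1, ?_, hr.2.2⟩
      by_contra hr'
      have : r = a (q - 1) := by
        rw [← hp.left r hr.1]
        congr 1
        omega
      rw [this] at hr
      omega
    have := Finset.card_le_card this
    omega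
  have e2 : D (a q) < θ := by
    by_contra hlt
    have m1 : a q ∈ heavy N D p θ q :=
      mem_heavy.2 ⟨hp.lt' q hq, (hp.right q hq).ge, by omega⟩
    have m2 : a q ∉ heavy N D p θ (q + 1) := fun hm => by
      have := (mem_heavy.1 hm).2.1
      rw [hp.right q hq] at this
      omega
    have := Finset.card_lt_card (Finset.ssubset_iff_subset_ne.2
      ⟨heavy_anti (N := N) (D := D) (p := p) (θ := θ) (show q ≤ q + 1 by omega),
        fun e => m2 (e ▸ m1)⟩)
    omega
  have e3 := hs.card_lt hp hp' (θ := θ) (r := a (q - 1)) (r' := a q) (hp.lt' _ hq') (hp.lt' _ hq)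
    (by rw [hp.right _ hq, hp.right _ hq']; omega) e1 e2 (by rw [hp.right _ hq']; exact h9)
  rw [hp.right _ hq', show q - 1 + 1 = q by omega] at e3
  have := Finset.card_le_card (heavy_anti (N := N) (D := D) (p := p) (θ := θ)
    (show q ≤ q + 1 by omega))
  omega

theorem SortInv.next {N n : ℕ} {Seg : ℕ → ℕ → Prop} {E : ℕ → ℕ → Prop} {D p : ℕ → ℕ} {τ : ℕ}
    (h : SortInv N Seg E D p τ n) (hb : ∀ a b, Seg a b → b ≤ N)
    (hE : ∀ a b z, Seg a b → a ≤ z → z + 1 < b → ∃ κ < n, E κ z) :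
    SortInv N Seg E D p (τ + 1) 0 := by
  intro a b θ hS h1 h2
  obtain ⟨i1, i2, i3⟩ := h a b θ hS h1 h2
  refine ⟨i1, i2, ?_⟩
  rintro q j h3 h4 h5 (h6 | ⟨_, _, _, h6, _⟩)
  · rcases h3.eq_or_lt with rfl | h7
    · have := hb _ _ hS
      omega
    · exact i3 q j h3 h4 h5
        (Or.inr ⟨by omega, h7, hE a b (q - 1) hS (by omega) (by omega)⟩)
  · omega

/-- For `q = θ` and the largest possible `j`, all positions from `θ` on hold heavy items, so no item
lies beyond its destination. Positions and destinations have the same sum, hence they coincide. -/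
theorem SortInv.sorted {N S : ℕ} {Seg : ℕ → ℕ → Prop} {E : ℕ → ℕ → Prop} {D d p a : ℕ → ℕ} {τ κ : ℕ}
    (h : SortInv N Seg E D p τ κ) (hD : InvPair N D d) (hp : InvPair N p a) (hτ : 2 * S ≤ τ)
    (hb : ∀ a b, Seg a b → b ≤ a + S)
    (hb' : ∀ a b, Seg a b → b ≤ N)
    (hS : ∀ z < N, ∃ a b, Seg a b ∧ a ≤ z ∧ z < b) : ∀ r < N, p r = D r := by
  have key : ∀ r < N, p r ≤ D r := by
    intro r hr
    obtain ⟨x, b, h1, h2, h3⟩ := hS (p r) (hp.lt r hr)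
    have h4 := hb x b h1
    have h5 := hb' x b h1
    -- Here q + 2j = 2b - 2 - q, which is less than the start of the segment plus 2S; this
    -- determines the number of rounds.
    have h6 := (h x b (p r) h1 h2 h3).2.2 (p r) (b - 1 - p r) h2 (by omega) (by omega)
      (Or.inl (by omega))
    have h7 : heavy N D p (p r) (p r) ⊆ (Finset.range N).filter fun x => p r ≤ p x := fun x hx => by
      rw [mem_heavy] at hx
      simp [hx]
    have h8 := Finset.eq_of_subset_of_card_le h7 (by rw [hp.card_ge]; omega)
    have h9 : r ∈ heavy N D p (p r) (p r) := by
      rw [h8]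
      simp [hr]
    exact (mem_heavy.1 h9).2.2
  have sum : ∀ {f g : ℕ → ℕ}, InvPair N f g →
      ∑ r ∈ Finset.range N, f r = ∑ z ∈ Finset.range N, z := by
    intro f g hf
    conv_rhs => rw [← hf.image]
    rw [Finset.sum_image]
    intro r hr r' hr' e
    simp only [Finset.coe_range, Set.mem_Iio] at hr hr'
    exact hf.inj hr hr' e
  have := (Finset.sum_eq_sum_iff_of_le
    (fun r hr => key r (Finset.mem_range.1 hr))).1 ((sum hp).trans (sum hD).symm)
  exact fun r hr => this r (Finset.mem_range.2 hr)

/-! ## Exchanging two neighbours in a ladder of six cells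

The cells `0, …, 5` of the ladder are arranged in three rungs `{0, 1}`, `{2, 3}`, `{4, 5}`; the dummy
cell `6` stands for a robot outside the ladder. -/

/-- Rotations along the cycles of the ladder: nothing, the first square, the second square, and the
hexagon, each in both directions. -/
def ladderMoves : List (List ℕ) :=
  [[0, 1, 2, 3, 4, 5], [1, 3, 0, 2, 4, 5], [2, 0, 3, 1, 4, 5], [0, 1, 3, 5, 2, 4],
    [0, 1, 4, 2, 5, 3], [1, 3, 0, 5, 2, 4], [2, 0, 4, 1, 5, 3]]

/-- For each edge of the ladder, moves that exchange its ends. -/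
def swapMoves : List (List ℕ) :=
  [[1, 1, 3, 6, 2], [1, 6, 3, 0, 0], [3, 1, 6, 2, 5], [2, 4, 5, 0, 0], [1, 3, 6, 0, 0],
    [3, 1, 6, 0, 0], [4, 2, 5, 0, 0]]

/-- The effect on cell `c` of the `q`-th of the moves that exchange the ends of edge `e`. -/
def ladderStep (e q c : ℕ) : ℕ :=
  (ladderMoves.getD ((swapMoves.getD e []).getD q 0) []).getD c 6

/-- The effect on cell `c` of the first `q` moves. -/
def ladderRun (e : ℕ) : ℕ → ℕ → ℕ
  | 0, c => c
  | q + 1, c => ladderStep e q (ladderRun e q c)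

/-- The first end of edge `e`. -/
def end₁ (e : ℕ) : ℕ := if e < 3 then 2 * e else e - 3

/-- The second end of edge `e`. -/
def end₂ (e : ℕ) : ℕ := if e < 3 then 2 * e + 1 else e - 1

/-- Adjacency of cells of the ladder. -/
def LadderAdj (c c' : ℕ) : Prop := (c / 2 = c' / 2 ∧ c ≠ c') ∨ c + 2 = c' ∨ c' + 2 = c

instance : DecidableRel LadderAdj := fun _ _ => by unfold LadderAdj; infer_instance

theorem ladderStep_lt : ∀ e < 7, ∀ q < 5, ∀ c < 6, ladderStep e q c < 6 := by decide

/-- The index 6 runs past the lists of length six, and the default value of `getD` makes the dummy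
cell a fixed point. -/
theorem ladderStep_six : ∀ e < 7, ∀ q < 5, ladderStep e q 6 = 6 := by decide

theorem ladderStep_inj : ∀ e < 7, ∀ q < 5, ∀ c < 6, ∀ c' < 6,
    ladderStep e q c = ladderStep e q c' → c = c' := by decide

theorem ladderStep_adj : ∀ e < 7, ∀ q < 5, ∀ c < 6,
    ladderStep e q c = c ∨ LadderAdj c (ladderStep e q c) := by decide

/-- Rotations along cycles of length at least four never exchange two cells. -/
theorem ladderStep_no_swap : ∀ e < 7, ∀ q < 5, ∀ c < 6, ∀ c' < 6, (ladderStep e q c = c' ∧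
    ladderStep e q c' = c) → c = c' := by decide

/-- A finite check of the words in `swapMoves`. Words of fewer than five rotations are padded by the
trivial move, so that every class takes the same time. -/
theorem ladderRun_five : ∀ e < 7, ∀ c < 7,
    ladderRun e 5 c = if c = end₁ e then end₂ e else if c = end₂ e then end₁ e else c := by decide

theorem end_facts : ∀ e < 7, end₁ e < 6 ∧ end₂ e < 6 ∧ end₁ e < end₂ e := by decide

theorem ladderRun_lt {e : ℕ} (he : e < 7) : ∀ q ≤ 5, ∀ c < 6, ladderRun e q c < 6
  | 0, _, _, hc => hc
  | q + 1, hq, c, hc =>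
    ladderStep_lt e he q (by omega) _ (ladderRun_lt he q (by omega) c hc)

theorem ladderRun_six {e : ℕ} (he : e < 7) : ∀ q ≤ 5, ladderRun e q 6 = 6
  | 0, _ => rfl
  | q + 1, hq => by
    rw [ladderRun, ladderRun_six he q (by omega), ladderStep_six e he q (by omega)]

/-! ## Ladders in a two-dimensional array of cells

The cell in row `r` and column `x` of an array of `L` rows of length `M` has number `r * M + x`. -/

/-- Adjacent cells. -/
def CellAdj (M N z z' : ℕ) : Prop :=
  ((z + 1 = z' ∧ z % M + 1 < M) ∨ (z + M = z' ∧ z' < N)) ∨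
    ((z' + 1 = z ∧ z' % M + 1 < M) ∨ (z' + M = z ∧ z < N))

theorem CellAdj.symm {M N z z' : ℕ} (h : CellAdj M N z z') : CellAdj M N z' z := Or.symm h

/-- A class of disjoint `3 × 2` (if `sh = 0`) or `2 × 3` (if `sh = 1`) blocks, with rows and columns of
the corners fixed modulo three, and an edge `e` of the ladder in them. -/
structure BlockClass where
  (M L ρr ρx sh e : ℕ)

namespace BlockClass

variable (b : BlockClass)

/-- The standing assumptions on a block class. -/
structure Good : Prop where
  M_pos : 0 < b.M
  sh_le : b.sh ≤ 1
  e_lt : b.e < 7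

/-- Row of a cell within its block. -/
def dr (z : ℕ) : ℕ := (z / b.M - b.ρr) % 3

/-- Column of a cell within its block. -/
def dx (z : ℕ) : ℕ := (z % b.M - b.ρx) % 3

/-- The cell lies in one of the blocks. -/
def InBlock (z : ℕ) : Prop :=
  b.ρr < z / b.M + 1 ∧ b.ρx < z % b.M + 1 ∧ b.dr z < 3 - b.sh ∧ b.dx z < 2 + b.sh ∧
    z / b.M - b.dr z + (3 - b.sh) < b.L + 1 ∧ z % b.M - b.dx z + (2 + b.sh) < b.M + 1

/-- The corner of the block of a cell. -/
def corner (z : ℕ) : ℕ := z - (b.dr z * b.M + b.dx z)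

/-- The cell of the ladder at which a cell of a block lies. -/
def slot (z : ℕ) : ℕ :=
  (1 - b.sh) * (2 * b.dr z + b.dx z) + b.sh * (2 * b.dx z + b.dr z)

/-- The offset of the cells `c` of the ladder in a block. -/
def off (c : ℕ) : ℕ :=
  c % 6 / 2 * ((1 - b.sh) * b.M + b.sh) + c % 2 * ((1 - b.sh) + b.sh * b.M)

theorem div_mod_of {M r x : ℕ} (hx : x < M) : (r * M + x) / M = r ∧ (r * M + x) % M = x := by
  constructor
  · rw [add_comm, Nat.add_mul_div_right _ _ (by omega), Nat.div_eq_of_lt hx, zero_add]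
  · rw [add_comm, Nat.add_mul_mod_self_right, Nat.mod_eq_of_lt hx]

variable {b}

/-- Together with `InBlock.exists` this describes the cells of blocks by corner and offset, so that
the residues in `dr` and `dx` need not be unfolded again. -/
theorem corner_add (hb : b.Good) {r₀ x₀ i j : ℕ} (h1 : b.ρr ≤ r₀) (h2 : (r₀ - b.ρr) % 3 = 0)
    (h3 : b.ρx ≤ x₀) (h4 : (x₀ - b.ρx) % 3 = 0) (h5 : r₀ + (3 - b.sh) ≤ b.L)
    (h6 : x₀ + (2 + b.sh) ≤ b.M) (hi : i < 3 - b.sh) (hj : j < 2 + b.sh) :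
    let z := (r₀ + i) * b.M + (x₀ + j)
    b.InBlock z ∧ b.corner z = r₀ * b.M + x₀ ∧ b.dr z = i ∧ b.dx z = j ∧ z < b.M * b.L := by
  have hs := hb.sh_le
  obtain ⟨e1, e2⟩ := div_mod_of (M := b.M) (r := r₀ + i) (x := x₀ + j) (by omega)
  have e3 : b.dr ((r₀ + i) * b.M + (x₀ + j)) = i := by
    rw [dr, e1]
    omega
  have e4 : b.dx ((r₀ + i) * b.M + (x₀ + j)) = j := by
    rw [dx, e2]
    omega
  refine ⟨?_, ?_, e3, e4, ?_⟩
  · rw [InBlock, e3, e4, e1, e2]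
    omega
  · rw [corner, e3, e4, add_mul]
    omega
  · have : (r₀ + i + 1) * b.M ≤ b.L * b.M := Nat.mul_le_mul_right _ (by omega)
    rw [mul_comm b.M]
    rw [add_mul _ 1] at this
    omega

theorem InBlock.exists {z : ℕ} (h : b.InBlock z) :
    ∃ r₀ x₀ i j, z = (r₀ + i) * b.M + (x₀ + j) ∧ b.ρr ≤ r₀ ∧ (r₀ - b.ρr) % 3 = 0 ∧
    b.ρx ≤ x₀ ∧ (x₀ - b.ρx) % 3 = 0 ∧ r₀ + (3 - b.sh) ≤ b.L ∧
    x₀ + (2 + b.sh) ≤ b.M ∧ i < 3 - b.sh ∧ j < 2 + b.sh := by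
  obtain ⟨h1, h2, h3, h4, h5, h6⟩ := h
  refine ⟨z / b.M - b.dr z, z % b.M - b.dx z, b.dr z, b.dx z, ?_, ?_, ?_, ?_, ?_, by omega, by omega,
    h3, h4⟩
  · have h7 : b.dr z ≤ z / b.M := (Nat.mod_le _ _).trans (Nat.sub_le _ _)
    have h8 : b.dx z ≤ z % b.M := (Nat.mod_le _ _).trans (Nat.sub_le _ _)
    rw [Nat.sub_add_cancel h7, Nat.sub_add_cancel h8, Nat.div_add_mod']
  all_goals
    simp only [dr, dx] at *
    omega

/-- The two shapes are transposes of each other: the rungs of the ladder lie in rows if `sh = 0` and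
in columns if `sh = 1`. -/
theorem off_eq (hb : b.Good) {c : ℕ} (hc : c < 6) : ∃ i j, i < 3 - b.sh ∧ j < 2 + b.sh ∧
    b.off c = i * b.M + j ∧ (1 - b.sh) * (2 * i + j) + b.sh * (2 * j + i) = c ∧
    i = (1 - b.sh) * (c / 2) + b.sh * (c % 2) ∧ j = (1 - b.sh) * (c % 2) + b.sh * (c / 2) := by
  have hs := hb.sh_le
  refine ⟨_, _, ?_, ?_, ?_, ?_, rfl, rfl⟩
  all_goals
    rcases Nat.le_one_iff_eq_zero_or_eq_one.1 hs with h | h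
    · simp only [off, h, Nat.mod_eq_of_lt hc, Nat.sub_zero, one_mul, zero_mul, add_zero, mul_one] <;>
        omega
    · simp only [off, h, Nat.mod_eq_of_lt hc, Nat.sub_self, one_mul, zero_mul, zero_add, mul_one] <;>
        omega

theorem slot_lt (hb : b.Good) {z : ℕ} (h : b.InBlock z) : b.slot z < 6 := by
  obtain ⟨h1, h2, h3, h4, -⟩ := h
  rcases Nat.le_one_iff_eq_zero_or_eq_one.1 hb.sh_le with h | h <;>
    simp only [slot, h, Nat.sub_zero, one_mul, zero_mul, Nat.sub_self] at * <;> omega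

theorem corner_slot (hb : b.Good) {z : ℕ} (h : b.InBlock z) : b.corner z + b.off (b.slot z) = z := by
  obtain ⟨r₀, x₀, i, j, hz, h1, h2, h3, h4, h5, h6, h7, h8⟩ := h.exists
  obtain ⟨-, k2, k3, k4, -⟩ := corner_add hb h1 h2 h3 h4 h5 h6 h7 h8
  rw [← hz] at k2 k3 k4
  obtain ⟨i', j', l1, l2, l3, l4, l5, l6⟩ := off_eq hb (slot_lt hb h)
  have e : i' = i ∧ j' = j := by
    rw [slot, k3, k4] at l4
    rcases Nat.le_one_iff_eq_zero_or_eq_one.1 hb.sh_le with h | h <;>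
      simp only [h, Nat.sub_zero, one_mul, zero_mul, Nat.sub_self] at * <;> omega
  rw [l3, e.1, e.2, k2, hz, add_mul]
  omega

theorem InBlock.place (hb : b.Good) {z c : ℕ} (h : b.InBlock z) (hc : c < 6) :
    b.InBlock (b.corner z + b.off c) ∧ b.corner (b.corner z + b.off c) = b.corner z ∧
      b.slot (b.corner z + b.off c) = c ∧ b.corner z + b.off c < b.M * b.L := by
  obtain ⟨r₀, x₀, i, j, hz, h1, h2, h3, h4, h5, h6, h7, h8⟩ := h.exists
  obtain ⟨-, k2, -⟩ := corner_add hb h1 h2 h3 h4 h5 h6 h7 h8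
  rw [← hz] at k2
  obtain ⟨i', j', l1, l2, l3, l4, -⟩ := off_eq hb hc
  obtain ⟨m1, m2, m3, m4, m5⟩ := corner_add hb h1 h2 h3 h4 h5 h6 l1 l2
  have e : b.corner z + b.off c = (r₀ + i') * b.M + (x₀ + j') := by
    rw [k2, l3, add_mul]
    omega
  rw [e]
  exact ⟨m1, m2.trans k2.symm, by rw [slot, m3, m4, l4], m5⟩

theorem InBlock.adj (hb : b.Good) {z c c' : ℕ} (h : b.InBlock z) (hc : c < 6) (hc' : c' < 6)
    (ha : LadderAdj c c') :
    CellAdj b.M (b.M * b.L) (b.corner z + b.off c) (b.corner z + b.off c') := by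
  wlog hlt : c < c' generalizing c c'
  · refine (this hc' hc ?_ ?_).symm
    · unfold LadderAdj at *
      omega
    · unfold LadderAdj at *
      omega
  refine Or.inl ?_
  obtain ⟨-, -, -, hN⟩ := h.place hb hc'
  obtain ⟨r₀, x₀, i, j, hz, h1, h2, h3, h4, h5, h6, h7, h8⟩ := h.exists
  obtain ⟨-, k2, -⟩ := corner_add hb h1 h2 h3 h4 h5 h6 h7 h8
  rw [← hz] at k2
  obtain ⟨i₁, j₁, l1, l2, l3, -, l5, l6⟩ := off_eq hb hc
  obtain ⟨i₂, j₂, m1, m2, m3, -, m5, m6⟩ := off_eq hb hc'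
  have e : b.corner z + b.off c = (r₀ + i₁) * b.M + (x₀ + j₁) := by
    rw [k2, l3, add_mul]
    omega
  have e' : b.corner z + b.off c' = (r₀ + i₂) * b.M + (x₀ + j₂) := by
    rw [k2, m3, add_mul]
    omega
  have cases : (i₁ = i₂ ∧ j₂ = j₁ + 1) ∨ (i₂ = i₁ + 1 ∧ j₂ = j₁) := by
    unfold LadderAdj at ha
    rcases Nat.le_one_iff_eq_zero_or_eq_one.1 hb.sh_le with h | h <;>
      simp only [h, Nat.sub_zero, one_mul, zero_mul, Nat.sub_self, zero_add, add_zero] at * <;> omega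
  rw [e'] at hN
  rw [e, e']
  rcases cases with ⟨rfl, rfl⟩ | ⟨rfl, rfl⟩
  · refine Or.inl ⟨by omega, ?_⟩
    rw [(div_mod_of (M := b.M) (r := r₀ + i₁) (x := x₀ + j₁) (by omega)).2]
    omega
  · exact Or.inr ⟨by rw [← add_assoc r₀ i₁ 1, add_mul _ 1]; omega, hN⟩

/-! ### The moves of a class of blocks -/

variable (b)

/-- The block of the cell is active: the keys at the ends of its edge are in the wrong order. -/
def Active (key : ℕ → ℕ) (z : ℕ) : Prop :=
  b.InBlock z ∧ key (b.corner z + b.off (end₂ b.e)) < key (b.corner z + b.off (end₁ b.e))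

open Classical in
/-- The corner of the active block of a cell, and the cell itself if there is none. -/
noncomputable def aCorner (key : ℕ → ℕ) (z : ℕ) : ℕ := if b.Active key z then b.corner z else z

open Classical in
/-- The place of a cell in its active block, and `6` if there is none. -/
noncomputable def aSlot (key : ℕ → ℕ) (z : ℕ) : ℕ := if b.Active key z then b.slot z else 6

/-- The position after `q` moves of the robot starting in cell `z`. -/
noncomputable def moved (key : ℕ → ℕ) (q z : ℕ) : ℕ := b.aCorner key z + b.off (ladderRun b.e q (b.aSlot key z))

variable {b}

theorem aSlot_cases (hb : b.Good) (key : ℕ → ℕ) (z : ℕ) :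
    (b.Active key z ∧ b.aCorner key z = b.corner z ∧ b.aSlot key z = b.slot z ∧ b.slot z < 6) ∨
    (¬ b.Active key z ∧ b.aCorner key z = z ∧ b.aSlot key z = 6) := by
  by_cases h : b.Active key z
  · exact Or.inl ⟨h, if_pos h, if_pos h, slot_lt hb h.1⟩
  · exact Or.inr ⟨h, if_neg h, if_neg h⟩

/-- This is the purpose of the reduction modulo 6 in `off`: a robot outside the active blocks has
slot 6 and corner its own cell, so the formula for `moved` leaves it in place. -/
theorem off_six : b.off 6 = 0 := by simp [off]

theorem Active.place (hb : b.Good) {key : ℕ → ℕ} {z c : ℕ} (h : b.Active key z) (hc : c < 6) :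
    b.Active key (b.corner z + b.off c) ∧ b.aCorner key (b.corner z + b.off c) = b.corner z ∧
      b.aSlot key (b.corner z + b.off c) = c := by
  obtain ⟨h1, h2, h3, -⟩ := h.1.place hb hc
  have : b.Active key (b.corner z + b.off c) := ⟨h1, by rw [h2]; exact h.2⟩
  exact ⟨this, (if_pos this).trans h2, (if_pos this).trans h3⟩

theorem moved_zero (hb : b.Good) (key : ℕ → ℕ) (z : ℕ) : b.moved key 0 z = z := by
  rcases aSlot_cases hb key z with ⟨h1, h2, h3, -⟩ | ⟨-, h2, h3⟩
  · rw [moved, ladderRun, h2, h3, corner_slot hb h1.1]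
  · rw [moved, ladderRun, h2, h3, off_six, add_zero]

/-- After some moves, the block and the cell in it can be read off from the position. -/
theorem moved_spec (hb : b.Good) (key : ℕ → ℕ) (z : ℕ) {q : ℕ} (hq : q ≤ 5) :
    b.aCorner key (b.moved key q z) = b.aCorner key z ∧
      b.aSlot key (b.moved key q z) = ladderRun b.e q (b.aSlot key z) := by
  rcases aSlot_cases hb key z with ⟨h1, h2, h3, h4⟩ | ⟨h1, h2, h3⟩
  · rw [moved, h2, h3]
    exact (h1.place hb (ladderRun_lt hb.e_lt q hq _ h4)).2
  · rw [moved, h2, h3, ladderRun_six hb.e_lt q hq, off_six, add_zero]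
    exact ⟨h2, h3⟩

theorem moved_lt (hb : b.Good) (key : ℕ → ℕ) {z : ℕ} (hz : z < b.M * b.L) {q : ℕ} (hq : q ≤ 5) :
    b.moved key q z < b.M * b.L := by
  rcases aSlot_cases hb key z with ⟨h1, h2, h3, h4⟩ | ⟨h1, h2, h3⟩
  · rw [moved, h2, h3]
    exact (h1.1.place hb (ladderRun_lt hb.e_lt q hq _ h4)).2.2.2
  · rwa [moved, h2, h3, ladderRun_six hb.e_lt q hq, off_six, add_zero]

/-- The position determines the active block, and a rotation permutes the cells of that block, so a
coincidence can be pulled back one move at a time. -/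
theorem moved_inj (hb : b.Good) (key : ℕ → ℕ) {z z' : ℕ} {q : ℕ} (hq : q ≤ 5)
    (h : b.moved key q z = b.moved key q z') : z = z' := by
  induction q with
  | zero => rwa [moved_zero hb, moved_zero hb] at h
  | succ q ih =>
    apply ih (by omega)
    obtain ⟨h1, h2⟩ := moved_spec hb key z hq
    obtain ⟨h3, h4⟩ := moved_spec hb key z' hq
    rw [h] at h1 h2
    have e1 := h1.symm.trans h3
    have e2 := h2.symm.trans h4
    rw [ladderRun, ladderRun] at e2
    rcases aSlot_cases hb key z with ⟨k1, k2, k3, k4⟩ | ⟨k1, k2, k3⟩ <;>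
      rcases aSlot_cases hb key z' with ⟨l1, l2, l3, l4⟩ | ⟨l1, l2, l3⟩
    · rw [k3, l3] at e2
      rw [moved, moved, e1, k3, l3, ladderStep_inj b.e hb.e_lt q (by omega) _
        (ladderRun_lt hb.e_lt q (by omega) _ k4) _ (ladderRun_lt hb.e_lt q (by omega) _ l4) e2]
    · have := ladderStep_lt b.e hb.e_lt q (by omega) _ (ladderRun_lt hb.e_lt q (by omega) _ k4)
      rw [k3, l3, ladderRun_six hb.e_lt q (by omega), ladderStep_six b.e hb.e_lt q (by omega)] at e2
      omega
    · have := ladderStep_lt b.e hb.e_lt q (by omega) _ (ladderRun_lt hb.e_lt q (by omega) _ l4)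
      rw [k3, l3, ladderRun_six hb.e_lt q (by omega), ladderStep_six b.e hb.e_lt q (by omega)] at e2
      omega
    · rw [moved, moved, e1, k3, l3]

theorem moved_adj (hb : b.Good) (key : ℕ → ℕ) (z : ℕ) {q : ℕ} (hq : q < 5) :
    b.moved key (q + 1) z = b.moved key q z ∨
      CellAdj b.M (b.M * b.L) (b.moved key q z) (b.moved key (q + 1) z) := by
  rcases aSlot_cases hb key z with ⟨h1, h2, h3, h4⟩ | ⟨h1, h2, h3⟩
  · have h5 := ladderRun_lt hb.e_lt q (by omega) _ h4
    rw [moved, moved, h2, h3, ladderRun]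
    rcases ladderStep_adj b.e hb.e_lt q hq _ h5 with h6 | h6
    · exact Or.inl (by rw [h6])
    · exact Or.inr (h1.1.adj hb h5 (ladderStep_lt b.e hb.e_lt q hq _ h5) h6)
  · left
    rw [moved, moved, h3, ladderRun_six hb.e_lt q (by omega), ladderRun_six hb.e_lt _ (by omega)]

theorem moved_no_swap (hb : b.Good) (key : ℕ → ℕ) {z z' : ℕ} {q : ℕ} (hq : q < 5)
    (h : b.moved key q z = b.moved key (q + 1) z')
    (h' : b.moved key q z' = b.moved key (q + 1) z) : z = z' := by
  apply moved_inj hb key (q := q) (by omega)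
  obtain ⟨h1, h2⟩ := moved_spec hb key z (q := q) (by omega)
  obtain ⟨h3, h4⟩ := moved_spec hb key z' (q := q) (by omega)
  obtain ⟨h5, h6⟩ := moved_spec hb key z (q := q + 1) (by omega)
  obtain ⟨h7, h8⟩ := moved_spec hb key z' (q := q + 1) (by omega)
  rw [h] at h1 h2
  rw [h'] at h3 h4
  have e1 := h7.symm.trans h1
  have e2 := h8.symm.trans h2
  have e4 := h6.symm.trans h4
  rw [ladderRun] at e2 e4
  rcases aSlot_cases hb key z with ⟨k1, k2, k3, k4⟩ | ⟨k1, k2, k3⟩ <;>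
    rcases aSlot_cases hb key z' with ⟨l1, l2, l3, l4⟩ | ⟨l1, l2, l3⟩
  · rw [k3, l3] at e2 e4
    rw [moved, moved, e1, k3, l3, ladderStep_no_swap b.e hb.e_lt q (by omega) _
        (ladderRun_lt hb.e_lt q (by omega) _ k4) _ (ladderRun_lt hb.e_lt q (by omega) _ l4) ⟨e4, e2⟩]
  · have := ladderRun_lt hb.e_lt q (by omega) _ k4
    rw [k3, l3, ladderRun_six hb.e_lt q (by omega), ladderStep_six b.e hb.e_lt q (by omega)] at e2
    omega
  · have := ladderRun_lt hb.e_lt q (by omega) _ l4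
    rw [k3, l3, ladderRun_six hb.e_lt q (by omega), ladderStep_six b.e hb.e_lt q (by omega)] at e4
    omega
  · rw [moved, moved, e1, k3, l3]

variable (b) in
/-- The cells `z` and `z + 1` are the ends of the edge in a block. -/
def Covers (z : ℕ) : Prop :=
  b.InBlock z ∧ b.slot z = end₁ b.e ∧ b.InBlock (z + 1) ∧ b.corner (z + 1) = b.corner z ∧
    b.slot (z + 1) = end₂ b.e

/-- Five moves exchange exactly the ends of the edge in every active block. The edge may also join
two rows; such exchanges are not needed, but they only involve pairs in the wrong order, which
`SortStep` permits at any distance. -/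
theorem sortStep (hb : b.Good) {D p a : ℕ → ℕ} (hp : InvPair (b.M * b.L) p a) :
    SortStep (b.M * b.L) D p (fun r => b.moved (fun z => D (a z)) 5 (p r)) b.Covers := by
  set key : ℕ → ℕ := fun z => D (a z) with hkey
  obtain ⟨f1, f2, f3⟩ := end_facts b.e hb.e_lt
  have hrun := ladderRun_five b.e hb.e_lt
  -- The first end has the smaller cell number, so a block is active exactly when its two ends are
  -- inverted.
  have hoff : b.off (end₁ b.e) < b.off (end₂ b.e) := by
    have hM := hb.M_pos
    have : ∀ e < 7, (end₁ e / 2 = end₂ e / 2 ∧ end₁ e % 2 = 0 ∧ end₂ e % 2 = 1) ∨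
      (end₁ e / 2 + 1 = end₂ e / 2 ∧ end₁ e % 2 = end₂ e % 2) := by decide
    have := this b.e hb.e_lt
    rw [off, off, Nat.mod_eq_of_lt f1, Nat.mod_eq_of_lt f2]
    rcases Nat.le_one_iff_eq_zero_or_eq_one.1 hb.sh_le with h | h <;>
      simp only [h, Nat.sub_zero, one_mul, zero_mul, Nat.sub_self, zero_add, add_zero, mul_one] <;>
      rcases this with ⟨h1, h2, h3⟩ | ⟨h1, h2⟩
    · rw [h1, h2, h3]; omega
    · rw [← h1, h2, add_mul]; omega
    · rw [h1, h2, h3]; omega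
    · rw [← h1, h2]; omega
  constructor
  · intro r hr
    rcases aSlot_cases hb key (p r) with ⟨h1, h2, h3, h4⟩ | ⟨h1, h2, h3⟩
    · have hz := corner_slot hb h1.1
      by_cases c1 : b.slot (p r) = end₁ b.e
      · right
        obtain ⟨k1, k2, k3⟩ := h1.place hb f2
        have k4 := (h1.1.place hb f2).2.2.2
        refine ⟨a (b.corner (p r) + b.off (end₂ b.e)), hp.lt' _ k4, ?_, ?_, Or.inl ⟨?_, ?_⟩⟩
        · rw [hp.right _ k4, moved, h2, h3, hrun _ (by omega), if_pos c1]
        · rw [hp.right _ k4, moved, k2, k3, hrun _ (by omega), if_neg (by omega), if_pos rfl, ← c1, hz]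
        · rw [hp.right _ k4]
          rw [c1] at hz
          omega
        · have := h1.2
          rw [← c1, hz] at this
          simp only [hkey, hp.left r hr] at this
          exact this
      by_cases c2 : b.slot (p r) = end₂ b.e
      · right
        obtain ⟨k1, k2, k3⟩ := h1.place hb f1
        have k4 := (h1.1.place hb f1).2.2.2
        refine ⟨a (b.corner (p r) + b.off (end₁ b.e)), hp.lt' _ k4, ?_, ?_, Or.inr ⟨?_, ?_⟩⟩
        · rw [hp.right _ k4, moved, h2, h3, hrun _ (by omega), if_neg (by omega), if_pos c2]
        · rw [hp.right _ k4, moved, k2, k3, hrun _ (by omega), if_pos rfl, ← c2, hz]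
        · rw [hp.right _ k4]
          rw [c2] at hz
          omega
        · have := h1.2
          rw [← c2, hz] at this
          simp only [hkey, hp.left r hr] at this
          exact this
      · left
        rw [moved, h2, h3, hrun _ (by omega), if_neg c1, if_neg c2, hz]
    · left
      rw [moved, h2, h3, ladderRun_six hb.e_lt 5 le_rfl, off_six, add_zero]
  · rintro r hr r' hr' e hD ⟨h1, h2, h3, h4, h5⟩
    have hz := corner_slot hb h1
    have hz' := corner_slot hb h3
    rw [h4, h5] at hz'
    rw [h2] at hz
    have hact : b.Active key (p r) := by
      refine ⟨h1, ?_⟩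
      rw [hz, hz', ← e]
      simp only [hkey, hp.left r hr, hp.left r' hr']
      exact hD
    rw [moved, aCorner, if_pos hact, aSlot, if_pos hact, h2, hrun _ (by omega), if_pos rfl, hz']

/-! ### The 126 classes: seven edges, three residues of rows and of columns, two shapes -/

variable (M L κ : ℕ) in
/-- The enumeration of the `126` block classes. -/
def ofIndex (M L κ : ℕ) : BlockClass := ⟨M, L, κ / 7 % 3, κ / 21 % 3, κ / 63, κ % 7⟩

theorem ofIndex_good {M L κ : ℕ} (hM : 0 < M) (hκ : κ < 126) : (ofIndex M L κ).Good :=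
  ⟨hM, by simp only [ofIndex]; omega, by simp only [ofIndex]; omega⟩

/-- With at least three rows, the pair is a rung of a 3 × 2 block. Otherwise there are two rows and
at least three columns, and the pair is an edge along the side of a 2 × 3 block. The minima push the
block back inside the array at its border. -/
theorem exists_covers {M L z : ℕ} (hM : 2 ≤ M) (hL : 2 ≤ L) (hN : 6 ≤ M * L) (hz : z < M * L)
    (hz' : z % M + 1 < M) : ∃ κ < 126, (ofIndex M L κ).Covers z := by
  have main : ∀ sh r₀ x₀ i j e : ℕ, sh ≤ 1 → e < 7 → z = (r₀ + i) * M + (x₀ + j) →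
      r₀ + (3 - sh) ≤ L → x₀ + (2 + sh) ≤ M → i < 3 - sh → j + 1 < 2 + sh →
      (1 - sh) * (2 * i + j) + sh * (2 * j + i) = end₁ e →
      (1 - sh) * (2 * i + (j + 1)) + sh * (2 * (j + 1) + i) = end₂ e →
      ∃ κ < 126, (ofIndex M L κ).Covers z := by
    intro sh r₀ x₀ i j e hs he hz hr hx hi hj h1 h2
    -- This inverts the decoding in `ofIndex`.
    refine ⟨e + 7 * (r₀ % 3) + 21 * (x₀ % 3) + 63 * sh, by omega, ?_⟩
    have hB : ofIndex M L (e + 7 * (r₀ % 3) + 21 * (x₀ % 3) + 63 * sh) =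
        ⟨M, L, r₀ % 3, x₀ % 3, sh, e⟩ := by
      simp only [ofIndex, BlockClass.mk.injEq, true_and]
      omega
    rw [hB]
    have hg : (BlockClass.mk M L (r₀ % 3) (x₀ % 3) sh e).Good := ⟨by simp only; omega, hs, he⟩
    have h3 : (r₀ - r₀ % 3) % 3 = 0 := by omega
    have h4 : (x₀ - x₀ % 3) % 3 = 0 := by omega
    obtain ⟨k1, k2, k3, k4, -⟩ := corner_add hg (Nat.mod_le r₀ 3) h3 (Nat.mod_le x₀ 3) h4 hr hx hi
      (show j < 2 + sh by omega)
    obtain ⟨l1, l2, l3, l4, -⟩ := corner_add hg (Nat.mod_le r₀ 3) h3 (Nat.mod_le x₀ 3) h4 hr hx hi hj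
    simp only at k1 k2 k3 k4 l1 l2 l3 l4
    rw [← hz] at k1 k2 k3 k4
    rw [← add_assoc, ← add_assoc, add_assoc _ x₀, ← hz] at l1 l2 l3 l4
    exact ⟨k1, by rw [slot, k3, k4]; exact h1, l1, l2.trans k2.symm, by rw [slot, l3, l4]; exact h2⟩
  have e0 : z = z / M * M + z % M := (Nat.div_add_mod' z M).symm
  have hrow : z / M < L := Nat.div_lt_of_lt_mul hz
  by_cases hL3 : 3 ≤ L
  · refine main 0 (min (z / M) (L - 3)) (z % M) (z / M - min (z / M) (L - 3)) 0
      (z / M - min (z / M) (L - 3)) (by omega) (by omega) ?_ (by omega) (by omega) (by omega)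
      (by omega) ?_ ?_
    · rw [Nat.add_sub_cancel' (min_le_left _ _)]
      omega
    · rw [end₁, if_pos (by omega)]
      omega
    · rw [end₂, if_pos (by omega)]
      omega
  · obtain rfl : L = 2 := by omega
    refine main 1 0 (min (z % M) (M - 3)) (z / M) (z % M - min (z % M) (M - 3))
      (3 + (2 * (z % M - min (z % M) (M - 3)) + z / M)) (by omega) (by omega) ?_ (by omega) (by omega)
      (by omega) (by omega) ?_ ?_
    · rw [Nat.add_sub_cancel' (min_le_left _ _), zero_add]
      omega
    · rw [end₁, if_neg (Nat.not_lt.2 (Nat.le_add_right _ _))]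
      omega
    · rw [end₂, if_neg (Nat.not_lt.2 (Nat.le_add_right _ _))]
      omega

end BlockClass

/-! ## Vertex numbers and snake-like enumerations of grids -/

section Grid

variable {k : ℕ} (m : Fin k → ℕ)

/-- The side lengths, as a function on the natural numbers. -/
abbrev side (l : ℕ) : ℕ := tabulate m l

theorem side_val (l : Fin k) : side m l = m l := by simp [side, tabulate]

theorem side_of_lt {l : ℕ} (h : l < k) : side m l = m ⟨l, h⟩ := by simp [side, tabulate, h]

/-- The weight of coordinate `l` in the number of a vertex. -/
def stride : ℕ → ℕ
  | 0 => 1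
  | l + 1 => stride l * side m l

theorem stride_eq_prod (l : ℕ) : stride m l = ∏ i ∈ Finset.range l, side m i := by
  induction l with
  | zero => rfl
  | succ l ih => rw [stride, ih, Finset.prod_range_succ]

theorem stride_self : stride m k = gridSize m := by
  rw [stride_eq_prod, ← Fin.prod_univ_eq_prod_range (fun l => side m l)]
  exact Finset.prod_congr rfl fun l _ => side_val m l

theorem stride_eq (l : Fin k) : ∏ j : Fin l, m (Fin.castLE l.is_lt.le j) = stride m l := by
  rw [stride_eq_prod, ← Fin.prod_univ_eq_prod_range (fun l => side m l)]
  exact Finset.prod_congr rfl fun j _ => (side_val m (Fin.castLE l.is_lt.le j)).symm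

variable {m}

theorem vertexCode_eq (v : GridVertex m) : vertexCode v = ∑ l, (v l : ℕ) * stride m l := by
  rw [vertexCode, finPiFinEquiv_apply]
  exact Finset.sum_congr rfl fun l _ => by rw [stride_eq]

theorem vertexCode_lt (v : GridVertex m) : vertexCode v < gridSize m := (finPiFinEquiv v).is_lt

theorem vertexCode_injective : Function.Injective (vertexCode (m := m)) := fun _ _ h =>
  finPiFinEquiv.injective (Fin.ext h)

theorem vertexCode_div_mod (v : GridVertex m) (l : Fin k) :
    vertexCode v / stride m l % m l = v l := by
  have h : ((finPiFinEquiv.symm (finPiFinEquiv v)) l : ℕ) =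
      vertexCode v / (∏ j : Fin l, m (Fin.castLE l.is_lt.le j)) % m l := rfl
  rw [Equiv.symm_apply_apply, stride_eq] at h
  exact h.symm

/-- The vertex with a given number. -/
def vertexOf (c : Fin (gridSize m)) : GridVertex m := finPiFinEquiv.symm c

theorem vertexCode_vertexOf (c : Fin (gridSize m)) : vertexCode (vertexOf c) = c := by
  rw [vertexCode, vertexOf, Equiv.apply_symm_apply]

/-! ### The snake-like enumeration by lines in a direction `j` -/

variable (m)

/-- The side lengths with that of dimension `j` replaced by `1`. -/
def crossSide (j l : ℕ) : ℕ := if l = j then 1 else side m l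

/-- The part of the cell number encoding the coordinates from `l` on. -/
def crossIndex (j idx : ℕ) : ℕ → ℕ
  | 0 => idx / side m j
  | l + 1 => crossIndex j idx l / crossSide m j l

/-- The coordinate `l ≠ j` of a cell in the snake-like order. -/
def snakeDigit (j idx l : ℕ) : ℕ :=
  if crossIndex m j idx (l + 1) % 2 = 0 then crossIndex m j idx l % crossSide m j l
  else crossSide m j l - 1 - crossIndex m j idx l % crossSide m j l

/-- The coordinate `l` of a cell. -/
def cellDigit (j idx l : ℕ) : ℕ := if l = j then idx % side m j else snakeDigit m j idx l

variable {m}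

theorem crossSide_pos (hm : ∀ l, 0 < m l) (j : ℕ) {l : ℕ} (hl : l < k) : 0 < crossSide m j l := by
  rw [crossSide, side_of_lt m hl]
  split_ifs
  exacts [Nat.one_pos, hm _]

theorem snakeDigit_lt (hm : ∀ l, 0 < m l) (j idx : ℕ) {l : ℕ} (hl : l < k) :
    snakeDigit m j idx l < crossSide m j l := by
  have h := crossSide_pos hm j hl
  have := Nat.mod_lt (crossIndex m j idx l) h
  rw [snakeDigit]
  split_ifs <;> omega

theorem snakeDigit_self (j idx : ℕ) : snakeDigit m j idx j = 0 := by
  simp [snakeDigit, crossSide, Nat.mod_one]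

theorem cellDigit_lt (hm : ∀ l, 0 < m l) (j idx : ℕ) (l : Fin k) : cellDigit m j idx l < m l := by
  rw [cellDigit]
  split_ifs with h
  · rw [← h, side_val]
    exact Nat.mod_lt _ (hm l)
  · have := snakeDigit_lt hm j idx l.is_lt
    rwa [crossSide, if_neg h, side_val] at this

/-- The vertex in cell `idx` of the enumeration of the grid by lines in direction `j`. -/
def cellVertex (hm : ∀ l, 0 < m l) (j idx : ℕ) : GridVertex m :=
  fun l => ⟨cellDigit m j idx l, cellDigit_lt hm j idx l⟩

theorem vertexCode_cellVertex (hm : ∀ l, 0 < m l) (j : Fin k) (idx : ℕ) :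
    vertexCode (cellVertex hm j idx) = idx % m j * stride m j +
      ∑ l ∈ Finset.range k, snakeDigit m j idx l * stride m l := by
  rw [vertexCode_eq, ← Fin.sum_univ_eq_sum_range (fun l => snakeDigit m j idx l * stride m l)]
  have : idx % m j * stride m j = ∑ l : Fin k, if l = j then idx % m j * stride m j else 0 := by simp
  rw [this, ← Finset.sum_add_distrib]
  refine Finset.sum_congr rfl fun l _ => ?_
  simp only [cellVertex, cellDigit]
  by_cases h : l = j
  · subst h
    simp [snakeDigit_self, side_val]
  · simp [h, Fin.val_inj]

theorem crossIndex_eq (j idx l : ℕ) :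
    crossIndex m j idx l = idx / side m j / ∏ i ∈ Finset.range l, crossSide m j i := by
  induction l with
  | zero => simp [crossIndex]
  | succ l ih => rw [crossIndex, ih, Finset.prod_range_succ, Nat.div_div_eq_div_mul _ (Finset.prod _ _)]

theorem mul_prod_crossSide (j : Fin k) :
    m j * ∏ i ∈ Finset.range k, crossSide m j i = gridSize m := by
  rw [← stride_self, stride_eq_prod]
  have : m j = ∏ l ∈ Finset.range k, if l = (j : ℕ) then m j else 1 := by simp
  rw [this, ← Finset.prod_mul_distrib]
  refine Finset.prod_congr rfl fun l _ => ?_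
  rw [crossSide]
  split_ifs with h
  · rw [h, side_val, mul_one]
  · rw [one_mul]

theorem crossIndex_last (j : Fin k) {idx : ℕ} (h : idx < gridSize m) :
    crossIndex m j idx k = 0 := by
  rw [crossIndex_eq, Nat.div_div_eq_div_mul, side_val, mul_prod_crossSide]
  exact Nat.div_eq_of_lt h

/-- The digits are read back from the top: above the last one the remaining index is 0, and the part
above a digit decides whether that digit is reflected. -/
theorem cellVertex_injOn (hm : ∀ l, 0 < m l) (j : Fin k) {idx idx' : ℕ} (h : idx < gridSize m)
    (h' : idx' < gridSize m) (e : cellVertex hm j idx = cellVertex hm j idx') : idx = idx' := by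
  have e1 : ∀ l : Fin k, cellDigit m j idx l = cellDigit m j idx' l := fun l => by
    have := congrFun e l
    simpa [cellVertex] using this
  have e2 : ∀ l < k, snakeDigit m j idx l = snakeDigit m j idx' l := by
    intro l hl
    by_cases hj : l = j
    · rw [hj, snakeDigit_self, snakeDigit_self]
    · have := e1 ⟨l, hl⟩
      rwa [cellDigit, cellDigit, if_neg hj, if_neg hj] at this
  have e3 : idx % side m j = idx' % side m j := by
    have := e1 j
    rwa [cellDigit, cellDigit, if_pos rfl, if_pos rfl] at this
  have e4 : ∀ d ≤ k, crossIndex m j idx (k - d) = crossIndex m j idx' (k - d) := by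
    intro d
    induction d with
    | zero => intro _; rw [Nat.sub_zero, crossIndex_last j h, crossIndex_last j h']
    | succ d ih =>
      intro hd
      have h1 := ih (by omega)
      have h2 := e2 (k - (d + 1)) (by omega)
      have h3 := crossSide_pos hm j (show k - (d + 1) < k by omega)
      rw [snakeDigit, snakeDigit, show k - (d + 1) + 1 = k - d by omega, h1] at h2
      have h4 : ∀ idx, crossIndex m j idx (k - d) =
          crossIndex m j idx (k - (d + 1)) / crossSide m j (k - (d + 1)) := fun idx => by
        rw [show k - d = k - (d + 1) + 1 by omega, crossIndex]
      rw [h4, h4] at h1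
      have h5 := Nat.mod_lt (crossIndex m j idx (k - (d + 1))) h3
      have h6 := Nat.mod_lt (crossIndex m j idx' (k - (d + 1))) h3
      rw [← Nat.div_add_mod (crossIndex m j idx (k - (d + 1))) (crossSide m j (k - (d + 1))),
        ← Nat.div_add_mod (crossIndex m j idx' (k - (d + 1))) (crossSide m j (k - (d + 1))), h1]
      congr 1
      split_ifs at h2 <;> omega
  have e5 := e4 k le_rfl
  rw [Nat.sub_self, crossIndex, crossIndex] at e5
  rw [← Nat.div_add_mod idx (side m j), ← Nat.div_add_mod idx' (side m j), e3, e5]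

theorem cellVertex_div_mod (hm : ∀ l, 0 < m l) (j : Fin k) (idx : ℕ) :
    ((cellVertex hm j idx) j : ℕ) = idx % m j := by
  simp [cellVertex, cellDigit, side_val]

theorem cellVertex_congr (hm : ∀ l, 0 < m l) (j : Fin k) {idx idx' : ℕ}
    (h : idx / m j = idx' / m j) (l : Fin k) (hl : l ≠ j) :
    cellVertex hm j idx l = cellVertex hm j idx' l := by
  have h1 : ∀ l, crossIndex m j idx l = crossIndex m j idx' l := fun l => by
    rw [crossIndex_eq, crossIndex_eq, side_val, h]
  simp [cellVertex, cellDigit, snakeDigit, h1, Fin.val_inj, hl]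

/-- Passing to the next line adds one with carries. A digit that overflows jumps from its maximum to
0, but the part above it changes parity, so its reflected value stays the same. The digit at which
the carry stops keeps its orientation and moves by one. The first alternative describes a carry that
is still pending. -/
theorem snakeDigit_succ (hm : ∀ l, 0 < m l) (j : Fin k) {idx idx' : ℕ}
    (h : idx' / m j = idx / m j + 1) : ∀ l ≤ k,
    (crossIndex m j idx' l = crossIndex m j idx l + 1 ∧
      ∀ l' < l, snakeDigit m j idx' l' = snakeDigit m j idx l') ∨
    (crossIndex m j idx' l = crossIndex m j idx l ∧ ∃ i < l,
      (snakeDigit m j idx' i = snakeDigit m j idx i + 1 ∨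
        snakeDigit m j idx i = snakeDigit m j idx' i + 1) ∧
      ∀ l' < l, l' ≠ i → snakeDigit m j idx' l' = snakeDigit m j idx l') := by
  intro l
  induction l with
  | zero => exact fun _ => Or.inl ⟨by simp only [crossIndex, side_val, h], by simp⟩
  | succ l ih =>
    intro hl
    have hs := crossSide_pos hm j (show l < k by omega)
    rcases ih (by omega) with ⟨h1, h2⟩ | ⟨h1, i, h2, h3, h4⟩
    · have hd := Nat.div_add_mod' (crossIndex m j idx l) (crossSide m j l)
      have hd' := Nat.mod_lt (crossIndex m j idx l) hs
      by_cases hc : crossIndex m j idx l % crossSide m j l + 1 = crossSide m j l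
      · have e : crossIndex m j idx' l =
            (crossIndex m j idx l / crossSide m j l + 1) * crossSide m j l + 0 := by
          rw [add_mul, h1]
          omega
        obtain ⟨e1, e2⟩ := BlockClass.div_mod_of (M := crossSide m j l)
          (r := crossIndex m j idx l / crossSide m j l + 1) hs
        rw [← e] at e1 e2
        refine Or.inl ⟨e1, fun l' hl' => ?_⟩
        rcases Nat.lt_succ_iff_lt_or_eq.1 hl' with h5 | rfl
        · exact h2 l' h5
        · rw [snakeDigit, snakeDigit, crossIndex, crossIndex, e1, e2]
          split_ifs <;> omega
      · have e : crossIndex m j idx' l = crossIndex m j idx l / crossSide m j l * crossSide m j l +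
            (crossIndex m j idx l % crossSide m j l + 1) := by
          rw [h1]
          omega
        obtain ⟨e1, e2⟩ := BlockClass.div_mod_of (M := crossSide m j l)
          (r := crossIndex m j idx l / crossSide m j l)
          (show crossIndex m j idx l % crossSide m j l + 1 < crossSide m j l by omega)
        rw [← e] at e1 e2
        refine Or.inr ⟨e1, l, by omega, ?_, fun l' hl' hne => h2 l' (by omega)⟩
        rw [snakeDigit, snakeDigit, crossIndex, crossIndex, e1, e2]
        split_ifs <;> omega
    · refine Or.inr ⟨by rw [crossIndex, crossIndex, h1], i, by omega, h3, fun l' hl' hne => ?_⟩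
      rcases Nat.lt_succ_iff_lt_or_eq.1 hl' with h5 | rfl
      · exact h4 l' h5 hne
      · rw [snakeDigit, snakeDigit, crossIndex, crossIndex, h1]

/-- Inside a row only coordinate `j` changes. Between consecutive rows `snakeDigit_succ` applies,
and a carry pending beyond the last digit is excluded because both cells lie in the grid. -/
theorem cellVertex_adj (hm : ∀ l, 0 < m l) (j : Fin k) {idx idx' : ℕ} (hN : idx < gridSize m)
    (hN' : idx' < gridSize m) (h : CellAdj (m j) (gridSize m) idx idx') :
    (gridGraph m).Adj (cellVertex hm j idx) (cellVertex hm j idx') := by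
  wlog hlt : ((idx + 1 = idx' ∧ idx % m j + 1 < m j) ∨ (idx + m j = idx' ∧ idx' < gridSize m))
    generalizing idx idx'
  · exact (this hN' hN h.symm (h.resolve_left hlt)).symm
  have hj := hm j
  rcases hlt with ⟨rfl, h2⟩ | ⟨rfl, h2⟩
  · have e : idx + 1 = idx / m j * m j + (idx % m j + 1) := by
      rw [← add_assoc, Nat.div_add_mod']
    obtain ⟨e1, e2⟩ := BlockClass.div_mod_of (r := idx / m j) h2
    rw [← e] at e1 e2
    refine ⟨j, ?_, fun l hl => cellVertex_congr hm j e1.symm l hl⟩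
    rw [SimpleGraph.pathGraph_adj, cellVertex_div_mod, cellVertex_div_mod, e2]
    exact Or.inl rfl
  · have e1 : (idx + m j) / m j = idx / m j + 1 := Nat.add_div_right _ hj
    have e2 : (idx + m j) % m j = idx % m j := Nat.add_mod_right _ _
    rcases snakeDigit_succ hm j e1 k le_rfl with ⟨h3, -⟩ | ⟨-, i, h3, h4, h5⟩
    · rw [crossIndex_last j hN, crossIndex_last j hN'] at h3
      omega
    · have hij : i ≠ j := by
        rintro rfl
        rw [snakeDigit_self, snakeDigit_self] at h4
        omega
      refine ⟨⟨i, h3⟩, ?_, fun l hl => ?_⟩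
      · rw [SimpleGraph.pathGraph_adj]
        simp only [cellVertex, cellDigit, if_neg hij]
        omega
      · apply Fin.ext
        simp only [cellVertex, cellDigit, side_val, e2]
        split_ifs
        · rfl
        · exact (h5 l l.is_lt fun hh => hl (Fin.ext hh)).symm

end Grid

/-! ## Distributing items in a round robin -/

/-- The number of earlier items with the same key. -/
def rank (key : ℕ → ℕ) (z : ℕ) : ℕ := ((Finset.range z).filter fun z' => key z' = key z).card

/-- The running counts of the elements with `P` are 0, 1, 2, …, each attained once, so a condition
on them can be tested on an initial interval. -/
theorem card_filter_rank (N : ℕ) (P : ℕ → Prop) [DecidablePred P] (Q : ℕ → Prop) [DecidablePred Q] :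
    ((Finset.range N).filter fun z => P z ∧ Q ((Finset.range z).filter P).card).card =
      ((Finset.range ((Finset.range N).filter P).card).filter Q).card := by
  induction N with
  | zero => simp
  | succ N ih =>
    rw [Finset.range_add_one, Finset.filter_insert, Finset.filter_insert]
    by_cases hP : P N
    · rw [if_pos hP, Finset.card_insert_of_notMem (s := (Finset.range N).filter P) (by simp),
        Finset.range_add_one, Finset.filter_insert]
      by_cases hQ : Q ((Finset.range N).filter P).card
      · rw [if_pos ⟨hP, hQ⟩, if_pos hQ, Finset.card_insert_of_notMem (by simp),
          Finset.card_insert_of_notMem (by simp), ih]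
      · rw [if_neg (fun h => hQ h.2), if_neg hQ, ih]
    · rw [if_neg (fun h => hP h.1), if_neg hP, ih]

theorem card_filter_mod {q l d : ℕ} (hd : d < l) :
    ((Finset.range (l * q)).filter fun c => c % l = d).card = q := by
  have : ((Finset.range (l * q)).filter fun c => c % l = d) =
      (Finset.range q).image fun t => l * t + d := by
    ext c
    simp only [Finset.mem_filter, Finset.mem_range, Finset.mem_image]
    constructor
    · rintro ⟨h1, rfl⟩
      exact ⟨c / l, Nat.div_lt_of_lt_mul h1, Nat.div_add_mod c l⟩
    · rintro ⟨t, h1, rfl⟩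
      refine ⟨?_, by rw [Nat.mul_add_mod, Nat.mod_eq_of_lt hd]⟩
      have : l * (t + 1) ≤ l * q := Nat.mul_le_mul_left _ h1
      rw [mul_add] at this
      omega
  rw [this, Finset.card_image_of_injective, Finset.card_range]
  intro t t' h
  simp only [add_left_inj] at h
  exact Nat.eq_of_mul_eq_mul_left (by omega) h

/-- A decomposition of `0, …, N - 1` into segments, which belong to groups `g`. -/
structure Segments (N : ℕ) (start len g : ℕ → ℕ) : Prop where
  start_le : ∀ z < N, start z ≤ z
  lt : ∀ z < N, z < start z + len z
  le : ∀ z < N, start z + len z ≤ N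
  eq : ∀ z < N, ∀ z', start z ≤ z' → z' < start z + len z →
    start z' = start z ∧ len z' = len z ∧ g z' = g z
  len_eq : ∀ z < N, ∀ z' < N, g z = g z' → len z = len z'

/-- The place in its segment for each item: those with even key are placed forwards, those with odd
key backwards. -/
def roundRobin (key len : ℕ → ℕ) (z : ℕ) : ℕ :=
  if key z % 2 = 0 then rank key z % len z else len z - 1 - rank key z % len z

section

variable {N : ℕ} {start len g : ℕ → ℕ} (h : Segments N start len g)
include h

/-- The cells of the group before this segment form whole segments, all of the same length. -/
theorem Segments.len_dvd {z : ℕ} (hz : z < N) :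
    len z ∣ ((Finset.range (start z)).filter fun z' => g z' = g z).card := by
  have hz0 := h.start_le z hz
  have hself := (h.eq z hz (start z) le_rfl (by have := h.lt z hz; omega)).1
  rw [Finset.card_eq_sum_card_image start]
  refine Finset.dvd_sum fun s hs => ?_
  obtain ⟨y, hy, rfl⟩ := Finset.mem_image.1 hs
  simp only [Finset.mem_filter, Finset.mem_range] at hy
  have hyN : y < N := by omega
  have hle : start y + len y ≤ start z := by
    by_contra hlt
    have := (h.eq y hyN (start z) (by have := h.start_le y hyN; omega) (by omega)).1
    have := h.start_le y hyN
    omega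
  have : (((Finset.range (start z)).filter fun z' => g z' = g z).filter
      fun z' => start z' = start y) = Finset.Ico (start y) (start y + len y) := by
    ext x
    simp only [Finset.mem_filter, Finset.mem_range, Finset.mem_Ico]
    constructor
    · rintro ⟨⟨h1, h2⟩, h3⟩
      have h4 := h.lt x (by omega)
      have h5 := h.start_le x (by omega)
      have h6 := h.len_eq x (by omega) y hyN (h2.trans hy.2.symm)
      omega
    · rintro ⟨h1, h2⟩
      have h3 := h.eq y hyN x h1 h2
      exact ⟨⟨by omega, h3.2.2.trans hy.2⟩, h3.1⟩
  rw [this, Nat.card_Ico, h.len_eq z hz y hyN hy.2.symm]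
  simp

theorem Segments.roundRobin_lt (key : ℕ → ℕ) {z : ℕ} (hz : z < N) : roundRobin key len z < len z := by
  have h1 := h.lt z hz
  have h2 := h.start_le z hz
  have := Nat.mod_lt (rank key z) (show 0 < len z by omega)
  rw [roundRobin]
  split_ifs <;> omega

/-- Robots with a common destination lie in one segment. If their bits agree, their ranks differ by
less than the length, so the residues differ. Otherwise let A and B be the numbers of zeros and ones
of the group before the segment. The length divides A + B by `Segments.len_dvd`, so modulo the
length the zeros of the segment are dealt upwards from A and its ones downwards from -B - 1 ≡ A - 1.
They cannot meet, as together there are at most as many robots as places. -/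
theorem Segments.dest_inj {key b : ℕ → ℕ} (hk : ∀ z, key z = 2 * g z + b z) (hb : ∀ z, b z < 2)
    {z z' : ℕ} (hz : z < N) (hz' : z' < N)
    (e : start z + roundRobin key len z = start z' + roundRobin key len z') : z = z' := by
  have r1 := h.roundRobin_lt key hz
  have r2 := h.roundRobin_lt key hz'
  obtain ⟨s1, l1, g1⟩ := h.eq z hz (start z + roundRobin key len z) (by omega) (by omega)
  obtain ⟨s2, l2, g2⟩ := h.eq z' hz' (start z + roundRobin key len z) (by omega) (by omega)
  rw [s1] at s2
  rw [l1] at l2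
  rw [g1] at g2
  have e' : roundRobin key len z = roundRobin key len z' := by omega
  have a1 := h.start_le z hz
  have a2 := h.start_le z' hz'
  have b1 := h.lt z hz
  have b2 := h.lt z' hz'
  have split : ∀ y, y < N → start y = start z → ∀ c, ((Finset.range y).filter fun x => key x = c).card =
      ((Finset.range (start z)).filter fun x => key x = c).card +
        ((Finset.Ico (start z) y).filter fun x => key x = c).card := by
    intro y hy hs c
    have := h.start_le y hy
    rw [← Finset.card_union_of_disjoint, ← Finset.filter_union]
    · congr 2
      ext x
      simp only [Finset.mem_range, Finset.mem_union, Finset.mem_Ico]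
      omega
    · refine Finset.disjoint_filter_filter (Finset.disjoint_left.2 fun x => ?_)
      simp only [Finset.mem_range, Finset.mem_Ico]
      omega
  have same : ∀ y y', y < y' → y' < start z + len z → start z ≤ y → key y = key y' →
      ((Finset.Ico (start z) y).filter fun x => key x = key y).card <
        ((Finset.Ico (start z) y').filter fun x => key x = key y').card ∧
      ((Finset.Ico (start z) y').filter fun x => key x = key y').card <
        ((Finset.Ico (start z) y).filter fun x => key x = key y).card + len z := by
    intro y y' h1 h2 h3 h4
    constructor
    · refine Finset.card_lt_card (Finset.ssubset_iff_of_subset ?_ |>.2 ⟨y, ?_, ?_⟩)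
      · intro x
        simp only [Finset.mem_filter, Finset.mem_Ico, h4]
        omega
      · simp only [Finset.mem_filter, Finset.mem_Ico]
        omega
      · simp
    · refine (Finset.card_le_card (t := ((Finset.Ico (start z) y).filter
        fun x => key x = key y) ∪ Finset.Ico y y') ?_).trans_lt
        ((Finset.card_union_le _ _).trans_lt ?_)
      · intro x
        simp only [Finset.mem_filter, Finset.mem_Ico, Finset.mem_union, h4]
        omega
      · rw [Nat.card_Ico]
        omega
  have mod_ne : ∀ u v l : ℕ, u < v → v < u + l → u % l ≠ v % l := by
    intro u v l h1 h2 h3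
    have := (Nat.modEq_iff_dvd' h1.le).1 h3
    have := Nat.le_of_dvd (by omega) this
    omega
  by_cases hbb : b z = b z'
  · have hkk : key z = key z' := by rw [hk, hk, g2, hbb]
    have hrr : rank key z % len z = rank key z' % len z := by
      have m1 := Nat.mod_lt (rank key z) (show 0 < len z by omega)
      have m2 := Nat.mod_lt (rank key z') (show 0 < len z by omega)
      rw [roundRobin, roundRobin, ← hkk, ← l2] at e'
      split_ifs at e' <;> omega
    have t1 := split z hz rfl (key z)
    have t2 := split z' hz' s2.symm (key z')
    rw [rank, rank] at hrr
    rcases lt_trichotomy z z' with hlt | heq | hlt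
    · have := same z z' hlt (by omega) (by omega) hkk
      rw [← hkk] at t2 this
      rw [← hkk] at hrr
      exact (mod_ne _ _ _ (by omega) (by omega) hrr).elim
    · exact heq
    · have := same z' z hlt (by omega) (by omega) hkk.symm
      rw [hkk] at t1 this hrr
      exact (mod_ne _ _ _ (by omega) (by omega) hrr.symm).elim
  · exfalso
    -- The situation is symmetric, so `z` may be taken to be the robot dealt forwards.
    wlog h0 : b z = 0 generalizing z z'
    · have hb1 := hb z
      have hb2 := hb z'
      refine this hz' hz e.symm r2 r1 ?_ ?_ ?_ ?_ ?_ ?_ e'.symm a2 a1 b2 b1 ?_ ?_ (Ne.symm hbb)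
        (by omega)
      · rw [← e, ← s2, s1]
      · rw [← e, ← l2, l1]
      · rw [← e, ← g2, g1]
      · exact s2.symm
      · exact l2.symm
      · exact g2.symm
      · rwa [← s2]
      · rwa [← s2, ← l2]
    have h1 : b z' = 1 := by
      have := hb z'
      omega
    have t1 := split z hz rfl (key z)
    have t2 := split z' hz' s2.symm (key z')
    rw [← rank] at t1 t2
    obtain ⟨q, hq⟩ := h.len_dvd hz
    have sum : ((Finset.range (start z)).filter fun x => g x = g z).card =
        ((Finset.range (start z)).filter fun x => key x = key z).card +
        ((Finset.range (start z)).filter fun x => key x = key z').card := by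
      rw [← Finset.card_union_of_disjoint, ← Finset.filter_or]
      · congr 1
        refine Finset.filter_congr fun x _ => ?_
        have := hb x
        rw [hk, hk, hk]
        omega
      · refine Finset.disjoint_filter.2 fun x _ h2 h3 => ?_
        rw [h2, hk, hk] at h3
        omega
    -- The summand 2 stands for `z` and `z'` themselves.
    have bound : ((Finset.Ico (start z) z).filter fun x => key x = key z).card +
        ((Finset.Ico (start z) z').filter fun x => key x = key z').card + 2 ≤ len z := by
      have k1 : z ∉ (Finset.Ico (start z) z).filter fun x => key x = key z := by simp
      have k2 : z' ∉ (Finset.Ico (start z) z').filter fun x => key x = key z' := by simp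
      have k3 := Finset.card_insert_of_notMem k1
      have k4 := Finset.card_insert_of_notMem k2
      have k5 : Disjoint (insert z ((Finset.Ico (start z) z).filter fun x => key x = key z))
          (insert z' ((Finset.Ico (start z) z').filter fun x => key x = key z')) := by
        rw [Finset.disjoint_left]
        intro x h2 h3
        have h4 : key x = key z := by
          rcases Finset.mem_insert.1 h2 with rfl | h5
          exacts [rfl, (Finset.mem_filter.1 h5).2]
        have h6 : key x = key z' := by
          rcases Finset.mem_insert.1 h3 with rfl | h5
          exacts [rfl, (Finset.mem_filter.1 h5).2]
        rw [h4, hk, hk] at h6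
        omega
      have k6 := Finset.card_union_of_disjoint k5
      have k7 := Finset.card_le_card (s := (insert z ((Finset.Ico (start z) z).filter
          fun x => key x = key z)) ∪
          (insert z' ((Finset.Ico (start z) z').filter fun x => key x = key z')))
          (t := Finset.Ico (start z) (start z + len z)) (by
        intro x
        simp only [Finset.mem_union, Finset.mem_insert, Finset.mem_filter, Finset.mem_Ico]
        omega)
      rw [Nat.card_Ico] at k7
      omega
    have kz : key z % 2 = 0 := by
      rw [hk]
      omega
    have kz' : ¬ key z' % 2 = 0 := by
      rw [hk]
      omega
    rw [roundRobin, roundRobin, if_pos kz, if_neg kz', ← l2] at e'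
    have d1 := Nat.div_add_mod (rank key z) (len z)
    have d2 := Nat.div_add_mod (rank key z') (len z)
    have m2 := Nat.mod_lt (rank key z') (show 0 < len z by omega)
    set u := ((Finset.Ico (start z) z).filter fun x => key x = key z).card
    set w := ((Finset.Ico (start z) z').filter fun x => key x = key z').card
    -- Equal places force the sum of the two ranks plus one to be a multiple of the length. The part
    -- before the segment is such a multiple, so `len z` divides `u + w + 1`, which lies strictly
    -- between 0 and `len z`.
    have e2 : len z * q + (u + w + 1) =
        len z * (rank key z / len z + rank key z' / len z + 1) := by
      rw [mul_add, mul_add]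
      omega
    have : len z ∣ u + w + 1 := (Nat.dvd_add_right ⟨q, rfl⟩).1 ⟨_, e2⟩
    have := Nat.le_of_dvd (by omega) this
    omega

end

/-! ## Blocks of a grid -/

/-- The first number in the block of size `S` of `x`. -/
def blockStart (S x : ℕ) : ℕ := x - x % S

/-- The number of elements below `M` in the block of size `S` of `x`. -/
def blockLen (S M x : ℕ) : ℕ := min S (M - blockStart S x)

theorem blockStart_eq (S x : ℕ) : blockStart S x = S * (x / S) := by
  have := Nat.div_add_mod x S
  rw [blockStart]
  omega

theorem blockStart_le (S x : ℕ) : blockStart S x ≤ x := Nat.sub_le _ _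

theorem blockStart_of_mem {S x d : ℕ} (hd : d < S) :
    blockStart S (blockStart S x + d) = blockStart S x := by
  rw [blockStart_eq S x, blockStart_eq, Nat.mul_add_div (by omega), Nat.div_eq_of_lt hd, add_zero]

theorem lt_blockStart_add {S M x x' : ℕ} (hS : 0 < S) (hx : x < M) (h : blockStart S x = blockStart S x') :
    x < blockStart S x' + blockLen S M x' := by
  have := Nat.mod_lt x hS
  have h2 := Nat.mod_le x S
  rw [blockLen, ← h]
  rw [blockStart]
  omega

theorem blockStart_add_le {S M x : ℕ} (hx : x < M) : blockStart S x + blockLen S M x ≤ M := by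
  have := blockStart_le S x
  rw [blockLen]
  omega

section Phase

variable {k : ℕ} {m : Fin k → ℕ} (hm : ∀ l, 0 < m l) (S : ℕ → ℕ) (R : ℕ → Prop) (j : Fin k)

open Classical in
/-- Round the coordinates in `R` down to the start of their blocks. -/
noncomputable def roundDown (v : GridVertex m) : GridVertex m := fun l =>
  ⟨if R l then blockStart (S l) (v l) else v l, by
    split_ifs
    exacts [(blockStart_le _ _).trans_lt (v l).is_lt, (v l).is_lt]⟩

variable (m) in
/-- The first cell in the segment of a cell. -/
def cellStart (z : ℕ) : ℕ := z - z % m j % S j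

variable (m) in
/-- The length of the segment of a cell. -/
def cellLen (z : ℕ) : ℕ := blockLen (S j) (m j) (z % m j)

/-- The number of the group of a cell. -/
noncomputable def cellGroup (z : ℕ) : ℕ := vertexCode (roundDown S R (cellVertex hm j z))

variable {S R j}

theorem roundDown_eq_iff {v v' : GridVertex m} : roundDown S R v = roundDown S R v' ↔
    ∀ l : Fin k, (R l → blockStart (S l) (v l) = blockStart (S l) (v' l)) ∧ (¬ R l → v l = v' l) := by
  constructor
  · intro h l
    have := congrArg Fin.val (congrFun h l)
    simp only [roundDown] at this
    constructor
    · intro hR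
      rwa [if_pos hR, if_pos hR] at this
    · intro hR
      rw [if_neg hR, if_neg hR] at this
      exact Fin.ext this
  · intro h
    funext l
    apply Fin.ext
    simp only [roundDown]
    split_ifs with hR
    · exact (h l).1 hR
    · rw [(h l).2 hR]

theorem cellGroup_eq_iff {z z' : ℕ} : cellGroup hm S R j z = cellGroup hm S R j z' ↔
    roundDown S R (cellVertex hm j z) = roundDown S R (cellVertex hm j z') :=
  vertexCode_injective.eq_iff

theorem cellStart_eq (z : ℕ) : cellStart m S j z = z / m j * m j + blockStart (S j) (z % m j) := by
  have h1 := Nat.div_add_mod' z (m j)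
  have h2 := Nat.mod_le (z % m j) (S j)
  rw [cellStart, blockStart]
  omega

include hm in
theorem cell_of_segment {z z' : ℕ} (h1 : cellStart m S j z ≤ z')
    (h2 : z' < cellStart m S j z + cellLen m S j z) :
    z' / m j = z / m j ∧ blockStart (S j) (z' % m j) = blockStart (S j) (z % m j) ∧
      z' % m j = blockStart (S j) (z % m j) + (z' - cellStart m S j z) := by
  have h3 := blockStart_add_le (S := S j) (Nat.mod_lt z (hm j))
  rw [cellLen] at h2
  rw [cellStart_eq] at h1 h2 ⊢
  obtain ⟨d, rfl⟩ := Nat.exists_eq_add_of_le h1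
  have h4 : d < S j := by
    have : blockLen (S j) (m j) (z % m j) ≤ S j := min_le_left _ _
    omega
  obtain ⟨e1, e2⟩ := BlockClass.div_mod_of (M := m j) (r := z / m j)
    (x := blockStart (S j) (z % m j) + d) (by omega)
  rw [← add_assoc] at e1 e2
  rw [e1, e2]
  exact ⟨rfl, blockStart_of_mem h4, by omega⟩

/-- A group is cut out by rounding coordinates, `j` among them, so it contains a segment together
with any of its cells. Blocks at the border may be truncated, but the length depends only on the
block of coordinate `j`, which is common to a group. -/
theorem segments (hS : 0 < S j) (hR : R j) :
    Segments (gridSize m) (cellStart m S j) (cellLen m S j) (cellGroup hm S R j) := by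
  have hmul : m j ∣ gridSize m := Finset.dvd_prod_of_mem m (Finset.mem_univ j)
  refine ⟨fun z _ => Nat.sub_le _ _, fun z hz => ?_, fun z hz => ?_, fun z hz z' h1 h2 => ?_,
    fun z hz z' hz' h => ?_⟩
  · have := lt_blockStart_add hS (Nat.mod_lt z (hm j)) (rfl : blockStart (S j) (z % m j) = _)
    have h1 := Nat.div_add_mod' z (m j)
    rw [cellStart_eq, cellLen]
    omega
  · have := blockStart_add_le (S := S j) (Nat.mod_lt z (hm j))
    obtain ⟨L, hL⟩ := hmul
    have h1 : z / m j < L := Nat.div_lt_of_lt_mul (hL ▸ hz)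
    have h2 : (z / m j + 1) * m j ≤ L * m j := Nat.mul_le_mul_right _ h1
    rw [hL, cellStart_eq, cellLen]
    rw [add_mul, mul_comm L] at h2
    omega
  · obtain ⟨e1, e2, -⟩ := cell_of_segment hm h1 h2
    refine ⟨by rw [cellStart_eq, cellStart_eq, e1, e2], ?_, ?_⟩
    · rw [cellLen, cellLen, blockLen, blockLen, e2]
    · rw [cellGroup_eq_iff, roundDown_eq_iff]
      intro l
      by_cases hl : l = j
      · subst hl
        rw [cellVertex_div_mod, cellVertex_div_mod]
        exact ⟨fun _ => e2, fun h => (h hR).elim⟩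
      · rw [cellVertex_congr hm j e1 l hl]
        exact ⟨fun _ => rfl, fun _ => rfl⟩
  · rw [cellGroup_eq_iff, roundDown_eq_iff] at h
    have := (h j).1 hR
    rw [cellVertex_div_mod, cellVertex_div_mod] at this
    rw [cellLen, cellLen, blockLen, blockLen, this]

/-! ### Destinations in a phase, and the balance of bits -/

variable (m S j) in
/-- The destination cell of the robot in cell `z`. -/
def cellDest (key : ℕ → ℕ) (z : ℕ) : ℕ :=
  cellStart m S j z + roundRobin key (cellLen m S j) z

theorem cellVertex_dest (hS : 0 < S j) (hR : R j) (key : ℕ → ℕ) {z : ℕ} (hz : z < gridSize m) :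
    (∀ l, l ≠ j → cellVertex hm j (cellDest m S j key z) l = cellVertex hm j z l) ∧
    (cellVertex hm j (cellDest m S j key z) j : ℕ) =
      blockStart (S j) (cellVertex hm j z j) + roundRobin key (cellLen m S j) z ∧
    blockStart (S j) (cellVertex hm j (cellDest m S j key z) j) =
      blockStart (S j) (cellVertex hm j z j) := by
  have h1 := (segments hm hS hR).roundRobin_lt key hz
  obtain ⟨e1, e2, e3⟩ := cell_of_segment hm (z := z) (z' := cellDest m S j key z) (Nat.le_add_right _ _)
    (Nat.add_lt_add_left h1 _)
  refine ⟨fun l hl => cellVertex_congr hm j e1 l hl, ?_, ?_⟩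
  · rw [cellVertex_div_mod, cellVertex_div_mod, e3, cellDest]
    omega
  · rw [cellVertex_div_mod, cellVertex_div_mod, e2]

/-- In each group, as many robots with bit `0` as vertices whose coordinate `i` lies in the first
half of its block. -/
def Balanced (S : ℕ → ℕ) (R : ℕ → Prop) (i : Fin k) (h : ℕ) (bit : ℕ → ℕ)
    (Y : Fin (gridSize m) → GridVertex m) : Prop :=
  ∀ v, Nat.card {r : Fin (gridSize m) // roundDown S R (Y r) = roundDown S R v ∧ bit r = 0} =
    Nat.card {u : GridVertex m // roundDown S R u = roundDown S R v ∧ (u i : ℕ) / h % 2 = 0}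

/-- Each robot shares its block with its goal, and goals are in bijection with vertices, so counting
robots amounts to counting their goals. -/
theorem Balanced.init {i : Fin k} {h : ℕ} {bit : ℕ → ℕ} {Y : Fin (gridSize m) → GridVertex m}
    (XG : GridConfig m) (hY : ∀ r, roundDown S R (Y r) = roundDown S R (XG r))
    (hbit : ∀ r : Fin (gridSize m), bit r = (XG r i : ℕ) / h % 2) : Balanced S R i h bit Y := by
  intro v
  have hb : Function.Bijective XG := by
    rw [Fintype.bijective_iff_injective_and_card]
    exact ⟨XG.injective, by simp [GridVertex, gridSize]⟩
  refine Nat.card_congr ((Equiv.ofBijective _ hb).subtypeEquiv fun r => ?_)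
  rw [hY, hbit]
  rfl

theorem update_apply_self_val (v : GridVertex m) (j : Fin k) {x : ℕ} (hx : x < m j) :
    ((Function.update v j ⟨x, hx⟩ : GridVertex m) j : ℕ) = x := by
  rw [Function.update_self]

/-- The vertices in a group, by their coordinate `j` and the remaining coordinates. -/
theorem card_group (hS : 0 < S j) (hR : R j) (P : GridVertex m → Prop) (Q : ℕ → Prop)
    (hP : ∀ v x, P (Function.update v j x) ↔ P v) (v : GridVertex m) :
    Nat.card {u : GridVertex m // roundDown S R u = roundDown S R v ∧
        (P u ∧ Q (u j - blockStart (S j) (v j)))} =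
      Nat.card {d : Fin (blockLen (S j) (m j) (v j)) // Q d} *
      Nat.card {u : GridVertex m // roundDown S (fun l => R l ∧ l ≠ j) u =
        roundDown S (fun l => R l ∧ l ≠ j) v ∧ P u} := by
  rw [← Nat.card_prod]
  have hle := blockStart_add_le (S := S j) (v j).is_lt
  have hlen : blockLen (S j) (m j) (v j) ≤ S j := min_le_left _ _
  have hlt : ∀ d : Fin (blockLen (S j) (m j) (v j)), blockStart (S j) (v j) + d < m j := fun d => by
    have := d.is_lt
    omega
  -- A vertex of the group corresponds to its offset in direction `j` and its projection to the
  -- slice through `v`; the condition `P` does not see coordinate `j`.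
  refine Nat.card_congr ⟨fun u => ⟨⟨⟨u.1 j - blockStart (S j) (v j), ?_⟩, u.2.2.2⟩,
    ⟨Function.update u.1 j (v j), ?_, (hP _ _).2 u.2.2.1⟩⟩,
    fun w => ⟨Function.update w.2.1 j ⟨blockStart (S j) (v j) + w.1.1, hlt w.1.1⟩, ?_,
      (hP _ _).2 w.2.2.2, ?_⟩, ?_, ?_⟩
  · have h1 := (roundDown_eq_iff.1 u.2.1 j).1 hR
    have h2 := lt_blockStart_add hS (u.1 j).is_lt h1
    have h3 := blockStart_le (S j) (u.1 j)
    omega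
  · rw [roundDown_eq_iff]
    intro l
    have := roundDown_eq_iff.1 u.2.1 l
    by_cases hl : l = j
    · subst hl
      rw [Function.update_self]
      exact ⟨fun _ => rfl, fun _ => rfl⟩
    · rw [Function.update_of_ne hl]
      refine ⟨fun h => this.1 h.1, fun h => this.2 fun h' => h ⟨h', fun e => hl (Fin.ext e)⟩⟩
  · rw [roundDown_eq_iff]
    intro l
    have := roundDown_eq_iff.1 w.2.2.1 l
    by_cases hl : l = j
    · subst hl
      rw [update_apply_self_val]
      exact ⟨fun _ => blockStart_of_mem (by have := w.1.1.is_lt; omega), fun h => (h hR).elim⟩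
    · rw [Function.update_of_ne hl]
      refine ⟨fun h => this.1 ⟨h, fun e => hl (Fin.ext e)⟩, fun h => this.2 fun h' => h h'.1⟩
  · rw [update_apply_self_val, Nat.add_sub_cancel_left]
    exact w.1.2
  · rintro ⟨u, h1, h2, h3⟩
    have h4 := (roundDown_eq_iff.1 h1 j).1 hR
    have h3 := blockStart_le (S j) (u j)
    apply Subtype.ext
    simp only [Function.update_idem]
    funext l
    by_cases hl : l = j
    · subst hl
      apply Fin.ext
      rw [update_apply_self_val]
      omega
    · rw [Function.update_of_ne hl]
  · rintro ⟨⟨d, h1⟩, u, h2, h3⟩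
    have h4 := (roundDown_eq_iff.1 h2 j).2 (fun h => h.2 rfl)
    refine Prod.ext (Subtype.ext (Fin.ext ?_)) (Subtype.ext ?_)
    · simp only [update_apply_self_val, Nat.add_sub_cancel_left]
    · simp only [Function.update_idem]
      rw [← h4, Function.update_eq_self]

variable {bit p a key : ℕ → ℕ} {Y : Fin (gridSize m) → GridVertex m}

/-- Counting robots by their cells. -/
theorem card_robots {N : ℕ} (hp : InvPair N p a) (P : ℕ → Prop) [DecidablePred P] :
    Nat.card {r : Fin N // P (p r)} = ((Finset.range N).filter P).card := by
  rw [Nat.card_eq_fintype_card, Fintype.card_subtype]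
  refine Finset.card_bij (fun r _ => p r) (fun r hr => ?_) (fun r _ r' _ e => ?_) fun z hz => ?_
  · simp only [Finset.mem_filter, Finset.mem_univ, true_and] at hr
    simp [hr, hp.lt r r.is_lt]
  · exact Fin.ext (hp.inj r.is_lt r'.is_lt e)
  · simp only [Finset.mem_filter, Finset.mem_range] at hz
    exact ⟨⟨a z, hp.lt' z hz.1⟩, by simp [hp.right z hz.1, hz.2], hp.right z hz.1⟩

theorem rank_eq_card {b : ℕ → ℕ} (hkey : ∀ z, key z = 2 * cellGroup hm S R j z + b z)
    (hb : ∀ z, b z < 2) {z c β : ℕ} (hz : cellGroup hm S R j z = c) (hz' : b z = β) :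
    rank key z = ((Finset.range z).filter fun z' => cellGroup hm S R j z' = c ∧ b z' = β).card := by
  rw [rank]
  congr 1
  refine Finset.filter_congr fun z' _ => ?_
  have h1 := hb z
  have h2 := hb z'
  rw [hkey, hkey]
  omega

theorem Balanced.card_cells {i : Fin k} {h : ℕ} (hB : Balanced S R i h bit Y)
    (hp : InvPair (gridSize m) p a) (hY : ∀ r : Fin (gridSize m), Y r = cellVertex hm j (p r))
    (v : GridVertex m) : ((Finset.range (gridSize m)).filter fun z =>
      cellGroup hm S R j z = vertexCode (roundDown S R v) ∧ bit (a z) = 0).card =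
    Nat.card {u : GridVertex m // roundDown S R u = roundDown S R v ∧ (u i : ℕ) / h % 2 = 0} := by
  rw [← hB v, ← card_robots hp]
  refine Nat.card_congr (Equiv.subtypeEquivRight fun r => ?_)
  rw [hp.left r r.is_lt, hY, cellGroup, vertexCode_injective.eq_iff]

/-- By `card_group` the group contains `len * q` zeros, where `q` is the number wanted in each
slice. Their ranks are 0, …, `len * q - 1` and meet every residue modulo `len` exactly `q` times,
and since zeros are dealt forwards, this residue is the new offset in direction `j`. The number `q`
is the same for all slices because `i ≠ j`. -/
theorem Balanced.phase (hS : 0 < S j) (hR : R j) {i : Fin k} (hij : i ≠ j) {h : ℕ}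
    (hB : Balanced S R i h bit Y) (hp : InvPair (gridSize m) p a)
    (hY : ∀ r : Fin (gridSize m), Y r = cellVertex hm j (p r))
    (hkey : ∀ z, key z = 2 * cellGroup hm S R j z + bit (a z)) (hbit : ∀ r, bit r < 2) :
    Balanced S (fun l => R l ∧ l ≠ j) i h bit
      (fun r => cellVertex hm j (cellDest m S j key (p r))) := by
  classical
  intro v
  have hgroup := card_group hS hR (fun u => (u i : ℕ) / h % 2 = 0) (fun _ => True)
    (fun v x => by rw [Function.update_of_ne hij]) v
  have hfin : Nat.card {d : Fin (blockLen (S j) (m j) (v j)) // True} = blockLen (S j) (m j) (v j) := by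
    simp
  simp only [and_true] at hgroup
  rw [hfin, ← hB.card_cells hm hp hY v] at hgroup
  have hd : v j - blockStart (S j) (v j) < blockLen (S j) (m j) (v j) := by
    have h1 := lt_blockStart_add hS (v j).is_lt (rfl : blockStart (S j) (v j) = _)
    have h2 := blockStart_le (S j) (v j)
    omega
  have hcount := card_filter_rank (gridSize m)
    (fun z => cellGroup hm S R j z = vertexCode (roundDown S R v) ∧ bit (a z) = 0)
    (fun c => c % blockLen (S j) (m j) (v j) = v j - blockStart (S j) (v j))
  rw [hgroup, card_filter_mod hd] at hcount
  rw [← hcount, ← card_robots hp]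
  refine Nat.card_congr (Equiv.subtypeEquivRight fun r => ?_)
  obtain ⟨c1, c2, c3⟩ := cellVertex_dest hm hS hR key (hp.lt r r.is_lt)
  rw [hp.left r r.is_lt]
  have e1 : roundDown S (fun l => R l ∧ l ≠ j) (cellVertex hm j (cellDest m S j key (p r))) =
      roundDown S (fun l => R l ∧ l ≠ j) v ↔
      roundDown S R (cellVertex hm j (p r)) = roundDown S R v ∧
      (cellVertex hm j (cellDest m S j key (p r)) j : ℕ) = v j := by
    rw [roundDown_eq_iff, roundDown_eq_iff]
    constructor
    · intro H
      have H' : cellVertex hm j (cellDest m S j key (p r)) j = v j := (H j).2 (by simp)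
      refine ⟨fun l => ?_, congrArg Fin.val H'⟩
      by_cases hl : l = j
      · subst hl
        rw [← c3, H']
        exact ⟨fun _ => rfl, fun h => (h hR).elim⟩
      · rw [← c1 l hl]
        exact ⟨fun h => (H l).1 ⟨h, fun e => hl (Fin.ext e)⟩, fun h => (H l).2 fun h' => h h'.1⟩
    · rintro ⟨H, H'⟩ l
      by_cases hl : l = j
      · subst hl
        exact ⟨fun h => (h.2 rfl).elim, fun _ => Fin.ext H'⟩
      · rw [c1 l hl]
        exact ⟨fun h => (H l).1 h.1, fun h => (H l).2 fun h' => h ⟨h', fun e => hl (Fin.ext e)⟩⟩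
  rw [e1, cellGroup, vertexCode_injective.eq_iff, and_assoc, and_assoc]
  refine and_congr_right fun h1 => ?_
  rw [and_comm]
  refine and_congr_right fun h2 => ?_
  have h3 : blockStart (S j) (cellVertex hm j (p r) j) = blockStart (S j) (v j) :=
    (roundDown_eq_iff.1 h1 j).1 hR
  have h4 : cellLen m S j (p r) = blockLen (S j) (m j) (v j) := by
    rw [cellLen, blockLen, blockLen, ← cellVertex_div_mod hm, h3]
  have h5 : key (p r) % 2 = 0 := by
    rw [hkey, hp.left r r.is_lt, h2]
    omega
  rw [c2, h3, roundRobin, if_pos h5, h4, rank_eq_card hm hkey (fun z => hbit (a z)) (β := 0)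
    (congrArg vertexCode h1) (by rw [hp.left r r.is_lt, h2])]
  have h6 := blockStart_le (S j) (v j)
  omega

theorem div_half {h x : ℕ} (hh : 0 < h) : x / h % 2 = 0 ↔ x - blockStart (2 * h) x < h := by
  have h1 : x - blockStart (2 * h) x = x % (2 * h) := by
    have := Nat.mod_le x (2 * h)
    rw [blockStart]
    omega
  rw [h1]
  have h2 : x / h % 2 = x % (2 * h) / h := by rw [mul_comm, Nat.mod_mul_right_div_self]
  rw [h2, Nat.div_eq_zero_iff_lt hh]

/-- When only coordinate `j` is left, a group is a single segment, with `min len h` zeros by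
balance. Ranks start from 0 there, so the zeros fill the front, and the ones, dealt from the other
end, are too few to reach the first half. -/
theorem Balanced.final {h : ℕ} (hS : S j = 2 * h) (hh : 0 < h) (hR : ∀ l : Fin k, R l ↔ l = j)
    (hB : Balanced S R j h bit Y) (hp : InvPair (gridSize m) p a)
    (hY : ∀ r : Fin (gridSize m), Y r = cellVertex hm j (p r))
    (hkey : ∀ z, key z = 2 * cellGroup hm S R j z + bit (a z)) (hbit : ∀ r, bit r < 2)
    (r : Fin (gridSize m)) :
    (cellVertex hm j (cellDest m S j key (p r)) j : ℕ) / h % 2 = bit r := by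
  classical
  have hRj : R j := (hR j).2 rfl
  have hSj : 0 < S j := by omega
  have hz := hp.lt r r.is_lt
  obtain ⟨c1, c2, c3⟩ := cellVertex_dest hm hSj hRj key hz
  set z := p r with hzdef
  set v := cellVertex hm j z with hv
  have hseg := segments hm hSj hRj
  have hrr := hseg.roundRobin_lt key hz
  have hlen : cellLen m S j z = blockLen (S j) (m j) (v j) := by
    rw [cellLen, blockLen, blockLen, ← cellVertex_div_mod hm]
  -- the number of zeros in the line
  have hzeros : ((Finset.range (gridSize m)).filter fun z' =>
      cellGroup hm S R j z' = cellGroup hm S R j z ∧ bit (a z') = 0).card =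
        min (cellLen m S j z) h := by
    have hgroup := card_group hSj hRj (fun _ => True) (fun d => d < h) (fun v x => Iff.rfl) v
    have e1 : Nat.card {u : GridVertex m // roundDown S (fun l => R l ∧ l ≠ j) u =
        roundDown S (fun l => R l ∧ l ≠ j) v ∧ True} = 1 := by
      rw [Nat.card_eq_one_iff_unique]
      refine ⟨⟨fun u u' => Subtype.ext (funext fun l => ?_)⟩, ⟨⟨v, rfl, trivial⟩⟩⟩
      have h1 : ¬ (R l ∧ (l : ℕ) ≠ j) := fun h => h.2 (congrArg Fin.val ((hR l).1 h.1))
      exact ((roundDown_eq_iff.1 u.2.1 l).2 h1).trans ((roundDown_eq_iff.1 u'.2.1 l).2 h1).symm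
    have e2 : Nat.card {d : Fin (blockLen (S j) (m j) (v j)) // (d : ℕ) < h} =
        min (cellLen m S j z) h := by
      rw [hlen, Nat.card_eq_fintype_card, Fintype.card_subtype]
      exact Fin.card_filter_val_lt
    rw [e1, e2, mul_one] at hgroup
    rw [cellGroup, hB.card_cells hm hp hY v, ← hgroup]
    refine Nat.card_congr (Equiv.subtypeEquivRight fun u => and_congr_right fun h1 => ?_)
    rw [true_and, div_half hh, ← hS, (roundDown_eq_iff.1 h1 j).1 hRj]
  -- the group is contained in the line
  have hline : ∀ z' < gridSize m, cellGroup hm S R j z' = cellGroup hm S R j z →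
      z' ∈ Finset.Ico (cellStart m S j z) (cellStart m S j z + cellLen m S j z) := by
    intro z' hz' hg
    rw [cellGroup_eq_iff, roundDown_eq_iff] at hg
    have h1 := (hg j).1 hRj
    rw [cellVertex_div_mod, cellVertex_div_mod] at h1
    have h2 := lt_blockStart_add hSj (Nat.mod_lt z' (hm j)) h1
    have h3 := blockStart_le (S j) (z' % m j)
    have h4 : cellStart m S j z + (z' % m j - blockStart (S j) (z % m j)) <
        cellStart m S j z + cellLen m S j z := by
      rw [cellLen]
      omega
    obtain ⟨e1, e2, e3⟩ := cell_of_segment hm (Nat.le_add_right _ _) h4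
    have : cellStart m S j z + (z' % m j - blockStart (S j) (z % m j)) = z' := by
      refine cellVertex_injOn hm j (h4.trans_le (hseg.le z hz)) hz' (funext fun l => ?_)
      by_cases hl : l = j
      · subst hl
        apply Fin.ext
        rw [cellVertex_div_mod, cellVertex_div_mod, e3]
        omega
      · rw [cellVertex_congr hm j e1 l hl]
        exact ((hg l).2 fun h => hl ((hR l).1 h)).symm
    rw [Finset.mem_Ico]
    omega
  have hbr : bit r < 2 := hbit r
  have haz : a z = r := hp.left r r.is_lt
  have hx : (cellVertex hm j (cellDest m S j key z) j : ℕ) / h % 2 = 0 ↔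
      roundRobin key (cellLen m S j) z < h := by
    rw [div_half hh, ← hS, c3, c2, Nat.add_sub_cancel_left]
  have hrank := rank_eq_card hm hkey (fun z => hbit (a z)) (z := z) rfl rfl
  rw [haz] at hrank
  have hsub : ∀ β, ((Finset.range z).filter fun z' =>
      cellGroup hm S R j z' = cellGroup hm S R j z ∧ bit (a z') = β) ⊆
      ((Finset.range (gridSize m)).filter fun z' =>
      cellGroup hm S R j z' = cellGroup hm S R j z ∧ bit (a z') = β) := by
    intro β
    exact Finset.filter_subset_filter _ (Finset.range_subset_range.2 hz.le)
  have hmem : z ∈ ((Finset.range (gridSize m)).filter fun z' =>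
      cellGroup hm S R j z' = cellGroup hm S R j z ∧ bit (a z') = bit r) := by
    simp [hz, haz]
  have hlt : rank key z < ((Finset.range (gridSize m)).filter fun z' =>
      cellGroup hm S R j z' = cellGroup hm S R j z ∧ bit (a z') = bit r).card := by
    rw [hrank]
    exact Finset.card_lt_card (Finset.ssubset_iff_of_subset (hsub _) |>.2 ⟨z, hmem, by simp⟩)
  have hpos : 0 < cellLen m S j z := by
    have := hseg.lt z hz
    have := hseg.start_le z hz
    omega
  have hk2 : key z % 2 = bit r := by
    rw [hkey, haz]
    omega
  rcases (show bit r = 0 ∨ bit r = 1 by omega) with h0 | h1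
  · rw [h0] at hlt ⊢
    rw [hzeros] at hlt
    rw [hx, roundRobin, if_pos (by omega)]
    exact (Nat.mod_le _ _).trans_lt (by omega)
  · have h2 := Nat.mod_lt (cellVertex hm j (cellDest m S j key z) j / h) (show 0 < 2 by omega)
    rw [h1] at hlt ⊢
    have hcard : ((Finset.range (gridSize m)).filter fun z' =>
        cellGroup hm S R j z' = cellGroup hm S R j z ∧ bit (a z') = 0).card +
        ((Finset.range (gridSize m)).filter fun z' =>
        cellGroup hm S R j z' = cellGroup hm S R j z ∧ bit (a z') = 1).card ≤ cellLen m S j z := by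
      rw [← Finset.card_union_of_disjoint]
      · refine (Finset.card_le_card (t := Finset.Ico (cellStart m S j z)
          (cellStart m S j z + cellLen m S j z)) fun x hx => ?_).trans (by simp)
        simp only [Finset.mem_union, Finset.mem_filter, Finset.mem_range] at hx
        rcases hx with hx | hx
        exacts [hline x hx.1 hx.2.1, hline x hx.1 hx.2.1]
      · refine Finset.disjoint_filter.2 fun x _ h3 h4 => ?_
        omega
    rw [hzeros] at hcard
    have h3 : ¬ roundRobin key (cellLen m S j) z < h := by
      rw [roundRobin, if_neg (by omega), Nat.mod_eq_of_lt (by omega)]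
      omega
    rw [← hx] at h3
    omega

end Phase

/-! ## The program -/

notation "kᵣ" => 0
notation "nᵣ" => 1
notation "tᵣ" => 2
notation "sᵣ" => 3
notation "iᵣ" => 4
notation "hᵣ" => 5
notation "jᵣ" => 6
notation "mᵣ" => 7
notation "lᵣ" => 8
notation "oᵣ" => 9
notation "xᵣ" => 10
notation "dᵣ" => 11
notation "uᵣ" => 12
notation "cᵣ" => 13
notation "qᵣ" => 14
notation "eᵣ" => 15
notation "yᵣ" => 16
notation "wᵣ" => 17
notation "bᵣ" => 18
notation "aᵣ" => 19
notation "gᵣ" => 20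
notation "fᵣ" => 21
notation "vᵣ" => 22
notation "tmp₀" => 23
notation "tmp₁" => 24
notation "tmp₂" => 25
notation "tmp₃" => 26
notation "tmp₄" => 27

notation "sideₐ" => 0
notation "initₐ" => 1
notation "goalₐ" => 2
notation "outₐ" => 3
notation "strideₐ" => 4
notation "sizeₐ" => 5
notation "orderₐ" => 6
notation "groupₐ" => 7
notation "tableₐ" => 8
notation "cellₐ" => 10
notation "robotₐ" => 11
notation "destₐ" => 12
notation "countₐ" => 13
notation "cornerₐ" => 14
notation "slotₐ" => 15
notation "inverseₐ" => 16

notation:max "ʳ" x:max => Term.reg x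
infix:50 " <ₜ " => Term.bin Op.lt
infix:50 " =ₜ " => Term.bin Op.eq
infix:35 " ≔ " => Prog.assign
infixr:30 " ;; " => Prog.seq

/-- The offset of the cell `c` of a ladder. -/
def offTerm (c : Term) : Term := c % 6 / 2 * ʳaᵣ + c % 2 * ʳgᵣ

/-- Set up the parameters of the block class with number `cᵣ`. -/
def decodeClass : Prog :=
  eᵣ ≔ ʳcᵣ % 7 ;; yᵣ ≔ ʳcᵣ / 7 % 3 ;; wᵣ ≔ ʳcᵣ / 21 % 3 ;; bᵣ ≔ ʳcᵣ / 63 ;;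
  aᵣ ≔ (1 - ʳbᵣ) * ʳmᵣ + ʳbᵣ ;; gᵣ ≔ (1 - ʳbᵣ) + ʳbᵣ * ʳmᵣ ;;
  fᵣ ≔ offTerm (.read tableₐ (245 + ʳeᵣ)) ;; vᵣ ≔ offTerm (.read tableₐ (252 + ʳeᵣ))

/-- The test whether the cell `tmp₀` lies in an active block. -/
def activeTerm : Term :=
  (ʳyᵣ <ₜ ʳtmp₀ / ʳmᵣ + 1) * (ʳwᵣ <ₜ ʳtmp₀ % ʳmᵣ + 1) * (ʳtmp₁ <ₜ 3 - ʳbᵣ) *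
    (ʳtmp₂ <ₜ 2 + ʳbᵣ) * (ʳtmp₀ / ʳmᵣ - ʳtmp₁ + (3 - ʳbᵣ) <ₜ ʳlᵣ + 1) *
    (ʳtmp₀ % ʳmᵣ - ʳtmp₂ + (2 + ʳbᵣ) <ₜ ʳmᵣ + 1) *
    (.read destₐ (.read robotₐ (ʳtmp₃ + ʳvᵣ)) <ₜ .read destₐ (.read robotₐ (ʳtmp₃ + ʳfᵣ)))

/-- Find the active block of robot `xᵣ`. -/
def locate : Prog :=
  tmp₀ ≔ .read cellₐ ʳxᵣ ;; .store cornerₐ ʳxᵣ ʳtmp₀ ;; .store slotₐ ʳxᵣ 6 ;;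
  tmp₁ ≔ (ʳtmp₀ / ʳmᵣ - ʳyᵣ) % 3 ;; tmp₂ ≔ (ʳtmp₀ % ʳmᵣ - ʳwᵣ) % 3 ;;
  tmp₃ ≔ ʳtmp₀ - (ʳtmp₁ * ʳmᵣ + ʳtmp₂) ;;
  .branch activeTerm
    (.store cornerₐ ʳxᵣ ʳtmp₃ ;; .store slotₐ ʳxᵣ
      ((1 - ʳbᵣ) * (2 * ʳtmp₁ + ʳtmp₂) + ʳbᵣ * (2 * ʳtmp₂ + ʳtmp₁)))
    .skip

/-- The move number `qᵣ` of robot `xᵣ`. -/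
def moveRobot : Prog :=
  .store slotₐ ʳxᵣ (.read tableₐ ((ʳeᵣ * 5 + ʳqᵣ) * 7 + .read slotₐ ʳxᵣ)) ;;
  .store outₐ ((ʳtᵣ + 1) * ʳnᵣ + ʳxᵣ)
    (.read orderₐ (ʳoᵣ + (.read cornerₐ ʳxᵣ + offTerm (.read slotₐ ʳxᵣ))))

/-- Record the new cell of robot `xᵣ`. -/
def commit : Prog :=
  tmp₀ ≔ .read cornerₐ ʳxᵣ + offTerm (.read slotₐ ʳxᵣ) ;;
  .store cellₐ ʳxᵣ ʳtmp₀ ;; .store robotₐ ʳtmp₀ ʳxᵣ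

/-- One move of all robots. -/
def moveAll : Prog := .for xᵣ ʳnᵣ moveRobot ;; tᵣ ≔ ʳtᵣ + 1

/-- The compare-exchange step for the block class number `cᵣ`. -/
def sortClass : Prog :=
  decodeClass ;; .for xᵣ ʳnᵣ locate ;; .for qᵣ 5 moveAll ;; .for xᵣ ʳnᵣ commit

/-- Sort the robots in all lines in direction `jᵣ` by their destinations. -/
def sortLines : Prog := .for uᵣ (2 * ʳsᵣ) (.for cᵣ 126 sortClass)

/-- Enumerate cell `xᵣ`. -/
def recordInverse : Prog := .store inverseₐ (.read orderₐ (ʳoᵣ + ʳxᵣ)) ʳxᵣ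

/-- Compute the cell of robot `xᵣ`. -/
def findCell : Prog :=
  tmp₀ ≔ .read inverseₐ (.read outₐ (ʳtᵣ * ʳnᵣ + ʳxᵣ)) ;;
  .store cellₐ ʳxᵣ ʳtmp₀ ;; .store robotₐ ʳtmp₀ ʳxᵣ

/-- The destination of the robot in cell `xᵣ`. -/
def assignDest : Prog :=
  tmp₀ ≔ .read robotₐ ʳxᵣ ;;
  tmp₁ ≔ 2 * .read groupₐ (.read orderₐ (ʳoᵣ + ʳxᵣ)) +
    .read goalₐ ʳtmp₀ / .read strideₐ ʳiᵣ % .read sideₐ ʳiᵣ / ʳhᵣ % 2 ;;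
  tmp₂ ≔ ʳxᵣ % ʳmᵣ % .read sizeₐ ʳjᵣ ;;
  tmp₃ ≔ .read sizeₐ ʳjᵣ ;;
  .branch (ʳmᵣ - (ʳxᵣ % ʳmᵣ - ʳtmp₂) <ₜ ʳtmp₃) (tmp₃ ≔ ʳmᵣ - (ʳxᵣ % ʳmᵣ - ʳtmp₂)) .skip ;;
  tmp₄ ≔ .read countₐ ʳtmp₁ % ʳtmp₃ ;;
  .branch (ʳtmp₁ % 2) (tmp₄ ≔ ʳtmp₃ - 1 - ʳtmp₄) .skip ;;
  .store destₐ ʳtmp₀ (ʳxᵣ - ʳtmp₂ + ʳtmp₄) ;;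
  .store countₐ ʳtmp₁ (.read countₐ ʳtmp₁ + 1)

/-- Refine the groups by coordinate `jᵣ`. -/
def refineGroup : Prog :=
  .store groupₐ ʳxᵣ (.read groupₐ ʳxᵣ +
    ʳxᵣ / .read strideₐ ʳjᵣ % ʳmᵣ % .read sizeₐ ʳjᵣ * .read strideₐ ʳjᵣ)

/-- Distribute the robots in all lines in direction `jᵣ`. -/
def phase : Prog :=
  mᵣ ≔ .read sideₐ ʳjᵣ ;; lᵣ ≔ ʳnᵣ / ʳmᵣ ;; oᵣ ≔ ʳjᵣ * ʳnᵣ ;;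
  .for xᵣ ʳnᵣ recordInverse ;; .for xᵣ ʳnᵣ findCell ;;
  .for xᵣ (2 * ʳnᵣ) (.store countₐ ʳxᵣ 0) ;; .for xᵣ ʳnᵣ assignDest ;;
  sortLines ;; .for xᵣ ʳnᵣ refineGroup

/-- Round coordinate `dᵣ` of vertex `xᵣ` down. -/
def coarsenGroup : Prog :=
  .store groupₐ ʳxᵣ (.read groupₐ ʳxᵣ -
    ʳxᵣ / .read strideₐ ʳdᵣ % .read sideₐ ʳdᵣ % .read sizeₐ ʳdᵣ * .read strideₐ ʳdᵣ)

/-- Move all robots to the correct half, with respect to coordinate `iᵣ`, of their blocks. -/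
def split : Prog :=
  hᵣ ≔ ʳsᵣ / 2 ;;
  .for xᵣ ʳnᵣ (.store groupₐ ʳxᵣ ʳxᵣ) ;;
  .for dᵣ ʳkᵣ (.for xᵣ ʳnᵣ coarsenGroup) ;;
  .for dᵣ ʳkᵣ (.branch (ʳdᵣ =ₜ ʳiᵣ) .skip (jᵣ ≔ ʳdᵣ ;; phase)) ;;
  jᵣ ≔ ʳiᵣ ;; phase ;; .store sizeₐ ʳiᵣ ʳhᵣ

/-- Halve all blocks until they are single vertices. -/
def route : Prog := .loop (1 <ₜ ʳsᵣ) (.for iᵣ ʳkᵣ split ;; sᵣ ≔ ʳsᵣ / 2)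

/-- One coordinate of the vertex in a cell. -/
def addDigit : Prog :=
  tmp₂ ≔ .read sideₐ ʳdᵣ ;; .branch (ʳdᵣ =ₜ ʳjᵣ) (tmp₂ ≔ 1) .skip ;;
  tmp₃ ≔ ʳtmp₀ % ʳtmp₂ ;; tmp₀ ≔ ʳtmp₀ / ʳtmp₂ ;;
  .branch (ʳtmp₀ % 2) (tmp₃ ≔ ʳtmp₂ - 1 - ʳtmp₃) .skip ;;
  tmp₁ ≔ ʳtmp₁ + ʳtmp₃ * .read strideₐ ʳdᵣ

/-- The vertex in cell `xᵣ` of the enumeration in direction `jᵣ`. -/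
def enumerateCell : Prog :=
  tmp₀ ≔ ʳxᵣ / .read sideₐ ʳjᵣ ;; tmp₁ ≔ ʳxᵣ % .read sideₐ ʳjᵣ * .read strideₐ ʳjᵣ ;;
  .for dᵣ ʳkᵣ addDigit ;;
  .store orderₐ (ʳjᵣ * ʳnᵣ + ʳxᵣ) ʳtmp₁

/-- Load the first `n` values of `f` into the table. -/
def loadTable (f : ℕ → ℕ) : ℕ → Prog
  | 0 => .skip
  | n + 1 => loadTable f n ;; .store tableₐ (.const n) (.const (f n))

/-- The moves of the ladder and the ends of its edges. -/
def ladderTable (i : ℕ) : ℕ :=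
  if i < 245 then ladderStep (i / 35) (i / 7 % 5) (i % 7)
  else if i < 252 then end₁ (i - 245) else end₂ (i - 252)

/-- Compute the number of vertices and the strides. -/
def initStrides : Prog :=
  nᵣ ≔ 1 ;; .for dᵣ ʳkᵣ (.store strideₐ ʳdᵣ ʳnᵣ ;; nᵣ ≔ ʳnᵣ * .read sideₐ ʳdᵣ)

/-- Compute a power of two which is not less than the sides. -/
def initSize : Prog :=
  sᵣ ≔ 1 ;; .for dᵣ ʳkᵣ (.loop (ʳsᵣ <ₜ .read sideₐ ʳdᵣ) (sᵣ ≔ ʳsᵣ * 2)) ;;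
  .for dᵣ ʳkᵣ (.store sizeₐ ʳdᵣ ʳsᵣ)

/-- The whole algorithm. -/
def solver : Prog :=
  initStrides ;; initSize ;; loadTable ladderTable 259 ;;
  .for xᵣ ʳnᵣ (.store outₐ ʳxᵣ (.read initₐ ʳxᵣ)) ;;
  .for jᵣ ʳkᵣ (.for xᵣ ʳnᵣ enumerateCell) ;;
  route ;; kᵣ ≔ ʳtᵣ

/-! ## Correctness of the program -/

section Spec

variable {k : ℕ} {m : Fin k → ℕ}

/-- The output array contains a sequence of `T` valid moves from `XI` to `Y`. -/
def Trace (XI : GridConfig m) (out : ℕ → ℕ) (T : ℕ) (Y : GridConfig m) : Prop :=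
  ∃ X : ℕ → GridConfig m, IsSolution (gridGraph m) XI Y T X ∧
    ∀ t ≤ T, ∀ r : Fin (gridSize m), out (t * gridSize m + r) = vertexCode (X t r)

theorem Trace.congr {XI Y : GridConfig m} {out out' : ℕ → ℕ} {T : ℕ} (h : Trace XI out T Y)
    (h' : ∀ x < (T + 1) * gridSize m, out' x = out x) : Trace XI out' T Y := by
  obtain ⟨X, h1, h2⟩ := h
  refine ⟨X, h1, fun t ht r => ?_⟩
  rw [h' _ ?_, h2 t ht r]
  have : (t + 1) * gridSize m ≤ (T + 1) * gridSize m := Nat.mul_le_mul_right _ (by omega)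
  have := r.is_lt
  rw [add_mul t 1] at *
  omega

theorem Trace.last {XI Y : GridConfig m} {out : ℕ → ℕ} {T : ℕ} (h : Trace XI out T Y)
    (r : Fin (gridSize m)) : out (T * gridSize m + r) = vertexCode (Y r) := by
  obtain ⟨X, h1, h2⟩ := h
  rw [h2 T le_rfl, h1.2.1]

theorem Trace.extend {XI Y Y' : GridConfig m} {out : ℕ → ℕ} {T : ℕ} (h : Trace XI out T Y)
    (hm : IsMove (gridGraph m) Y Y')
    (h' : ∀ r : Fin (gridSize m), out ((T + 1) * gridSize m + r) = vertexCode (Y' r)) :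
    Trace XI out (T + 1) Y' := by
  obtain ⟨X, ⟨h1, h2, h3⟩, h4⟩ := h
  refine ⟨fun t => if t ≤ T then X t else Y', ⟨by simp [h1], by simp, fun t ht => ?_⟩,
    fun t ht r => ?_⟩
  · rcases Nat.lt_succ_iff_lt_or_eq.1 ht with h5 | rfl
    · simp only [if_pos h5.le, if_pos (show t + 1 ≤ T from h5)]
      exact h3 t h5
    · simp only [le_refl, if_true, if_neg (show ¬ t + 1 ≤ t by omega), h2]
      exact hm
  · rcases Nat.le_succ_iff.1 ht with h5 | rfl
    · simp only [if_pos h5, h4 t h5]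
    · simp only [if_neg (show ¬ T + 1 ≤ T by omega), h']

/-- The parts of the state that do not change during the main part of the algorithm. -/
structure Env (hm : ∀ l, 0 < m l) (XG : GridConfig m) (s : State) : Prop where
  dim : s.reg kᵣ = k
  size : s.reg nᵣ = gridSize m
  side : s.arr sideₐ = side m
  goal : ∀ r : Fin (gridSize m), s.arr goalₐ r = vertexCode (XG r)
  stride : ∀ l < k, s.arr strideₐ l = stride m l
  table : ∀ i < 259, s.arr tableₐ i = ladderTable i
  order : ∀ j : Fin k, ∀ z < gridSize m,
    s.arr orderₐ (j * gridSize m + z) = vertexCode (cellVertex hm j z)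

theorem Env.agree {hm : ∀ l, 0 < m l} {XG : GridConfig m} {s s' : State} {L K : List ℕ}
    (h : Env hm XG s) (ha : Agree L K s s') (hL : kᵣ ∉ L ∧ nᵣ ∉ L := by decide)
    (hK : sideₐ ∉ K ∧ goalₐ ∉ K ∧ strideₐ ∉ K ∧ tableₐ ∉ K ∧ orderₐ ∉ K := by decide) :
    Env hm XG s' := by
  obtain ⟨k1, k2, k3, k4, k5⟩ := hK
  constructor
  · rw [ha.reg _ hL.1, h.dim]
  · rw [ha.reg _ hL.2, h.size]
  · rw [ha.arr _ k1, h.side]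
  · rw [ha.arr _ k2]; exact h.goal
  · rw [ha.arr _ k3]; exact h.stride
  · rw [ha.arr _ k4]; exact h.table
  · rw [ha.arr _ k5]; exact h.order

/-- The parameters of the phase in direction `j`. -/
structure LineEnv (j : Fin k) (s : State) : Prop where
  dir : s.reg jᵣ = j
  len : s.reg mᵣ = m j
  rows : s.reg lᵣ = gridSize m / m j
  off : s.reg oᵣ = j * gridSize m

theorem LineEnv.agree {j : Fin k} {s s' : State} {L K : List ℕ}
    (h : LineEnv (m := m) j s) (ha : Agree L K s s')
    (hL : jᵣ ∉ L ∧ mᵣ ∉ L ∧ lᵣ ∉ L ∧ oᵣ ∉ L := by decide) : LineEnv (m := m) j s' := by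
  obtain ⟨k1, k2, k3, k4⟩ := hL
  constructor
  · rw [ha.reg _ k1, h.dir]
  · rw [ha.reg _ k2, h.len]
  · rw [ha.reg _ k3, h.rows]
  · rw [ha.reg _ k4, h.off]

/-- The positions of the robots. -/
structure Placed (N : ℕ) (D p a : ℕ → ℕ) (s : State) : Prop where
  inv : InvPair N p a
  cell : ∀ r < N, s.arr cellₐ r = p r
  robot : ∀ z < N, s.arr robotₐ z = a z
  dest : ∀ r < N, s.arr destₐ r = D r

theorem Placed.agree {N : ℕ} {D p a : ℕ → ℕ} {s s' : State} {L K : List ℕ}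
    (h : Placed N D p a s) (ha : Agree L K s s')
    (hK : cellₐ ∉ K ∧ robotₐ ∉ K ∧ destₐ ∉ K := by decide) : Placed N D p a s' := by
  obtain ⟨k1, k2, k3⟩ := hK
  refine ⟨h.inv, ?_, ?_, ?_⟩
  · rw [ha.arr _ k1]; exact h.cell
  · rw [ha.arr _ k2]; exact h.robot
  · rw [ha.arr _ k3]; exact h.dest

/-- The parameters of a block class. -/
structure ClassEnv (b : BlockClass) (s : State) : Prop where
  e : s.reg eᵣ = b.e
  ρr : s.reg yᵣ = b.ρr
  ρx : s.reg wᵣ = b.ρx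
  sh : s.reg bᵣ = b.sh
  α : s.reg aᵣ = (1 - b.sh) * b.M + b.sh
  β : s.reg gᵣ = (1 - b.sh) + b.sh * b.M
  first : s.reg fᵣ = b.off (end₁ b.e)
  second : s.reg vᵣ = b.off (end₂ b.e)

theorem ClassEnv.agree {b : BlockClass} {s s' : State} {L K : List ℕ} (h : ClassEnv b s)
    (ha : Agree L K s s') (hL : eᵣ ∉ L ∧ yᵣ ∉ L ∧ wᵣ ∉ L ∧ bᵣ ∉ L ∧ aᵣ ∉ L ∧ gᵣ ∉ L ∧ fᵣ ∉ L ∧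
      vᵣ ∉ L := by decide) : ClassEnv b s' := by
  obtain ⟨k1, k2, k3, k4, k5, k6, k7, k8⟩ := hL
  constructor
  · rw [ha.reg _ k1, h.e]
  · rw [ha.reg _ k2, h.ρr]
  · rw [ha.reg _ k3, h.ρx]
  · rw [ha.reg _ k4, h.sh]
  · rw [ha.reg _ k5, h.α]
  · rw [ha.reg _ k6, h.β]
  · rw [ha.reg _ k7, h.first]
  · rw [ha.reg _ k8, h.second]

theorem ClassEnv.eval_off {b : BlockClass} {s : State} (h : ClassEnv b s) (c : Term) :
    (offTerm c).eval s = b.off (c.eval s) := by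
  simp [offTerm, h.α, h.β, BlockClass.off]

theorem ladderTable_step : ∀ e < 7, ∀ q < 5, ∀ c < 7,
    (e * 5 + q) * 7 + c < 259 ∧ ladderTable ((e * 5 + q) * 7 + c) = ladderStep e q c := by
  intro e he q hq c hc
  have h1 : ((e * 5 + q) * 7 + c) / 35 = e := by omega
  have h2 : ((e * 5 + q) * 7 + c) / 7 % 5 = q := by omega
  have h3 : ((e * 5 + q) * 7 + c) % 7 = c := by omega
  refine ⟨by omega, ?_⟩
  rw [ladderTable, if_pos (by omega), h1, h2, h3]

theorem ladderTable_end : ∀ e < 7, ladderTable (245 + e) = end₁ e ∧ ladderTable (252 + e) = end₂ e := by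
  decide

set_option maxRecDepth 10000 in
theorem ladderTable_le : ∀ i < 259, ladderTable i ≤ 6 := by decide

theorem BlockClass.off_le {M L ρr ρx sh e c : ℕ} (hs : sh ≤ 1) (hM : 0 < M) :
    (BlockClass.mk M L ρr ρx sh e).off c ≤ 2 * M + 2 := by
  have h1 : c % 6 / 2 ≤ 2 := by omega
  have h2 : c % 2 ≤ 1 := by omega
  rcases Nat.le_one_iff_eq_zero_or_eq_one.1 hs with rfl | rfl
  · have := Nat.mul_le_mul_right M h1
    simp only [BlockClass.off, Nat.sub_zero, one_mul, zero_mul, add_zero, mul_one]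
    omega
  · have := Nat.mul_le_mul_right M h2
    simp only [BlockClass.off, Nat.sub_self, one_mul, zero_mul, zero_add, mul_one]
    omega

theorem side_le_gridSize (hm : ∀ l, 0 < m l) (j : Fin k) : m j ≤ gridSize m :=
  Nat.le_of_dvd (Finset.prod_pos fun l _ => hm l) (Finset.dvd_prod_of_mem m (Finset.mem_univ j))

theorem mul_rows (j : Fin k) : m j * (gridSize m / m j) = gridSize m :=
  Nat.mul_div_cancel' (Finset.dvd_prod_of_mem m (Finset.mem_univ j))

theorem gridSize_pos (hm : ∀ l, 0 < m l) : 0 < gridSize m := Finset.prod_pos fun l _ => hm l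

/-- The block class number `κ` for direction `j`. -/
abbrev lineClass (m : Fin k → ℕ) (j : Fin k) (κ : ℕ) : BlockClass :=
  BlockClass.ofIndex (m j) (gridSize m / m j) κ

/-- The machine only compares by `<`, which explains the form of the bounds in `InBlock`; a product
of 0-1 values is a conjunction. The two destinations are meaningful only for a cell of a block, but
otherwise another factor vanishes already. -/
theorem activeTerm_eval {j : Fin k} {κ z N : ℕ} {D p a : ℕ → ℕ} {s : State}
    (hb : (lineClass m j κ).Good) (hN : N = gridSize m)
    (hl : LineEnv (m := m) j s) (hc : ClassEnv (lineClass m j κ) s) (hp : Placed N D p a s)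
    (h0 : s.reg tmp₀ = z) (h1 : s.reg tmp₁ = (lineClass m j κ).dr z)
    (h2 : s.reg tmp₂ = (lineClass m j κ).dx z) (h3 : s.reg tmp₃ = (lineClass m j κ).corner z) :
    activeTerm.eval s = 0 ↔ ¬ (lineClass m j κ).Active (fun z => D (a z)) z := by
  subst hN
  have hM : (lineClass m j κ).M = m j := rfl
  have hL : (lineClass m j κ).L = gridSize m / m j := rfl
  have hN : (lineClass m j κ).M * (lineClass m j κ).L = gridSize m := mul_rows j
  simp only [activeTerm, Term.eval_mul, Term.eval_lt, Term.eval_add, Term.eval_sub, Term.eval_div,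
    Term.eval_mod, Term.eval_reg, Term.eval_ofNat, Term.eval_read, hl.len, hl.rows, hc.ρr, hc.ρx, hc.sh,
    hc.first, hc.second, h0, h1, h2, h3, BlockClass.Active, BlockClass.InBlock, hM, hL]
  rw [← not_iff_not, not_not]
  simp only [mul_eq_zero, ite_eq_right_iff, one_ne_zero, imp_false, not_or, not_not, and_assoc]
  refine and_congr_right fun i1 => and_congr_right fun i2 => and_congr_right fun i3 =>
    and_congr_right fun i4 => and_congr_right fun i5 => and_congr_right fun i6 => ?_
  have hin : (lineClass m j κ).InBlock z := ⟨i1, i2, i3, i4, i5, i6⟩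
  obtain ⟨e1, e2, -⟩ := end_facts _ hb.e_lt
  have k1 := (hin.place hb e1).2.2.2
  have k2 := (hin.place hb e2).2.2.2
  rw [hN] at k1 k2
  rw [hp.robot _ k1, hp.robot _ k2, hp.dest _ (hp.inv.lt' _ k1), hp.dest _ (hp.inv.lt' _ k2)]

variable {W : ℕ} (hW : 1000 ≤ W)

include hW in
theorem Wp.decodeClass {hm : ∀ l, 0 < m l} {XG : GridConfig m} {j : Fin k} {κ : ℕ} {s : State}
    (hκ : κ < 126) (he : Env hm XG s) (hl : LineEnv (m := m) j s) (hc : s.reg cᵣ = κ)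
    (hN : 2 * gridSize m + 2 ≤ W) :
    Wp W decodeClass decodeClass.time (ClassEnv (lineClass m j κ)) s := by
  refine Wp.block hW (by decide) ?_
  have hmj := side_le_gridSize hm j
  have h1 := he.table (245 + κ % 7) (by omega)
  have h2 := he.table (252 + κ % 7) (by omega)
  obtain ⟨h3, h4⟩ := ladderTable_end (κ % 7) (by omega)
  rw [h3] at h1
  rw [h4] at h2
  have b1 : (1 - κ / 63) * m j + κ / 63 ≤ W := by
    rcases (show κ / 63 = 0 ∨ κ / 63 = 1 by omega) with h | h <;> rw [h] <;> omega
  have b2 : (1 - κ / 63) + κ / 63 * m j ≤ W := by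
    rcases (show κ / 63 = 0 ∨ κ / 63 = 1 by omega) with h | h <;> rw [h] <;> omega
  have b3 : ∀ c, c % 6 / 2 * ((1 - κ / 63) * m j + κ / 63) +
      c % 2 * (1 - κ / 63 + κ / 63 * m j) ≤ W := fun c => by
    have := BlockClass.off_le (L := 0) (ρr := 0) (ρx := 0) (e := 0) (c := c)
      (show κ / 63 ≤ 1 by omega) (hm j)
    simp only [BlockClass.off] at this
    omega
  simp [MPP.decodeClass, Prog.vc, offTerm, hc, hl.len, h1, h2]
  refine ⟨by omega, by omega, by omega, by omega, b1, b2, b3 _, b3 _, ?_⟩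
  constructor <;> simp [BlockClass.ofIndex, BlockClass.off]

/-- After `locate`, the active blocks of the robots before `r` are recorded. -/
def Located (b : BlockClass) (key p : ℕ → ℕ) (r : ℕ) (s : State) : Prop :=
  ∀ r' < r, s.arr cornerₐ r' = b.aCorner key (p r') ∧ s.arr slotₐ r' = b.aSlot key (p r')

include hW in
-- The keys are read from arrays that do not change before `commit`, so all robots judge the
-- activity of blocks by the same configuration.
theorem Wp.locate {j : Fin k} {κ r : ℕ} {D p a : ℕ → ℕ} {s : State}
    (hb : (lineClass m j κ).Good)
    (hl : LineEnv (m := m) j s) (hc : ClassEnv (lineClass m j κ) s) (hp : Placed (gridSize m) D p a s)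
    (hr : r < gridSize m) (hx : s.reg xᵣ = r) (h : Located (lineClass m j κ) (fun z => D (a z)) p r s) :
    Wp W locate locate.time (Located (lineClass m j κ) (fun z => D (a z)) p (r + 1)) s := by
  refine Wp.bdd fun hB => Wp.block hW (by decide) ?_
  have hpr := hp.cell r hr
  have hpW : p r ≤ W := hpr ▸ hB.arr _ _
  have hM : (lineClass m j κ).M = m j := rfl
  have e1 : (p r / m j - (lineClass m j κ).ρr) % 3 = (lineClass m j κ).dr (p r) := rfl
  have e2 : (p r % m j - (lineClass m j κ).ρx) % 3 = (lineClass m j κ).dx (p r) := rfl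
  have e3 : p r - ((lineClass m j κ).dr (p r) * m j + (lineClass m j κ).dx (p r)) =
    (lineClass m j κ).corner (p r) := rfl
  have b1 : (lineClass m j κ).dr (p r) ≤ 2 := by rw [BlockClass.dr]; omega
  have b2 : (lineClass m j κ).dx (p r) ≤ 2 := by rw [BlockClass.dx]; omega
  have b3 : (lineClass m j κ).corner (p r) ≤ W := (Nat.sub_le _ _).trans hpW
  simp [MPP.locate, Prog.vc, hx, hpr, hl.len, hc.ρr, hc.ρx, hc.sh, e1, e2, e3]
  have b4 : (1 - (lineClass m j κ).sh) * (2 * (lineClass m j κ).dr (p r) + (lineClass m j κ).dx (p r)) +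
      (lineClass m j κ).sh * (2 * (lineClass m j κ).dx (p r) + (lineClass m j κ).dr (p r)) ≤ W := by
    rcases Nat.le_one_iff_eq_zero_or_eq_one.1 hb.sh_le with h | h <;> rw [h] <;> omega
  have hact := activeTerm_eval (z := p r) (D := D) (a := a) (p := p) (s := (((((s.setReg tmp₀ (p r)).setArr cornerₐ r (p r)).setArr
    slotₐ r 6).setReg tmp₁ ((lineClass m j κ).dr (p r))).setReg tmp₂ ((lineClass m j κ).dx (p r))).setReg
    tmp₃ ((lineClass m j κ).corner (p r))) hb rfl
    (by constructor <;> simp [hl.dir, hl.len, hl.rows, hl.off])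
    (by constructor <;> simp [hc.e, hc.ρr, hc.ρx, hc.sh, hc.α, hc.β, hc.first, hc.second])
    (by
      refine ⟨hp.inv, ?_, ?_, ?_⟩ <;> simp
      exacts [hp.cell, hp.robot, hp.dest]) (by simp) (by simp) (by simp) (by simp)
  rw [hact, not_not]
  refine ⟨hpW, by omega, by omega, by omega, b3, fun hA => ⟨b3, b4, fun r' hr' => ?_⟩,
    fun hA r' hr' => ?_⟩
  all_goals
    rcases Nat.lt_succ_iff_lt_or_eq.1 hr' with hlt | rfl
    · simp [Function.update_of_ne hlt.ne, h r' hlt]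
  · simp only [State.setArr_arr, State.setReg_arr]
    simp [BlockClass.aCorner, BlockClass.aSlot, hA, BlockClass.slot]
  · simp [BlockClass.aCorner, BlockClass.aSlot, hA]

/-- During move number `q`, the robots before `r` have moved. -/
structure Moving (hm : ∀ l, 0 < m l) (j : Fin k) (b : BlockClass) (key p out : ℕ → ℕ) (T q r : ℕ)
    (s : State) : Prop where
  slot : ∀ r' < gridSize m, s.arr slotₐ r' =
    ladderRun b.e (if r' < r then q + 1 else q) (b.aSlot key (p r'))
  new : ∀ r' < r, s.arr outₐ ((T + 1) * gridSize m + r') =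
    vertexCode (cellVertex hm j (b.moved key (q + 1) (p r')))
  old : ∀ x < (T + 1) * gridSize m, s.arr outₐ x = out x

include hW in
theorem Wp.moveRobot {hm : ∀ l, 0 < m l} {XG : GridConfig m} {j : Fin k} {κ r q T : ℕ}
    {key p out : ℕ → ℕ} {s : State} (hb : (lineClass m j κ).Good) (he : Env hm XG s)
    (hl : LineEnv (m := m) j s) (hc : ClassEnv (lineClass m j κ) s)
    (hcor : ∀ r < gridSize m, s.arr cornerₐ r = (lineClass m j κ).aCorner key (p r))
    (hp : ∀ r < gridSize m, p r < gridSize m)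
    (hr : r < gridSize m) (hq : q < 5) (hx : s.reg xᵣ = r) (hqr : s.reg qᵣ = q) (ht : s.reg tᵣ = T)
    (h : Moving hm j (lineClass m j κ) key p out T q r s) :
    Wp W moveRobot moveRobot.time (Moving hm j (lineClass m j κ) key p out T q (r + 1)) s := by
  refine Wp.bdd fun hB => Wp.block hW (by decide) ?_
  have hN : (lineClass m j κ).M * (lineClass m j κ).L = gridSize m := mul_rows j
  have hM : (lineClass m j κ).M = m j := rfl
  have hslot := h.slot r hr
  rw [if_neg (lt_irrefl _)] at hslot
  have hlt : ladderRun (lineClass m j κ).e q ((lineClass m j κ).aSlot key (p r)) < 7 := by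
    rcases BlockClass.aSlot_cases hb key (p r) with ⟨h1, h2, h3, h4⟩ | ⟨h1, h2, h3⟩
    · rw [h3]
      exact (ladderRun_lt hb.e_lt q hq.le _ h4).trans (by omega)
    · rw [h3, ladderRun_six hb.e_lt q hq.le]
      omega
  obtain ⟨t1, t2⟩ := ladderTable_step _ hb.e_lt q hq _ hlt
  have t3 := he.table _ t1
  rw [t2, ← ladderRun] at t3
  have hmv := BlockClass.moved_lt hb key (z := p r) (by rw [hN]; exact hp r hr) (q := q + 1) hq
  have ho := he.order j _ (hN ▸ hmv)
  rw [BlockClass.moved, BlockClass.off, hM] at ho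
  have w1 := hB.arr tableₐ (((lineClass m j κ).e * 5 + q) * 7 +
    ladderRun (lineClass m j κ).e q ((lineClass m j κ).aSlot key (p r)))
  rw [t3] at w1
  have w2 := hB.arr orderₐ (j * gridSize m + (lineClass m j κ).moved key (q + 1) (p r))
  rw [he.order j _ (hN ▸ hmv)] at w2
  simp [MPP.moveRobot, Prog.vc, hx, hqr, hslot, hc.e, t3, offTerm, hc.α, hc.β, hl.off, hcor r hr, ho, ht,
    he.size, hM, w1]
  refine ⟨w2, ⟨fun r' hr' => ?_, fun r' hr' => ?_, fun x hx' => ?_⟩⟩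
  · simp
    by_cases hne : r' = r
    · subst hne
      simp
    · have hiff : r' ≤ r ↔ r' < r := by omega
      simp [Function.update_of_ne hne, h.slot r' hr', hiff]
  · simp
    rcases Nat.lt_succ_iff_lt_or_eq.1 hr' with hlt | rfl
    · rw [Function.update_of_ne (by omega), h.new r' hlt]
    · simp [BlockClass.moved, BlockClass.off, hM]
  · simp
    rw [Function.update_of_ne (by omega), h.old x hx']

end Spec

/-! ### A compare-exchange step as five recorded moves -/

section Spec

variable {k : ℕ} {m : Fin k → ℕ}

/-- The output array contains a sequence of `T` valid moves from `XI` to the configuration with robot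
`r` in cell `f r`. -/
def TraceTo (hm : ∀ l, 0 < m l) (j : Fin k) (XI : GridConfig m) (out : ℕ → ℕ) (T : ℕ) (f : ℕ → ℕ) :
    Prop :=
  ∃ Y : GridConfig m, (∀ r, Y r = cellVertex hm j (f r)) ∧ Trace XI out T Y

/-- Conditions on cell numbers suffice, since distinct cells are distinct vertices and neighbouring
cells are neighbouring vertices. -/
theorem TraceTo.step {hm : ∀ l, 0 < m l} {j : Fin k} {XI : GridConfig m} {out out' : ℕ → ℕ} {T : ℕ}
    {f f' : ℕ → ℕ} (h : TraceTo hm j XI out T f)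
    (hf : ∀ r < gridSize m, f r < gridSize m) (hf' : ∀ r < gridSize m, f' r < gridSize m)
    (hinj : ∀ r r', f' r = f' r' → f r = f r')
    (hadj : ∀ r < gridSize m, f' r = f r ∨ CellAdj (m j) (gridSize m) (f r) (f' r))
    (hswap : ∀ r r', f r = f' r' → f r' = f' r → f r = f r')
    (hold : ∀ x < (T + 1) * gridSize m, out' x = out x)
    (hnew : ∀ r < gridSize m, out' ((T + 1) * gridSize m + r) = vertexCode (cellVertex hm j (f' r))) :
    TraceTo hm j XI out' (T + 1) f' := by
  obtain ⟨Y, h1, h2⟩ := h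
  have inj : ∀ r r' : Fin (gridSize m), f r = f r' → r = r' := fun r r' e =>
    Y.injective (by rw [h1, h1, e])
  refine ⟨⟨fun r => cellVertex hm j (f' r), fun r r' e => inj r r' (hinj _ _
    (cellVertex_injOn hm j (hf' r r.is_lt) (hf' r' r'.is_lt) e))⟩, fun r => rfl,
    (h2.congr hold).extend ⟨fun r => ?_, fun r r' hne e e' => hne (inj _ _ (hswap _ _ ?_ ?_))⟩
      fun r => hnew r r.is_lt⟩
  · rw [h1]
    rcases hadj r r.is_lt with e | e
    · exact Or.inl (congrArg (cellVertex hm j) e)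
    · exact Or.inr (cellVertex_adj hm j (hf r r.is_lt) (hf' r r.is_lt) e)
  · rw [h1] at e
    exact cellVertex_injOn hm j (hf r r.is_lt) (hf' r' r'.is_lt) e
  · rw [h1] at e'
    exact cellVertex_injOn hm j (hf r' r'.is_lt) (hf' r r.is_lt) e'

variable {W : ℕ} (hW : 1000 ≤ W)

include hW in
theorem Wp.moveAll {hm : ∀ l, 0 < m l} {XG : GridConfig m} {j : Fin k} {κ q T : ℕ}
    {key p : ℕ → ℕ} {s : State} (hN : gridSize m ≤ W) (hT : T + 1 ≤ W)
    (hb : (lineClass m j κ).Good) (he : Env hm XG s)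
    (hl : LineEnv (m := m) j s) (hc : ClassEnv (lineClass m j κ) s)
    (hcor : ∀ r < gridSize m, s.arr cornerₐ r = (lineClass m j κ).aCorner key (p r))
    (hp : ∀ r < gridSize m, p r < gridSize m)
    (hq : q < 5) (hqr : s.reg qᵣ = q) (ht : s.reg tᵣ = T)
    (h : ∀ r < gridSize m, s.arr slotₐ r =
      ladderRun (lineClass m j κ).e q ((lineClass m j κ).aSlot key (p r))) :
    Wp W moveAll ((gridSize m + 1) * (MPP.moveRobot.time + 110) + 4)
      (fun s' => s'.reg tᵣ = T + 1 ∧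
        Moving hm j (lineClass m j κ) key p (s.arr outₐ) T q (gridSize m) s') s := by
  refine Wp.seq (Wp.for hW [] [slotₐ, outₐ] (Moving hm j (lineClass m j κ) key p (s.arr outₐ) T q)
    (gridSize m) MPP.moveRobot.time hN ?_ ⟨?_, ?_, ?_⟩ ?_ ?_) ?_
  · intro r hr s' ha hx hM
    exact Wp.moveRobot hW hb (he.agree ha) (hl.agree ha) (hc.agree ha)
      (by rwa [ha.arr _ (by decide)]) hp hr hq hx ((ha.reg _ (by decide)).trans hqr)
      ((ha.reg _ (by decide)).trans ht) hM
  · intro r hr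
    rw [if_neg (by omega), h r hr]
  · intro r hr
    omega
  · intro x _
    rfl
  · intro s' ha
    simp [(he.agree ha).size]
  · exact fun r v s' hM => ⟨hM.slot, hM.new, hM.old⟩
  · rintro s' ⟨ha, -, hM⟩
    have ht' : s'.reg tᵣ = T := (ha.reg _ (by decide)).trans ht
    refine Wp.block hW (p := tᵣ ≔ ʳtᵣ + 1) (by decide) ⟨by simpa [ht'], ?_, ?_⟩
    · simp [ht']
    · exact ⟨hM.slot, hM.new, hM.old⟩

/-- The new cells of the robots before `r` have been recorded. -/
def Committed (f : ℕ → ℕ) (r : ℕ) (s : State) : Prop :=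
  ∀ r' < r, s.arr cellₐ r' = f r' ∧ s.arr robotₐ (f r') = r'

include hW in
theorem Wp.commit {b : BlockClass} {r N : ℕ} {key p : ℕ → ℕ} {s : State}
    (hc : ClassEnv b s) (hcor : ∀ r < N, s.arr cornerₐ r = b.aCorner key (p r))
    (hs : ∀ r < N, s.arr slotₐ r = ladderRun b.e 5 (b.aSlot key (p r)))
    (hlt : ∀ r < N, b.moved key 5 (p r) < N) (hN : N ≤ W)
    (hinj : ∀ r < N, ∀ r' < N, b.moved key 5 (p r) = b.moved key 5 (p r') → r = r')
    (hr : r < N) (hx : s.reg xᵣ = r)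
    (h : Committed (fun r => b.moved key 5 (p r)) r s) :
    Wp W commit MPP.commit.time (Committed (fun r => b.moved key 5 (p r)) (r + 1)) s := by
  refine Wp.block hW (by decide) ?_
  have e : (Term.read cornerₐ ʳxᵣ + offTerm (.read slotₐ ʳxᵣ)).eval s = b.moved key 5 (p r) := by
    rw [Term.eval_add, hc.eval_off]
    simp [hx, hcor r hr, hs r hr, BlockClass.moved]
  have hlt' := hlt r hr
  refine ⟨by rw [e]; omega, ?_⟩
  rw [e]
  simp [Prog.vc, hx]
  refine ⟨by omega, by omega, fun r' hr' => ?_⟩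
  rcases Nat.lt_succ_iff_lt_or_eq.1 hr' with h1 | rfl
  · obtain ⟨h2, h3⟩ := h r' h1
    have hne : b.moved key 5 (p r') ≠ b.moved key 5 (p r) := fun e =>
      h1.ne (hinj _ (by omega) _ hr e)
    simp [Function.update_of_ne h1.ne, Function.update_of_ne hne, h2, h3]
  · simp

include hW in
theorem Wp.sortClass {hm : ∀ l, 0 < m l} {XI XG : GridConfig m} {j : Fin k} {κ T : ℕ}
    {D p a : ℕ → ℕ} {s : State} (hN : 2 * gridSize m + 2 ≤ W) (hT : T + 5 ≤ W)
    (hκ : κ < 126) (he : Env hm XG s) (hl : LineEnv (m := m) j s) (hc : s.reg cᵣ = κ)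
    (hp : Placed (gridSize m) D p a s) (ht : s.reg tᵣ = T)
    (htr : TraceTo hm j XI (s.arr outₐ) T p) :
    Wp W sortClass (10 ^ 5 * gridSize m) (fun s' => ∃ p' a', Placed (gridSize m) D p' a' s' ∧
      SortStep (gridSize m) D p p' (lineClass m j κ).Covers ∧ s'.reg tᵣ = T + 5 ∧
      TraceTo hm j XI (s'.arr outₐ) (T + 5) p') s := by
  have hNN : (lineClass m j κ).M * (lineClass m j κ).L = gridSize m := mul_rows j
  have hN0 := gridSize_pos hm
  have hb : (lineClass m j κ).Good := BlockClass.ofIndex_good (hm j) hκ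
  set key : ℕ → ℕ := fun z => D (a z) with hkey
  set b := lineClass m j κ with hbdef
  have hlt : ∀ q ≤ 5, ∀ r < gridSize m, b.moved key q (p r) < gridSize m := fun q hq r hr =>
    hNN ▸ BlockClass.moved_lt hb key (hNN.symm ▸ hp.inv.lt r hr) hq
  have hinj : ∀ r < gridSize m, ∀ r' < gridSize m, b.moved key 5 (p r) = b.moved key 5 (p r') → r = r' :=
    fun r hr r' hr' e => hp.inv.inj hr hr' (BlockClass.moved_inj hb key le_rfl e)
  refine Wp.mono (Wp.seq (Wp.agree _ _ (Wp.decodeClass hW hκ he hl hc hN) (List.Subset.refl _)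
    (List.Subset.refl _)) (Q := fun s' => ∃ p' a', Placed (gridSize m) D p' a' s' ∧
      SortStep (gridSize m) D p p' (lineClass m j κ).Covers ∧ s'.reg tᵣ = T + 5 ∧
      TraceTo hm j XI (s'.arr outₐ) (T + 5) p')
    (τ' := (gridSize m + 1) * (MPP.locate.time + 110) + ((5 + 1) * (((gridSize m + 1) * (MPP.moveRobot.time + 110) + 4) + 110) +
      (gridSize m + 1) * (MPP.commit.time + 110))) ?_) ?_ fun _ _ h => h
  swap
  · have e1 : MPP.decodeClass.time ≤ 500 := by decide
    have e2 : MPP.locate.time ≤ 500 := by decide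
    have e3 : MPP.moveRobot.time ≤ 500 := by decide
    have e4 : MPP.commit.time ≤ 500 := by decide
    have f2 := Nat.mul_le_mul_left (gridSize m + 1) e2
    have f3 := Nat.mul_le_mul_left (gridSize m + 1) e3
    have f4 := Nat.mul_le_mul_left (gridSize m + 1) e4
    simp only [mul_add] at f2 f3 f4 ⊢
    omega
  rintro s₁ ⟨ha₁, hc₁⟩
  have he₁ := he.agree ha₁
  have hl₁ := hl.agree ha₁
  have hp₁ := hp.agree ha₁
  refine Wp.seq (Wp.for hW [tmp₀, tmp₁, tmp₂, tmp₃] [cornerₐ, slotₐ] (Located b key p) (gridSize m) MPP.locate.time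
    (by omega) (fun r hr s' ha hx h => Wp.locate hW hb (hl₁.agree ha) (hc₁.agree ha) (hp₁.agree ha) hr hx h)
    (fun r hr => by omega) (fun s' ha => by simp [(he₁.agree ha).size]) fun r v s' h => h) ?_
  rintro s₂ ⟨ha₂, -, hloc⟩
  have he₂ := he₁.agree ha₂
  have hl₂ := hl₁.agree ha₂
  have hp₂ := hp₁.agree ha₂
  have hc₂ := hc₁.agree ha₂
  have ht₂ : s₂.reg tᵣ = T := by rw [ha₂.reg _ (by decide), ha₁.reg _ (by decide), ht]
  have ho₂ : s₂.arr outₐ = s.arr outₐ := by rw [ha₂.arr _ (by decide), ha₁.arr _ (by decide)]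
  refine Wp.seq (Wp.for hW [xᵣ, tᵣ] [slotₐ, outₐ] (fun q s' => s'.reg tᵣ = T + q ∧
    (∀ r < gridSize m, s'.arr slotₐ r = ladderRun b.e q (b.aSlot key (p r))) ∧
    TraceTo hm j XI (s'.arr outₐ) (T + q) fun r => b.moved key q (p r)) 5 _ (by omega) ?_ ?_
    (fun s' _ => by simp) ?_) ?_
  · rintro q hq s' ha hqr ⟨h1, h2, h3⟩
    refine Wp.mono (Wp.moveAll hW (by omega) (T := T + q) (by omega) hb (he₂.agree ha) (hl₂.agree ha) (hc₂.agree ha)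
      (fun r hr => ?_) hp.inv.lt hq hqr h1 h2) le_rfl ?_
    · rw [ha.arr _ (by decide)]
      exact (hloc r hr).1
    rintro s'' - ⟨h4, h5⟩
    refine ⟨h4, fun r hr => ?_, h3.step (hlt q (by omega)) (hlt (q + 1) (by omega)) ?_ ?_ ?_ h5.old h5.new⟩
    · rw [h5.slot r hr, if_pos hr]
    · intro r r' e
      rw [BlockClass.moved_inj hb key (by omega) e]
    · intro r hr
      rw [← hNN]
      exact BlockClass.moved_adj hb key _ hq
    · intro r r' e e'
      rw [BlockClass.moved_no_swap hb key hq e e']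
  · refine ⟨ht₂, fun r hr => (hloc r hr).2, ?_⟩
    simpa [ho₂, BlockClass.moved_zero hb] using htr
  · rintro q v s' ⟨h1, h2, h3⟩
    exact ⟨by simpa using h1, h2, h3⟩
  rintro s₃ ⟨ha₃, -, ht₃, hs₃, htr₃⟩
  have hc₃ := hc₂.agree ha₃
  refine Wp.mono (Wp.for hW [tmp₀] [cellₐ, robotₐ] (Committed fun r => b.moved key 5 (p r)) (gridSize m) MPP.commit.time
    (by omega) (fun r hr s' ha hx h => ?_) (fun r hr => by omega)
    (fun s' ha => by simp [((he₂.agree ha₃).agree ha).size]) fun r v s' h => h) le_rfl ?_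
  · refine Wp.commit hW (hc₃.agree ha) (fun r hr => ?_) (fun r hr => ?_) (hlt 5 le_rfl) (by omega) hinj hr hx h
    · rw [ha.arr _ (by decide), ha₃.arr _ (by decide)]
      exact (hloc r hr).1
    · rw [ha.arr _ (by decide)]
      exact hs₃ r hr
  rintro s₄ - ⟨ha₄, -, hcom⟩
  -- The array `robotₐ` holds this inverse, since each cell is the new cell of exactly one robot.
  obtain ⟨a', ha'⟩ := InvPair.of_inj (hlt 5 le_rfl) hinj
  refine ⟨_, a', ⟨ha', fun r hr => (hcom r hr).1, fun z hz => ?_, fun r hr => ?_⟩, ?_, ?_, ?_⟩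
  · have : s₄.arr robotₐ (b.moved key 5 (p (a' z))) = a' z := (hcom (a' z) (ha'.lt' z hz)).2
    rwa [show b.moved key 5 (p (a' z)) = z from ha'.right z hz] at this
  · rw [ha₄.arr _ (by decide), ha₃.arr _ (by decide), hp₂.dest r hr]
  · rw [← hNN]
    exact BlockClass.sortStep hb (hNN.symm ▸ hp.inv)
  · rw [ha₄.reg _ (by decide), ht₃]
  · rw [ha₄.arr _ (by decide)]
    exact htr₃

end Spec

/-! ### Segments as disjoint intervals -/

section Segments

variable {N : ℕ} {start len g : ℕ → ℕ} (h : Segments N start len g)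

/-- The segments, as intervals. -/
def IsSegment (N : ℕ) (start len : ℕ → ℕ) (a b : ℕ) : Prop :=
  ∃ z < N, a = start z ∧ b = start z + len z

include h

theorem Segments.start_inter {y z : ℕ} (hy : y < N) (hz : z < N) (h1 : start y ≤ start z)
    (h2 : start z < start y + len y) : start z = start y ∧ len z = len y := by
  obtain ⟨e1, e2, -⟩ := h.eq y hy _ h1 h2
  have h3 := h.start_le z hz
  obtain ⟨e3, e4, -⟩ := h.eq z hz (start z) le_rfl (by have := h.lt z hz; omega)
  omega

/-- Needed, with `Segments.end_le`, for `SortInv.init`: a robot with its destination in its own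
segment is on the correct side of every other segment. -/
theorem Segments.lt_start {y z d : ℕ} (hy : y < N) (hz : z < N) (hd : d < start y + len y)
    (hyz : y < start z) : d < start z := by
  by_contra hdz
  have := h.start_le y hy
  have := h.start_inter hy hz (by omega) (by omega)
  omega

theorem Segments.end_le {y z d : ℕ} (hy : y < N) (hz : z < N) (hd : start y ≤ d)
    (hyz : start z + len z ≤ y) : start z + len z ≤ d := by
  by_contra hdz
  have h1 := h.start_le y hy
  have h2 := h.lt y hy
  have h3 := h.start_le z hz
  have h4 := h.lt z hz
  rcases le_total (start z) (start y) with h5 | h5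
  · have := h.start_inter hz hy h5 (by omega)
    omega
  · have := h.start_inter hy hz h5 (by omega)
    omega

end Segments

/-! ### Sorting all lines of one direction -/

section Spec

variable {k : ℕ} {m : Fin k → ℕ}

/-- A segment does not cross the end of a row, so its neighbouring cells are neighbours in a row. -/
theorem exists_lineClass_covers {hm : ∀ l, 0 < m l} {S : ℕ → ℕ} {j : Fin k} (hmj : 2 ≤ m j)
    (hrows : 2 ≤ gridSize m / m j) (h6 : 6 ≤ gridSize m) {a b z : ℕ}
    (h : IsSegment (gridSize m) (cellStart m S j) (cellLen m S j) a b) (h1 : a ≤ z) (h2 : z + 1 < b)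
    (hS : 0 < S j) :
    ∃ κ < 126, (lineClass m j κ).Covers z := by
  obtain ⟨y, hy, rfl, rfl⟩ := h
  have hle := (segments hm hS (R := fun _ => True) trivial).le y hy
  obtain ⟨e1, -, -⟩ := cell_of_segment hm h1 (by omega)
  obtain ⟨e2, -, -⟩ := cell_of_segment hm (z' := z + 1) (by omega) h2
  refine BlockClass.exists_covers hmj hrows (by rwa [mul_rows]) (by rw [mul_rows]; omega) ?_
  have h3 := Nat.div_add_mod z (m j)
  have h4 := Nat.div_add_mod (z + 1) (m j)
  have h5 := Nat.mod_lt (z + 1) (hm j)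
  rw [e2, ← e1] at h4
  omega

variable {W : ℕ} (hW : 1000 ≤ W)

include hW in
-- The outer invariant counts rounds, the inner one the steps of a round. Every neighbouring pair of
-- a segment is covered in the course of 126 steps, so `SortInv.next` starts a new round after 126 ·
-- 5 = 630 moves.
theorem Wp.sortLines {hm : ∀ l, 0 < m l} {XI XG : GridConfig m} {j : Fin k} {T σ : ℕ} {S : ℕ → ℕ}
    {D d p a : ℕ → ℕ} {s : State} (hmj : 2 ≤ m j)
    (hrows : 2 ≤ gridSize m / m j) (h6 : 6 ≤ gridSize m)
    (hN : 2 * gridSize m + 2 ≤ W) (hT : T + 2 * σ * 630 ≤ W)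
    (he : Env hm XG s) (hl : LineEnv (m := m) j s) (hσ : s.reg sᵣ = σ) (hS : 0 < S j) (hSσ : S j ≤ σ)
    (hp : Placed (gridSize m) D p a s) (hD : InvPair (gridSize m) D d)
    (hpD : ∀ r < gridSize m, cellStart m S j (p r) ≤ D r ∧
      D r < cellStart m S j (p r) + cellLen m S j (p r))
    (ht : s.reg tᵣ = T) (htr : TraceTo hm j XI (s.arr outₐ) T p) :
    Wp W sortLines (10 ^ 8 * (σ * gridSize m)) (fun s' => s'.reg tᵣ = T + 2 * σ * 630 ∧
      TraceTo hm j XI (s'.arr outₐ) (T + 2 * σ * 630) D) s := by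
  have hseg := segments hm hS (R := fun _ => True) trivial
  set Seg := IsSegment (gridSize m) (cellStart m S j) (cellLen m S j) with hSeg
  have hSN : ∀ a b, Seg a b → b ≤ gridSize m := by
    rintro a b ⟨z, hz, rfl, rfl⟩
    exact hseg.le z hz
  set E : ℕ → ℕ → Prop := fun κ => (lineClass m j κ).Covers
  refine Wp.mono (Wp.for hW (cᵣ :: MPP.sortClass.wr) MPP.sortClass.wa (fun u s' => ∃ p a, Placed (gridSize m) D p a s' ∧
      SortInv (gridSize m) Seg E D p u 0 ∧ s'.reg tᵣ = T + u * 630 ∧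
      TraceTo hm j XI (s'.arr outₐ) (T + u * 630) p) (2 * σ) ((126 + 1) * (10 ^ 5 * gridSize m + 110)) (by omega)
      ?_ ?_ ?_ ?_ (hK := List.Subset.refl _)) ?_ ?_
  · rintro u hu s' ha - ⟨p, a, hp, hs, ht, htr⟩
    refine Wp.mono (Wp.for hW MPP.sortClass.wr MPP.sortClass.wa (fun κ s' => ∃ p a, Placed (gridSize m) D p a s' ∧
      SortInv (gridSize m) Seg E D p u κ ∧ s'.reg tᵣ = T + u * 630 + κ * 5 ∧
      TraceTo hm j XI (s'.arr outₐ) (T + u * 630 + κ * 5) p) 126 (10 ^ 5 * gridSize m) (by omega)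
      ?_ ⟨p, a, hp, hs, ht, htr⟩ ?_ ?_ (hL := List.Subset.refl _) (hK := List.Subset.refl _)) le_rfl ?_
    · rintro κ hκ s'' ha' hc ⟨p, a, hp, hs, ht, htr⟩
      refine Wp.mono (Wp.sortClass hW hN (by omega) hκ ((he.agree ha).agree ha') ((hl.agree ha).agree ha') hc hp ht htr) le_rfl ?_
      rintro s₁ - ⟨p', a', hp', hss, ht', htr'⟩
      rw [add_assoc (T + u * 630), ← Nat.succ_mul] at ht' htr'
      exact ⟨p', a', hp', hs.step hp.inv hp'.inv hSN hss, ht', htr'⟩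
    · exact fun _ _ => rfl
    · rintro κ v s' ⟨p, a, hp, hs, ht, htr⟩
      exact ⟨p, a, ⟨hp.inv, hp.cell, hp.robot, hp.dest⟩, hs, by simpa using ht, htr⟩
    · rintro s'' - ⟨-, -, p, a, hp, hs, ht, htr⟩
      refine ⟨p, a, hp, hs.next hSN fun a b z hab h1 h2 => ?_, by omega, ?_⟩
      · exact exists_lineClass_covers (hm := hm) hmj hrows h6 hab h1 h2 hS
      · rwa [show T + (u + 1) * 630 = T + u * 630 + 126 * 5 by ring]
  · refine ⟨p, a, hp, SortInv.init hD hp.inv hSN ?_ ?_, by simpa using ht, by simpa using htr⟩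
    · rintro _ _ r ⟨z, hz, rfl, rfl⟩ hr hlt
      exact hseg.lt_start (hp.inv.lt r hr) hz (hpD r hr).2 hlt
    · rintro _ _ r ⟨z, hz, rfl, rfl⟩ hr hle
      exact hseg.end_le (hp.inv.lt r hr) hz (hpD r hr).1 hle
  · intro s' ha
    simp [ha.reg sᵣ (by decide), hσ]
  · rintro κ v s' ⟨p, a, hp, hs, ht, htr⟩
    exact ⟨p, a, ⟨hp.inv, hp.cell, hp.robot, hp.dest⟩, hs, by simpa using ht, htr⟩
  · have h1 : 1 ≤ σ := by omega
    have h2 : 1 ≤ σ * gridSize m := Nat.mul_pos h1 (by omega)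
    have h3 : σ ≤ σ * gridSize m := Nat.le_mul_of_pos_right _ (by omega)
    have h4 : gridSize m ≤ σ * gridSize m := Nat.le_mul_of_pos_left _ h1
    nlinarith
  · rintro s' - ⟨-, -, p', a', hp', hs, ht, htr⟩
    have hsorted : ∀ r < gridSize m, p' r = D r := by
      refine hs.sorted hD hp'.inv (Nat.mul_le_mul_left 2 hSσ) ?_ hSN fun z hz =>
        ⟨_, _, ⟨z, hz, rfl, rfl⟩, hseg.start_le z hz, hseg.lt z hz⟩
      rintro _ _ ⟨z, hz, rfl, rfl⟩
      exact Nat.add_le_add_left (min_le_left _ _) _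
    refine ⟨ht, ?_⟩
    obtain ⟨Y, h1, h2⟩ := htr
    exact ⟨Y, fun r => by rw [h1, hsorted r r.is_lt], h2⟩

end Spec

/-! ### The group array, positions and destinations at the start of a phase -/

section Spec

variable {k : ℕ} {m : Fin k → ℕ}

/-- The block sizes and the parameters of a splitting step. -/
structure Blocks (i : Fin k) (h σ : ℕ) (S : ℕ → ℕ) (s : State) : Prop where
  dir : s.reg iᵣ = i
  half : s.reg hᵣ = h
  level : s.reg sᵣ = σ
  size : ∀ l < k, s.arr sizeₐ l = S l

theorem Blocks.agree {i : Fin k} {h σ : ℕ} {S : ℕ → ℕ} {s s' : State} {L K : List ℕ}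
    (hb : Blocks i h σ S s) (ha : Agree L K s s') (hL : iᵣ ∉ L ∧ hᵣ ∉ L ∧ sᵣ ∉ L := by decide)
    (hK : sizeₐ ∉ K := by decide) : Blocks i h σ S s' := by
  obtain ⟨k1, k2, k3⟩ := hL
  constructor
  · rw [ha.reg _ k1, hb.dir]
  · rw [ha.reg _ k2, hb.half]
  · rw [ha.reg _ k3, hb.level]
  · rw [ha.arr _ hK]; exact hb.size

/-- The group array describes the rounding of the coordinates in `R`. -/
def Groups (m : Fin k → ℕ) (S : ℕ → ℕ) (R : ℕ → Prop) (s : State) : Prop :=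
  ∀ v : GridVertex m, s.arr groupₐ (vertexCode v) = vertexCode (roundDown S R v)

theorem Groups.agree {S : ℕ → ℕ} {R : ℕ → Prop} {s s' : State} {L K : List ℕ} (h : Groups m S R s)
    (ha : Agree L K s s') (hK : groupₐ ∉ K := by decide) : Groups m S R s' := by
  unfold Groups
  rwa [ha.arr _ hK]

theorem roundDown_congr {S : ℕ → ℕ} {R R' : ℕ → Prop} (h : ∀ l : Fin k, R l ↔ R' l) (v : GridVertex m) :
    roundDown S R v = roundDown S R' v := by
  funext l
  have := h l
  by_cases hl : R l <;> simp_all [roundDown]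

/-- No longer rounding coordinate `j` adds back the remainder that the rounding removed. This is the
update in `refineGroup` and, read backwards, the one in `coarsenGroup`. -/
theorem vertexCode_roundDown_erase {S : ℕ → ℕ} {R : ℕ → Prop} {j : Fin k} (hR : R j) (v : GridVertex m) :
    vertexCode (roundDown S (fun l => R l ∧ l ≠ j) v) =
      vertexCode (roundDown S R v) + v j % S j * stride m j := by
  rw [vertexCode_eq, vertexCode_eq, ← Finset.add_sum_erase _ _ (Finset.mem_univ j),
    ← Finset.add_sum_erase _ _ (Finset.mem_univ j)]
  have h1 : ∀ l ∈ Finset.univ.erase j, (roundDown S (fun l => R l ∧ l ≠ j) v l : ℕ) * stride m l =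
      (roundDown S R v l : ℕ) * stride m l := by
    intro l hl
    have : (l : ℕ) ≠ j := fun e => (Finset.mem_erase.1 hl).1 (Fin.ext e)
    by_cases hRl : R l <;> simp [roundDown, this, hRl]
  rw [Finset.sum_congr rfl h1]
  have h2 : (roundDown S (fun l => R l ∧ l ≠ j) v j : ℕ) = roundDown S R v j + v j % S j := by
    have := Nat.mod_le (v j) (S j)
    simp only [roundDown, hR, ne_eq, not_true_eq_false, and_false, if_false, if_true, blockStart]
    omega
  rw [h2]
  ring

theorem exists_vertexCode {c : ℕ} (hc : c < gridSize m) : ∃ v : GridVertex m, vertexCode v = c :=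
  ⟨vertexOf ⟨c, hc⟩, vertexCode_vertexOf _⟩

theorem exists_cells (hm : ∀ l, 0 < m l) (j : Fin k) (Y : GridConfig m) :
    ∃ p a, InvPair (gridSize m) p a ∧ ∀ r, Y r = cellVertex hm j (p r) := by
  have hbij : Function.Bijective fun z : Fin (gridSize m) => cellVertex hm j z := by
    rw [Fintype.bijective_iff_injective_and_card]
    exact ⟨fun z z' e => Fin.ext (cellVertex_injOn hm j z.is_lt z'.is_lt e), by simp [GridVertex, gridSize]⟩
  have hs : ∀ r : ℕ, ∃ z < gridSize m, ∀ hr : r < gridSize m, Y ⟨r, hr⟩ = cellVertex hm j z := by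
    intro r
    by_cases hr : r < gridSize m
    · obtain ⟨z, hz⟩ := hbij.surjective (Y ⟨r, hr⟩)
      exact ⟨z, z.is_lt, fun _ => hz.symm⟩
    · exact ⟨0, gridSize_pos hm, fun h => absurd h hr⟩
  choose p hp hY using hs
  obtain ⟨a, ha⟩ := InvPair.of_inj (fun r _ => hp r) (fun r hr r' hr' e => by
    have : (⟨r, hr⟩ : Fin (gridSize m)) = ⟨r', hr'⟩ := Y.injective (by rw [hY r hr, hY r' hr', e])
    exact Fin.mk.inj_iff.1 this)
  exact ⟨p, a, ha, fun r => hY r r.is_lt⟩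

/-- Whether the goal of a robot lies in the second half of its block. -/
def goalBit (XG : GridConfig m) (i : Fin k) (h r : ℕ) : ℕ :=
  if hr : r < gridSize m then XG ⟨r, hr⟩ i / h % 2 else 0

theorem goalBit_lt (XG : GridConfig m) (i : Fin k) (h r : ℕ) : goalBit XG i h r < 2 := by
  rw [goalBit]
  split_ifs
  · exact Nat.mod_lt _ (by norm_num)
  · norm_num

variable {W : ℕ} (hW : 1000 ≤ W)

include hW in
theorem Wp.recordInverse {hm : ∀ l, 0 < m l} {XG : GridConfig m} {j : Fin k} {s : State}
    (hN : gridSize m ≤ W) (he : Env hm XG s) (hl : LineEnv (m := m) j s) :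
    Wp W (.for xᵣ ʳnᵣ recordInverse) ((gridSize m + 1) * 200)
      (fun s' => ∀ z < gridSize m, s'.arr inverseₐ (vertexCode (cellVertex hm j z)) = z) s := by
  refine Wp.mono (Wp.for hW [] [inverseₐ] (fun x s' => ∀ z < x,
    s'.arr inverseₐ (vertexCode (cellVertex hm j z)) = z) (gridSize m) MPP.recordInverse.time hN ?_
    (fun z hz => by omega) (fun s' ha => by simp [(he.agree ha).size]) fun _ _ _ h => h)
    (Nat.mul_le_mul_left _ (by decide)) fun s' _ h => h.2.2
  intro x hx s' ha hxr h
  refine Wp.block hW (by decide) ?_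
  have ho := (he.agree ha).order j x hx
  simp [MPP.recordInverse, Prog.vc, hxr, (hl.agree ha).off, ho]
  refine ⟨by omega, fun z hz => ?_⟩
  rcases hz.lt_or_eq with hz | rfl
  · rw [Function.update_of_ne, h z hz]
    exact fun e => hz.ne (cellVertex_injOn hm j (by omega) hx (vertexCode_injective e))
  · simp

include hW in
theorem Wp.findCell {hm : ∀ l, 0 < m l} {XI XG Y : GridConfig m} {j : Fin k} {T : ℕ} {p a : ℕ → ℕ} {s : State}
    (hN : gridSize m ≤ W) (he : Env hm XG s) (ht : s.reg tᵣ = T) (htr : Trace XI (s.arr outₐ) T Y)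
    (hp : InvPair (gridSize m) p a) (hY : ∀ r, Y r = cellVertex hm j (p r))
    (hinv : ∀ z < gridSize m, s.arr inverseₐ (vertexCode (cellVertex hm j z)) = z) :
    Wp W (.for xᵣ ʳnᵣ findCell) ((gridSize m + 1) * 200) (Committed p (gridSize m)) s := by
  refine Wp.mono (Wp.for hW [tmp₀] [cellₐ, robotₐ] (Committed p) (gridSize m) MPP.findCell.time hN ?_
    (fun z hz => by omega) (fun s' ha => by simp [(he.agree ha).size]) fun _ _ _ h => h)
    (Nat.mul_le_mul_left _ (by decide)) fun s' _ h => h.2.2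
  intro x hx s' ha hxr h
  refine Wp.block hW (by decide) ?_
  have h1 := htr.last ⟨x, hx⟩
  rw [hY, ← ha.arr _ (by decide)] at h1
  have h2 := hinv (p x) (hp.lt x hx)
  rw [← ha.arr _ (by decide)] at h2
  have h3 := hp.lt x hx
  have ht' : s'.reg tᵣ = T := (ha.reg _ (by decide)).trans ht
  simp only at h1
  simp [MPP.findCell, Prog.vc, hxr, (he.agree ha).size, ht', h1, h2]
  refine ⟨by omega, by omega, fun r hr => ?_⟩
  rcases Nat.lt_succ_iff_lt_or_eq.1 hr with hr | rfl
  · obtain ⟨k1, k2⟩ := h r hr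
    have hne : p r ≠ p x := fun e => hr.ne (hp.inj (by omega) hx e)
    simp [Function.update_of_ne hr.ne, Function.update_of_ne hne, k1, k2]
  · simp

include hW in
theorem Wp.clearCount {hm : ∀ l, 0 < m l} {XG : GridConfig m} {s : State}
    (hN : 2 * gridSize m ≤ W) (he : Env hm XG s) :
    Wp W (.for xᵣ (2 * ʳnᵣ) (.store countₐ ʳxᵣ 0)) ((2 * gridSize m + 1) * 200)
      (fun s' => ∀ c < 2 * gridSize m, s'.arr countₐ c = 0) s := by
  refine Wp.mono (Wp.for hW [] [countₐ] (fun x s' => ∀ c < x, s'.arr countₐ c = 0) (2 * gridSize m)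
    (Prog.store countₐ ʳxᵣ 0).time hN ?_
    (fun z hz => by omega) (fun s' ha => by simp [(he.agree ha).size]) fun _ _ _ h => h)
    (Nat.mul_le_mul_left _ (by decide)) fun s' _ h => h.2.2
  intro x hx s' ha hxr h
  refine Wp.block hW (by decide) ?_
  simp [Prog.vc, hxr]
  intro c hc
  rcases hc.lt_or_eq with hc | rfl
  · rw [Function.update_of_ne hc.ne, h c hc]
  · simp

/-- The destinations of the robots in the cells before `x` have been found. -/
structure Assigned (m : Fin k → ℕ) (S : ℕ → ℕ) (j : Fin k) (key a : ℕ → ℕ) (x : ℕ) (s : State) : Prop where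
  dest : ∀ z < x, s.arr destₐ (a z) = cellDest m S j key z
  count : ∀ c < 2 * gridSize m, s.arr countₐ c = ((Finset.range x).filter fun z => key z = c).card

include hW in
-- The array `countₐ` holds the running count of every key, so its entry when cell `x` is treated is
-- the `rank` of `x`.
theorem Wp.assignDest {hm : ∀ l, 0 < m l} {XG : GridConfig m} {i j : Fin k} {h σ : ℕ} {S : ℕ → ℕ}
    {R : ℕ → Prop} {key p a : ℕ → ℕ} {s : State} (hN : 2 * gridSize m ≤ W) (he : Env hm XG s)
    (hl : LineEnv (m := m) j s) (hb : Blocks i h σ S s) (hS : 0 < S j) (hR : R j)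
    (hg : Groups m S R s) (hp : InvPair (gridSize m) p a)
    (hrob : ∀ z < gridSize m, s.arr robotₐ z = a z)
    (hkey : ∀ z, key z = 2 * cellGroup hm S R j z + goalBit XG i h (a z))
    (hc : ∀ c < 2 * gridSize m, s.arr countₐ c = 0) :
    Wp W (.for xᵣ ʳnᵣ assignDest) ((gridSize m + 1) * 500) (Assigned m S j key a (gridSize m)) s := by
  refine Wp.mono (Wp.for hW [tmp₀, tmp₁, tmp₂, tmp₃, tmp₄] [destₐ, countₐ] (Assigned m S j key a)
    (gridSize m) MPP.assignDest.time (by omega) ?_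
    ⟨fun z hz => by omega, fun c hc' => by simp [hc c hc']⟩ (fun s' ha => by simp [(he.agree ha).size])
    fun _ _ _ h => ⟨h.dest, h.count⟩)
    (Nat.mul_le_mul_left _ (by decide)) fun s' _ h => h.2.2
  intro x hx s' ha hxr hA
  refine Wp.bdd fun hB => Wp.block hW (by decide) ?_
  have he' := he.agree ha
  have hb' := hb.agree ha
  have hl' := hl.agree ha
  have hax := hp.lt' x hx
  have h1 : s'.arr robotₐ x = a x := by rw [ha.arr _ (by decide), hrob x hx]
  have h2 := he'.order j x hx
  have h3 : s'.arr groupₐ (vertexCode (cellVertex hm j x)) = cellGroup hm S R j x := (hg.agree ha) _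
  have h4 := he'.goal ⟨a x, hax⟩
  have h5 : vertexCode (XG ⟨a x, hax⟩) / stride m i % m i / h % 2 = goalBit XG i h (a x) := by
    rw [vertexCode_div_mod, goalBit, dif_pos hax]
  have h6 : cellGroup hm S R j x < gridSize m := vertexCode_lt _
  have h7 := goalBit_lt XG i h (a x)
  have h8 : key x < 2 * gridSize m := by rw [hkey]; omega
  have h9 := hA.count _ h8
  have hst := he'.stride i i.is_lt
  have hsi := hb'.size j j.is_lt
  have hlen : cellLen m S j x = min (S j) (m j - (x % m j - x % m j % S j)) := rfl
  have hSW : S j ≤ W := hsi ▸ hB.arr _ _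
  have hmod := Nat.mod_le (x % m j) (S j)
  have hmod' := Nat.mod_lt x (hm j)
  have hmj := side_le_gridSize hm j
  have hseg := segments hm hS hR
  have hrr := hseg.roundRobin_lt key hx
  have hsl := hseg.le x hx
  have hcs : x - x % m j % S j = cellStart m S j x := rfl
  have hrank : ((Finset.range x).filter fun z => key z = key x).card = rank key x := rfl
  rw [hrank] at h9
  have hrk : rank key x ≤ x := by
    rw [← hrank]
    exact (Finset.card_filter_le _ _).trans (by simp)
  simp only at h4
  -- The program has four branches, for full or truncated segments and even or odd keys, which
  -- differ only in the computation of `v`.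
  have hfin : ∀ v, v = roundRobin key (cellLen m S j) x → ∀ s₁ : State,
      s₁.arr destₐ = Function.update (s'.arr destₐ) (a x) (cellStart m S j x + v) →
      s₁.arr countₐ = Function.update (s'.arr countₐ) (key x) (rank key x + 1) →
      Assigned m S j key a (x + 1) s₁ := by
    rintro v rfl s₁ e1 e2
    refine ⟨fun z hz => ?_, fun c hc => ?_⟩
    · rw [e1]
      rcases Nat.lt_succ_iff_lt_or_eq.1 hz with hz | rfl
      · rw [Function.update_of_ne, hA.dest z hz]
        exact fun e => hz.ne (hp.symm.inj (by omega) hx e)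
      · simp [cellDest]
    · rw [e2, Finset.range_add_one, Finset.filter_insert]
      by_cases hck : c = key x
      · subst hck
        rw [if_pos rfl, Finset.card_insert_of_notMem (by simp), Function.update_self, hrank]
      · rw [Function.update_of_ne hck, hA.count c hc, if_neg (Ne.symm hck)]
  have h5' : s'.arr goalₐ (a x) / stride m i % m i / h % 2 = goalBit XG i h (a x) := by
    rw [h4, h5]
  simp [MPP.assignDest, Prog.vc, hxr, h1, hl'.off, h2, h3, hb'.dir, hb'.half, hst, he'.side, side_val, hl'.len, hl'.dir,
    hsi, h5', ← hkey, h9]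
  have hmodW : ∀ L, rank key x % L ≤ W := fun L => (Nat.mod_le _ _).trans (by omega)
  have leaf : ∀ v, v = roundRobin key (cellLen m S j) x → ∀ s₁ : State,
      (x - x % m j % S j + v ≤ W ∧ rank key x < W) ∧
      (s₁.arr destₐ = s'.arr destₐ → s₁.arr countₐ = s'.arr countₐ →
        Assigned m S j key a (x + 1) ((s₁.setArr destₐ (a x) (x - x % m j % S j + v)).setArr countₐ
          (key x) (rank key x + 1))) := by
    rintro v rfl s₁
    rw [hcs]
    exact ⟨by omega, fun e1 e2 => hfin _ rfl _ (by simp [e1]) (by simp [e2])⟩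
  refine ⟨by omega, by omega, by omega, hSW, fun hlt => ?_, fun hge => ?_⟩
  · have hlen' : cellLen m S j x = m j - (x % m j - x % m j % S j) := hlen.trans (min_eq_right hlt.le)
    rw [← hlen'] at *
    refine ⟨by omega, hmodW _, fun hodd => ?_, fun heven => ?_⟩
    · obtain ⟨l1, l2⟩ := leaf (cellLen m S j x - 1 - rank key x % cellLen m S j x) (by rw [roundRobin, if_neg (by omega)])
        (((((((s'.setReg 23 (a x)).setReg 24 (key x)).setReg 25 (x % m j % S ↑j)).setReg 26 (S ↑j)).setReg 26
          (cellLen m S j x)).setReg 27 (rank key x % cellLen m S j x)).setReg 27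
          (cellLen m S j x - 1 - rank key x % cellLen m S j x))
      exact ⟨by omega, l1.1, l1.2, l2 rfl rfl⟩
    · obtain ⟨l1, l2⟩ := leaf (rank key x % cellLen m S j x) (by rw [roundRobin, if_pos heven])
        ((((((s'.setReg 23 (a x)).setReg 24 (key x)).setReg 25 (x % m j % S ↑j)).setReg 26 (S ↑j)).setReg 26
          (cellLen m S j x)).setReg 27 (rank key x % cellLen m S j x))
      exact ⟨l1.1, l1.2, l2 rfl rfl⟩
  · have hlen' : cellLen m S j x = S j := hlen.trans (min_eq_left hge)
    refine ⟨hmodW _, fun hodd => ?_, fun heven => ?_⟩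
    · obtain ⟨l1, l2⟩ := leaf (S j - 1 - rank key x % S j) (by rw [roundRobin, if_neg (by omega), hlen'])
        ((((((s'.setReg 23 (a x)).setReg 24 (key x)).setReg 25 (x % m j % S ↑j)).setReg 26 (S ↑j)).setReg
          27 (rank key x % S j)).setReg 27 (S j - 1 - rank key x % S j))
      exact ⟨by omega, l1.1, l1.2, l2 rfl rfl⟩
    · obtain ⟨l1, l2⟩ := leaf (rank key x % S j) (by rw [roundRobin, if_pos heven, hlen'])
        (((((s'.setReg 23 (a x)).setReg 24 (key x)).setReg 25 (x % m j % S ↑j)).setReg 26 (S ↑j)).setReg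
          27 (rank key x % S j))
      exact ⟨l1.1, l1.2, l2 rfl rfl⟩

end Spec

/-! ### One phase -/

section Spec

variable {k : ℕ} {m : Fin k → ℕ} {W : ℕ} (hW : 1000 ≤ W)

include hW in
theorem Wp.assign {x : ℕ} {e : Term} {q : Prog} {τ : ℕ} {Q : State → Prop} {s : State}
    (he : e.small = true) (hv : e.eval s ≤ W) (hq : Wp W q τ Q (s.setReg x (e.eval s))) :
    Wp W (.seq (.assign x e) q) (101 + τ) Q s := by
  have hc : e.cost ≤ 100 := by
    simp only [Term.small, Bool.and_eq_true, decide_eq_true_eq] at he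
    exact he.2
  refine Wp.mono (Wp.seq (R := fun s' => s' = s.setReg x (e.eval s))
    (Wp.block hW (p := .assign x e) he ⟨hv, rfl⟩) fun s' h => h ▸ hq) ?_ fun _ _ h => h
  simp only [Prog.time]
  omega

include hW in
theorem Wp.refineGroup {hm : ∀ l, 0 < m l} {XG : GridConfig m} {i j : Fin k} {h σ : ℕ} {S : ℕ → ℕ}
    {R : ℕ → Prop} {s : State} (hN : gridSize m ≤ W) (he : Env hm XG s)
    (hl : LineEnv (m := m) j s) (hb : Blocks i h σ S s) (hR : R j) (hg : Groups m S R s) :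
    Wp W (.for xᵣ ʳnᵣ refineGroup) ((gridSize m + 1) * 300) (Groups m S fun l => R l ∧ l ≠ j) s := by
  refine Wp.mono (Wp.for hW [] [groupₐ] (fun x s' => ∀ v : GridVertex m, s'.arr groupₐ (vertexCode v) =
    if vertexCode v < x then vertexCode (roundDown S (fun l => R l ∧ l ≠ j) v) else vertexCode (roundDown S R v))
    (gridSize m) MPP.refineGroup.time hN ?_
    (fun v => by simp [hg v]) (fun s' ha => by simp [(he.agree ha).size]) fun _ _ _ h => h)
    (Nat.mul_le_mul_left _ (by decide)) fun s' _ h v => ?_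
  swap
  · rw [h.2.2, if_pos (vertexCode_lt v)]
  intro x hx s' ha hxr hI
  obtain ⟨u, rfl⟩ := exists_vertexCode hx
  refine Wp.block hW (by decide) ?_
  have h1 := hI u
  rw [if_neg (lt_irrefl _)] at h1
  have h2 := vertexCode_roundDown_erase (S := S) hR u
  have h3 := vertexCode_lt (roundDown S (fun l => R l ∧ l ≠ j) u)
  simp [MPP.refineGroup, Prog.vc, hxr, h1, (hl.agree ha).dir, (hl.agree ha).len, (he.agree ha).stride j j.is_lt,
    (hb.agree ha).size j j.is_lt, vertexCode_div_mod, ← h2]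
  refine ⟨by simpa using h3.le.trans hN, fun v => ?_⟩
  by_cases hvu : v = u
  · subst hvu
    simp
  · have hne : vertexCode v ≠ vertexCode u := fun e => hvu (vertexCode_injective e)
    have hiff : vertexCode v ≤ vertexCode u ↔ vertexCode v < vertexCode u := by omega
    simp [Function.update_of_ne hne, hI v, hiff]

/-- The configuration `Y'` arises from `Y` by distributing the robots in all lines in direction `j`. -/
def PhaseStep (hm : ∀ l, 0 < m l) (S : ℕ → ℕ) (R : ℕ → Prop) (j : Fin k) (bit : ℕ → ℕ)
    (Y Y' : GridConfig m) : Prop :=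
  ∃ p a key, InvPair (gridSize m) p a ∧ (∀ r, Y r = cellVertex hm j (p r)) ∧
    (∀ z, key z = 2 * cellGroup hm S R j z + bit (a z)) ∧
    ∀ r : Fin (gridSize m), Y' r = cellVertex hm j (cellDest m S j key (p r))

include hW in
-- The destinations form a permutation by `Segments.dest_inj` and stay inside the segments, so
-- sorting by them brings every robot to its destination.
theorem Wp.phase {hm : ∀ l, 0 < m l} {XI XG Y : GridConfig m} {i j : Fin k} {h σ T : ℕ} {S : ℕ → ℕ}
    {R : ℕ → Prop} {s : State} (hmj : 2 ≤ m j)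
    (hrows : 2 ≤ gridSize m / m j) (h6 : 6 ≤ gridSize m) (hN : 2 * gridSize m + 2 ≤ W)
    (hkN : k * gridSize m ≤ W) (hT : T + 2 * σ * 630 ≤ W) (he : Env hm XG s) (hj : s.reg jᵣ = j)
    (hb : Blocks i h σ S s) (hS : 0 < S j) (hSσ : S j ≤ σ) (hR : R j) (hg : Groups m S R s)
    (ht : s.reg tᵣ = T) (htr : Trace XI (s.arr outₐ) T Y) :
    Wp W phase (2 * 10 ^ 8 * (σ * gridSize m)) (fun s' => ∃ Y', PhaseStep hm S R j (goalBit XG i h) Y Y' ∧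
      s'.reg tᵣ = T + 2 * σ * 630 ∧ Trace XI (s'.arr outₐ) (T + 2 * σ * 630) Y' ∧
      Groups m S (fun l => R l ∧ l ≠ j) s') s := by
  have hmN := side_le_gridSize hm j
  have hside : (Term.read sideₐ ʳjᵣ).eval s = m j := by simp [hj, he.side, side_val]
  have hjk : j * gridSize m ≤ W := (Nat.mul_le_mul_right _ j.is_lt.le).trans hkN
  -- The assignments of the line parameters are split off; the remainder works from any state in
  -- which they are set.
  suffices H : ∀ s₀, Env hm XG s₀ → LineEnv (m := m) j s₀ → Blocks i h σ S s₀ → Groups m S R s₀ →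
      s₀.reg tᵣ = T → Trace XI (s₀.arr outₐ) T Y → Wp W
        (.for xᵣ ʳnᵣ MPP.recordInverse ;; .for xᵣ ʳnᵣ MPP.findCell ;;
        .for xᵣ (2 * ʳnᵣ) (.store countₐ ʳxᵣ 0) ;; .for xᵣ ʳnᵣ MPP.assignDest ;;
        MPP.sortLines ;; .for xᵣ ʳnᵣ MPP.refineGroup)
        ((gridSize m + 1) * 200 + ((gridSize m + 1) * 200 + ((2 * gridSize m + 1) * 200 +
          ((gridSize m + 1) * 500 + (10 ^ 8 * (σ * gridSize m) + (gridSize m + 1) * 300)))))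
        (fun s' => ∃ Y', PhaseStep hm S R j (goalBit XG i h) Y Y' ∧
          s'.reg tᵣ = T + 2 * σ * 630 ∧ Trace XI (s'.arr outₐ) (T + 2 * σ * 630) Y' ∧
          Groups m S (fun l => R l ∧ l ≠ j) s') s₀ by
    refine Wp.mono (Wp.assign hW (by decide) (by rw [hside]; omega) (Wp.assign hW (by decide) ?_
      (Wp.assign hW (by decide) ?_ (H _ ?_ ?_ ?_ hg ?_ htr)))) ?_ fun _ _ h => h
    · simp [hside, he.size]
      exact (Nat.div_le_self _ _).trans (by omega)
    · simp [hj, he.size, hjk]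
    · exact ⟨by simp [he.dim], by simp [he.size], he.side, he.goal, he.stride, he.table, he.order⟩
    · constructor <;> simp [hj, he.side, side_val, he.size]
    · exact ⟨by simp [hb.dir], by simp [hb.half], by simp [hb.level], hb.size⟩
    · simp [ht]
    · have : gridSize m ≤ σ * gridSize m := Nat.le_mul_of_pos_left _ (by omega)
      omega
  clear hside hb he hg ht htr hj s
  intro s he hl hb hg ht htr
  obtain ⟨p, a, hp, hY⟩ := exists_cells hm j Y
  refine Wp.seq (Wp.agree [xᵣ] [inverseₐ] (Wp.recordInverse hW (by omega) he hl)) ?_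
  rintro s₁ ⟨ha₁, hinv⟩
  have ht₁ : s₁.reg tᵣ = T := (ha₁.reg _ (by decide)).trans ht
  have htr₁ : Trace XI (s₁.arr outₐ) T Y := by rwa [ha₁.arr _ (by decide)]
  refine Wp.seq (Wp.agree [xᵣ, tmp₀] [cellₐ, robotₐ]
    (Wp.findCell hW (by omega) (he.agree ha₁) ht₁ htr₁ hp hY hinv)) ?_
  rintro s₂ ⟨ha₂, hcom⟩
  have he₂ := (he.agree ha₁).agree ha₂
  have hl₂ := (hl.agree ha₁).agree ha₂
  have hb₂ := (hb.agree ha₁).agree ha₂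
  have hg₂ := (hg.agree ha₁).agree ha₂
  have ht₂ : s₂.reg tᵣ = T := (ha₂.reg _ (by decide)).trans ht₁
  have htr₂ : Trace XI (s₂.arr outₐ) T Y := by rwa [ha₂.arr _ (by decide)]
  refine Wp.seq (Wp.agree [xᵣ] [countₐ] (Wp.clearCount hW (by omega) he₂)) ?_
  rintro s₃ ⟨ha₃, hcount⟩
  have hrob : ∀ z < gridSize m, s₂.arr robotₐ z = a z := fun z hz => by
    have := (hcom (a z) (hp.lt' z hz)).2
    rwa [hp.right z hz] at this
  set key : ℕ → ℕ := fun z => 2 * cellGroup hm S R j z + goalBit XG i h (a z) with hkey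
  refine Wp.seq (Wp.agree [xᵣ, tmp₀, tmp₁, tmp₂, tmp₃, tmp₄] [destₐ, countₐ]
    (Wp.assignDest hW (key := key) (by omega) (he₂.agree ha₃) (hl₂.agree ha₃) (hb₂.agree ha₃) hS hR (hg₂.agree ha₃) hp
      (by rwa [ha₃.arr _ (by decide)]) (fun z => rfl) hcount)) ?_
  rintro s₄ ⟨ha₄, hass⟩
  have he₄ := (he₂.agree ha₃).agree ha₄
  have hl₄ := (hl₂.agree ha₃).agree ha₄
  have hb₄ := (hb₂.agree ha₃).agree ha₄
  have hg₄ := (hg₂.agree ha₃).agree ha₄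
  have hseg := segments hm hS hR
  obtain ⟨d, hd⟩ := InvPair.of_inj (N := gridSize m) (p := fun r => cellDest m S j key (p r))
    (fun r hr => by
      have h1 := hseg.roundRobin_lt key (hp.lt r hr)
      have h2 := hseg.le _ (hp.lt r hr)
      simp only [cellDest]
      omega)
    (fun r hr r' hr' e => hp.inj hr hr' (hseg.dest_inj (fun z => rfl) (fun z => goalBit_lt XG i h (a z))
      (hp.lt r hr) (hp.lt r' hr') e))
  have hplaced : Placed (gridSize m) (fun r => cellDest m S j key (p r)) p a s₄ := by
    refine ⟨hp, fun r hr => ?_, fun z hz => ?_, fun r hr => ?_⟩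
    · rw [ha₄.arr _ (by decide), ha₃.arr _ (by decide)]
      exact (hcom r hr).1
    · rw [ha₄.arr _ (by decide), ha₃.arr _ (by decide), hrob z hz]
    · have := hass.dest (p r) (hp.lt r hr)
      rwa [hp.left r hr] at this
  refine Wp.seq (Wp.agree MPP.sortLines.wr MPP.sortLines.wa
    (Wp.sortLines hW hmj hrows h6 hN hT (XI := XI) he₄ hl₄ hb₄.level hS hSσ hplaced hd
      (fun r hr => ⟨Nat.le_add_right _ _, Nat.add_lt_add_left (hseg.roundRobin_lt key (hp.lt r hr)) _⟩) ?_
      ⟨Y, hY, ?_⟩) (List.Subset.refl _) (List.Subset.refl _)) ?_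
  · rw [ha₄.reg _ (by decide), ha₃.reg _ (by decide), ht₂]
  · rwa [ha₄.arr _ (by decide), ha₃.arr _ (by decide)]
  rintro s₅ ⟨ha₅, ht₅, Y', hY', htr₅⟩
  refine Wp.mono (Wp.agree [xᵣ] [groupₐ] (Wp.refineGroup hW (by omega) (he₄.agree ha₅) (hl₄.agree ha₅)
    (hb₄.agree ha₅) hR (hg₄.agree ha₅))) le_rfl ?_
  rintro s₆ - ⟨ha₆, hg₆⟩
  refine ⟨Y', ⟨p, a, key, hp, hY, fun z => rfl, hY'⟩, ?_, ?_, hg₆⟩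
  · rw [ha₆.reg _ (by decide), ht₅]
  · rwa [ha₆.arr _ (by decide)]

end Spec

/-! ### Halving the blocks in one coordinate -/

section Spec

variable {k : ℕ} {m : Fin k → ℕ}

theorem Balanced.congr {S : ℕ → ℕ} {R R' : ℕ → Prop} {i : Fin k} {h : ℕ} {bit : ℕ → ℕ}
    {Y : Fin (gridSize m) → GridVertex m} (hB : Balanced S R i h bit Y) (hR : ∀ l : Fin k, R l ↔ R' l) :
    Balanced S R' i h bit Y := by
  intro v
  simp only [← roundDown_congr hR]
  exact hB v

theorem Groups.congr {S : ℕ → ℕ} {R R' : ℕ → Prop} {s : State} (hg : Groups m S R s)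
    (hR : ∀ l : Fin k, R l ↔ R' l) : Groups m S R' s := by
  intro v
  rw [← roundDown_congr hR]
  exact hg v

/-- Robots move only along direction `j` and inside their segments, so none leaves its block. -/
theorem PhaseStep.div_eq {hm : ∀ l, 0 < m l} {S : ℕ → ℕ} {R : ℕ → Prop} {j : Fin k} {bit : ℕ → ℕ}
    {Y Y' : GridConfig m} (h : PhaseStep hm S R j bit Y Y') (hS : 0 < S j) (hR : R j) (r : Fin (gridSize m))
    (l : Fin k) : (Y' r l : ℕ) / S l = Y r l / S l := by
  obtain ⟨p, a, key, hp, hY, -, hY'⟩ := h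
  obtain ⟨h1, -, h2⟩ := cellVertex_dest hm hS hR key (hp.lt r r.is_lt)
  rw [hY', hY]
  by_cases hl : l = j
  · subst hl
    rw [blockStart_eq, blockStart_eq] at h2
    exact Nat.eq_of_mul_eq_mul_left hS h2
  · rw [h1 l hl]

variable {W : ℕ} (hW : 1000 ≤ W)

include hW in
theorem Wp.initGroup {hm : ∀ l, 0 < m l} {XG : GridConfig m} {s : State} (S : ℕ → ℕ)
    (hN : gridSize m ≤ W) (he : Env hm XG s) :
    Wp W (.for xᵣ ʳnᵣ (.store groupₐ ʳxᵣ ʳxᵣ)) ((gridSize m + 1) * 200) (Groups m S (· < 0)) s := by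
  refine Wp.mono (Wp.for hW [] [groupₐ] (fun x s' => ∀ c < x, s'.arr groupₐ c = c) (gridSize m)
    (Prog.store groupₐ ʳxᵣ ʳxᵣ).time hN ?_
    (fun z hz => by omega) (fun s' ha => by simp [(he.agree ha).size]) fun _ _ _ h => h)
    (Nat.mul_le_mul_left _ (by decide)) fun s' _ h v => ?_
  · intro x hx s' ha hxr h
    refine Wp.block hW (by decide) ?_
    simp [Prog.vc, hxr]
    refine ⟨by omega, fun c hc => ?_⟩
    rcases hc.lt_or_eq with hc | rfl
    · rw [Function.update_of_ne hc.ne, h c hc]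
    · simp
  · rw [h.2.2 _ (vertexCode_lt v)]
    congr 1
    funext l
    simp [roundDown]

include hW in
theorem Wp.coarsenGroup {hm : ∀ l, 0 < m l} {XG : GridConfig m} {i : Fin k} {h σ d : ℕ} {S : ℕ → ℕ}
    {s : State} (hN : gridSize m ≤ W) (he : Env hm XG s) (hd : d < k) (hdr : s.reg dᵣ = d)
    (hb : Blocks i h σ S s) (hg : Groups m S (· < d) s) :
    Wp W (.for xᵣ ʳnᵣ coarsenGroup) ((gridSize m + 1) * 300) (Groups m S (· < d + 1)) s := by
  refine Wp.mono (Wp.for hW [] [groupₐ] (fun x s' => ∀ v : GridVertex m, s'.arr groupₐ (vertexCode v) =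
    if vertexCode v < x then vertexCode (roundDown S (· < d + 1) v) else vertexCode (roundDown S (· < d) v))
    (gridSize m) MPP.coarsenGroup.time hN ?_
    (fun v => by simp [hg v]) (fun s' ha => by simp [(he.agree ha).size]) fun _ _ _ h => h)
    (Nat.mul_le_mul_left _ (by decide)) fun s' _ h v => ?_
  swap
  · rw [h.2.2, if_pos (vertexCode_lt v)]
  intro x hx s' ha hxr hI
  obtain ⟨u, rfl⟩ := exists_vertexCode hx
  refine Wp.block hW (by decide) ?_
  have hdr' : s'.reg dᵣ = d := (ha.reg _ (by decide)).trans hdr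
  have h1 := hI u
  rw [if_neg (lt_irrefl _)] at h1
  have h2 := vertexCode_roundDown_erase (S := S) (R := (· < d + 1)) (j := ⟨d, hd⟩) (Nat.lt_succ_self d) u
  rw [roundDown_congr (R' := (· < d)) fun l => by simp only; omega] at h2
  have h3 : vertexCode u / stride m d % m ⟨d, hd⟩ = u ⟨d, hd⟩ := vertexCode_div_mod u ⟨d, hd⟩
  have h4 : vertexCode (roundDown S (· < d) u) - u ⟨d, hd⟩ % S d * stride m d =
      vertexCode (roundDown S (· < d + 1) u) := by
    rw [h2]
    exact Nat.add_sub_cancel _ _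
  have h5 := vertexCode_lt (roundDown S (· < d + 1) u)
  refine ⟨?_, fun v => ?_⟩ <;>
    simp only [Term.eval_sub, Term.eval_mul, Term.eval_mod, Term.eval_div, Term.eval_read, Term.eval_reg,
      hxr, h1, hdr', (he.agree ha).stride d hd, (hb.agree ha).size d hd, (he.agree ha).side, side_of_lt m hd, h3, h4]
  · omega
  by_cases hvu : v = u
  · subst hvu
    simp
  · have hne : vertexCode v ≠ vertexCode u := fun e => hvu (vertexCode_injective e)
    have hiff : vertexCode v ≤ vertexCode u ↔ vertexCode v < vertexCode u := by omega
    simp [Function.update_of_ne hne, hI v, hiff]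

include hW in
-- The first loop over `d` coarsens the groups from vertices to blocks. In the second, every `d ≠ i`
-- leaves the set of rounded coordinates by a phase, so before step `d` this set consists of `i` and
-- the coordinates from `d` on; skipping `d = i` is consistent with this. Only `i` is left for the
-- final phase. The factor `k + 1` counts the `k` passes of the loop, one of them idle, and the
-- final phase.
theorem Wp.split {hm : ∀ l, 0 < m l} {XI XG Y : GridConfig m} {i : Fin k} {h σ T : ℕ} {S : ℕ → ℕ}
    {s : State} (hm2 : ∀ l, 2 ≤ m l)
    (hrows : ∀ l, 2 ≤ gridSize m / m l) (h6 : 6 ≤ gridSize m) (hN : 2 * gridSize m + 2 ≤ W)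
    (hkN : k * gridSize m ≤ W) (hT : T + (k + 1) * (2 * σ * 630) ≤ W) (he : Env hm XG s)
    (hi : s.reg iᵣ = i) (hσ : s.reg sᵣ = σ) (hσh : σ = 2 * h) (hh : 0 < h) (hσW : σ ≤ W)
    (hsize : ∀ l < k, s.arr sizeₐ l = S l)
    (hS : ∀ l < k, 0 < S l ∧ S l ≤ σ) (hSi : S i = σ)
    (hY : ∀ r l, (Y r l : ℕ) / S l = XG r l / S l)
    (ht : s.reg tᵣ = T) (htr : Trace XI (s.arr outₐ) T Y) :
    Wp W split (10 ^ 9 * (k * (σ * gridSize m))) (fun s' => ∃ T' ≤ T + (k + 1) * (2 * σ * 630), ∃ Y',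
      s'.reg tᵣ = T' ∧ Trace XI (s'.arr outₐ) T' Y' ∧
      (∀ l < k, s'.arr sizeₐ l = Function.update S i h l) ∧
      ∀ r l, (Y' r l : ℕ) / Function.update S i h l = XG r l / Function.update S i h l) s := by
  have hk := i.pos
  refine Wp.mono (Wp.assign hW (by decide) ?_ (Wp.seq (Wp.agree [xᵣ] [groupₐ] (Wp.initGroup hW S (by omega) (XG := XG)
    (hm := hm) ?_)) (τ' := (k + 1) * ((gridSize m + 1) * 300 + 110) + ((k + 1) * ((101 + (101 + 2 * 10 ^ 8 * (σ * gridSize m))) + 110) +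
      (101 + (2 * 10 ^ 8 * (σ * gridSize m) + (Prog.store sizeₐ ʳiᵣ ʳhᵣ).time)))) ?_)) ?_ fun _ _ h => h
  · simp [hσ]
    omega
  · exact ⟨by simp [he.dim], by simp [he.size], he.side, he.goal, he.stride, he.table, he.order⟩
  swap
  · have h0 : (Prog.store sizeₐ ʳiᵣ ʳhᵣ).time = 3 := rfl
    rw [h0]
    have h1 : gridSize m ≤ σ * gridSize m := Nat.le_mul_of_pos_left _ (by omega)
    have h2 := Nat.mul_le_mul_left k h1
    have h3 : σ * gridSize m ≤ k * (σ * gridSize m) := Nat.le_mul_of_pos_left _ hk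
    have h4 : k ≤ k * gridSize m := Nat.le_mul_of_pos_right _ (by omega)
    nlinarith
  have hsh : σ / 2 = h := by omega
  rintro s₁ ⟨ha₁, hg₁⟩
  have he₁ : Env hm XG s₁ := Env.agree (s := s.setReg hᵣ h)
    ⟨by simp [he.dim], by simp [he.size], he.side, he.goal, he.stride, he.table, he.order⟩
    (by simpa [hσ, hsh] using ha₁)
  have hb₁ : Blocks i h σ S s₁ := Blocks.agree (s := s.setReg hᵣ h)
    ⟨by simp [hi], by simp, by simp [hσ], hsize⟩ (by simpa [hσ, hsh] using ha₁)
  have ht₁ : s₁.reg tᵣ = T := by rw [ha₁.reg _ (by decide)]; simp [ht]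
  have htr₁ : Trace XI (s₁.arr outₐ) T Y := by rw [ha₁.arr _ (by decide)]; exact htr
  refine Wp.seq (Wp.for hW [xᵣ] [groupₐ] (fun d s' => Groups m S (· < d) s') k _ ?_ ?_ hg₁ ?_ ?_) ?_
  · exact (Nat.le_mul_of_pos_right _ (by omega)).trans hkN
  · intro d hd s' ha hdr hg
    exact Wp.coarsenGroup hW (by omega) (he₁.agree ha) hd hdr (hb₁.agree ha) hg
  · intro s' ha
    simp [(he₁.agree ha).dim]
  · exact fun _ _ _ h => h
  rintro s₂ ⟨ha₂, -, hg₂⟩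
  have he₂ := he₁.agree ha₂
  have hb₂ := hb₁.agree ha₂
  set bit := goalBit XG i h with hbit
  refine Wp.seq (Wp.for hW (jᵣ :: MPP.phase.wr) MPP.phase.wa (fun d s' => ∃ T' ≤ T + d * (2 * σ * 630), ∃ Y' : GridConfig m,
    s'.reg tᵣ = T' ∧ Trace XI (s'.arr outₐ) T' Y' ∧ Groups m S (fun l => d ≤ l ∨ l = i) s' ∧
    Balanced S (fun l => d ≤ l ∨ l = i) i h bit Y' ∧ ∀ r l, (Y' r l : ℕ) / S l = XG r l / S l) k _ ?_ ?_ ?_ ?_ ?_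
    (hK := List.Subset.refl _)) ?_
  · exact (Nat.le_mul_of_pos_right _ (by omega)).trans hkN
  · rintro d hd s' ha hdr ⟨T', hT', Y', ht', htr', hg', hB', hY'⟩
    have hb' := hb₂.agree ha
    have he' := he₂.agree ha
    refine Wp.branch hW (by decide) (fun hdi => ?_) fun hdi => ?_
    · have hdi' : d = i := by
        by_contra hne
        simp [hdr, hb'.dir, hne] at hdi
      refine Wp.mono (Wp.block hW (p := .skip) (Q := fun s₁ => s₁ = s') rfl rfl) (by simp [Prog.time]; omega) ?_
      rintro s'' - rfl
      exact ⟨T', by nlinarith, Y', ht', htr', hg'.congr fun l => by omega, hB'.congr fun l => by omega, hY'⟩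
    · have hdi' : d ≠ i := by
        intro e
        simp [hdr, hb'.dir, e] at hdi
      have hTd : T + (d + 1) * (2 * σ * 630) ≤ T + (k + 1) * (2 * σ * 630) :=
        Nat.add_le_add_left (Nat.mul_le_mul_right _ (by omega)) _
      rw [add_mul d 1, one_mul] at hTd
      refine Wp.assign hW (by decide) ?_ (Wp.mono (Wp.phase hW (j := ⟨d, hd⟩) (i := i) (T := T') (hm2 _) (hrows _) h6 hN hkN (by omega)
        (XG := XG) (hm := hm) ?_ ?_ (h := h) ?_ (hS d hd).1 (hS d hd).2 (R := fun l => d ≤ l ∨ l = i) (Or.inl le_rfl) hg' ?_ htr') le_rfl ?_)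
      · simp [hdr]
        have := Nat.mul_le_mul_left k (show 1 ≤ gridSize m by omega)
        omega
      · exact ⟨by simp [he'.dim], by simp [he'.size], he'.side, he'.goal, he'.stride, he'.table, he'.order⟩
      · simp [hdr]
      · exact ⟨by simp [hb'.dir], by simp [hb'.half], by simp [hb'.level], hb'.size⟩
      · simp [ht']
      · rintro s'' - ⟨Y'', hst, ht'', htr'', hg''⟩
        refine ⟨_, by rw [add_mul d 1]; omega, Y'', ht'', htr'', hg''.congr fun l => by simp only; omega, ?_, fun r l => ?_⟩
        · obtain ⟨p, a, key, hp, hYp, hkey, hY''⟩ := hst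
          have := Balanced.phase hm (j := ⟨d, hd⟩) (hS d hd).1 (Or.inl le_rfl) (fun e => hdi' (by rw [e])) hB' hp hYp hkey
            (goalBit_lt XG i h)
          rw [show (Y'' : Fin (gridSize m) → GridVertex m) = _ from funext hY'']
          exact this.congr fun l => by simp only; omega
        · rw [hst.div_eq (hS d hd).1 (Or.inl le_rfl), hY']
  · refine ⟨T, by omega, Y, ?_, ?_, hg₂.congr fun l => by simp, Balanced.init XG (fun r => ?_) (fun r => ?_), hY⟩
    · rw [ha₂.reg _ (by decide), ht₁]
    · rwa [ha₂.arr _ (by decide)]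
    · rw [roundDown_eq_iff]
      intro l
      simp [blockStart_eq, hY r l]
    · rw [hbit, goalBit, dif_pos r.is_lt]
  · intro s' ha
    simp [(he₂.agree ha).dim]
  · rintro d v s' ⟨T', hT', Y', ht', h⟩
    exact ⟨T', hT', Y', by simpa using ht', h⟩
  rintro s₃ ⟨ha₃, -, T', hT', Y', ht', htr', hg', hB', hY'⟩
  have hb₃ := hb₂.agree ha₃
  have he₃ := he₂.agree ha₃
  rw [add_mul k 1, one_mul] at hT ⊢
  refine Wp.assign hW (by decide) ?_ (Wp.seq (Wp.agree MPP.phase.wr MPP.phase.wa (Wp.phase hW (j := i) (i := i) (T := T') (hm2 _) (hrows _) h6 hN hkN (by omega)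
        (XG := XG) (hm := hm) ?_ ?_ (h := h) ?_ (hS i i.is_lt).1 (hS i i.is_lt).2 (R := fun l => k ≤ l ∨ l = i) (Or.inr rfl) hg' ?_ htr')
        (List.Subset.refl _) (List.Subset.refl _)) ?_)
  · simp [hb₃.dir]
    have := Nat.mul_le_mul_left k (show 1 ≤ gridSize m by omega)
    omega
  · exact ⟨by simp [he₃.dim], by simp [he₃.size], he₃.side, he₃.goal, he₃.stride, he₃.table, he₃.order⟩
  · simp [hb₃.dir]
  · exact ⟨by simp [hb₃.dir], by simp [hb₃.half], by simp [hb₃.level], hb₃.size⟩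
  · simp [ht']
  rintro s₄ ⟨ha₄, Y'', hst, ht'', htr'', -⟩
  have hb₄ : Blocks i h σ S s₄ := Blocks.agree (s := s₃.setReg jᵣ (s₃.reg iᵣ)) (L := MPP.phase.wr) (K := MPP.phase.wa)
    ⟨by simp [hb₃.dir], by simp [hb₃.half], by simp [hb₃.level], hb₃.size⟩ ha₄
  refine Wp.block hW (by decide) ⟨by simp [hb₄.half]; omega, T' + 2 * σ * 630, by omega, Y'', ht'', htr'', fun l hl => ?_, fun r l => ?_⟩
  · simp only [Term.eval_reg, hb₄.dir, hb₄.half, State.setArr_arr, if_true, Function.update_apply]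
    split_ifs
    · rfl
    · exact hb₄.size l hl
  · have hdiv := hst.div_eq (hS i i.is_lt).1 (Or.inr rfl) r
    by_cases hl : l = i
    · subst hl
      rw [Function.update_self]
      have h1 : (Y'' r l : ℕ) / h % 2 = bit r := by
        obtain ⟨p, a, key, hp, hYp, hkey, hY''⟩ := hst
        rw [hY'']
        exact Balanced.final hm (R := fun l' => k ≤ l' ∨ l' = l) (hSi.trans hσh) hh (fun l' => by omega) hB' hp hYp hkey (goalBit_lt XG l h) r
      rw [hbit, goalBit, dif_pos r.is_lt] at h1
      -- A robot in the same block of side `2 * h` as its goal, and in the same half of it, is in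
      -- the same block of side `h`.
      have h2 := (hdiv l).trans (hY' r l)
      rw [hSi, hσh, mul_comm, ← Nat.div_div_eq_div_mul, ← Nat.div_div_eq_div_mul] at h2
      simp only [Fin.eta] at h1
      omega
    · rw [Function.update_of_ne fun e => hl (Fin.ext e), hdiv l, hY' r l]

end Spec

/-! ### All levels, and the geometric series -/

section Spec

variable {k : ℕ} {m : Fin k → ℕ} {W : ℕ} (hW : 1000 ≤ W)

include hW in
theorem Wp.loop_done {e : Term} {p : Prog} {Q : State → Prop} {s : State} (he : e.small = true)
    (h : e.eval s = 0) (hQ : Q s) : Wp W (.loop e p) 101 Q s := by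
  intro hs
  have hc : e.cost ≤ 100 := by
    simp only [Term.small, Bool.and_eq_true, decide_eq_true_eq] at he
    exact he.2
  exact ⟨s, _, .loop_done (Term.small.fits hW hs he) h, by omega, hs, hQ⟩

include hW in
theorem Wp.loop_step {e : Term} {p : Prog} {τ τ' : ℕ} {R Q : State → Prop} {s : State} (he : e.small = true)
    (h : e.eval s ≠ 0) (hp : Wp W p τ R s) (hl : ∀ s', R s' → Wp W (.loop e p) τ' Q s') :
    Wp W (.loop e p) (101 + τ + τ') Q s := by
  intro hs
  have hc : e.cost ≤ 100 := by
    simp only [Term.small, Bool.and_eq_true, decide_eq_true_eq] at he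
    exact he.2
  obtain ⟨s₁, t₁, h1, h2, h3, h4⟩ := hp hs
  obtain ⟨s₂, t₂, k1, k2, k3, k4⟩ := hl s₁ h4 h3
  exact ⟨s₂, _, .loop_step (Term.small.fits hW hs he) h h1 k1, by omega, k3, k4⟩

include hW in
-- During the loop, coordinates before `i` have blocks of side `h` and the others of side `σ`. All
-- phases use `2 * σ` rounds, which is enough for both.
theorem Wp.splitAll {hm : ∀ l, 0 < m l} {XI XG Y : GridConfig m} {h σ T : ℕ}
    {s : State} (hm2 : ∀ l, 2 ≤ m l)
    (hrows : ∀ l, 2 ≤ gridSize m / m l) (h6 : 6 ≤ gridSize m) (hN : 2 * gridSize m + 2 ≤ W)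
    (hkN : k * gridSize m ≤ W) (hT : T + k * (k + 1) * (1260 * σ) ≤ W) (he : Env hm XG s)
    (hσ : s.reg sᵣ = σ) (hσh : σ = 2 * h) (hh : 0 < h) (hσW : σ ≤ W)
    (hsize : ∀ l < k, s.arr sizeₐ l = σ) (hY : ∀ r l, (Y r l : ℕ) / σ = XG r l / σ)
    (ht : s.reg tᵣ = T) (htr : Trace XI (s.arr outₐ) T Y) :
    Wp W (.for iᵣ ʳkᵣ MPP.split) ((k + 1) * (10 ^ 9 * (k * (σ * gridSize m)) + 110)) (fun s' =>
      ∃ T' ≤ T + k * (k + 1) * (1260 * σ), ∃ Y', s'.reg tᵣ = T' ∧ Trace XI (s'.arr outₐ) T' Y' ∧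
      (∀ l < k, s'.arr sizeₐ l = h) ∧ (∀ r l, (Y' r l : ℕ) / h = XG r l / h)) s := by
  refine Wp.mono (Wp.for hW MPP.split.wr MPP.split.wa (fun i s' => ∃ T' ≤ T + i * ((k + 1) * (2 * σ * 630)), ∃ Y',
    s'.reg tᵣ = T' ∧ Trace XI (s'.arr outₐ) T' Y' ∧ (∀ l < k, s'.arr sizeₐ l = if l < i then h else σ) ∧
    (∀ r (l : Fin k), (Y' r l : ℕ) / (if (l : ℕ) < i then h else σ) = XG r l / (if (l : ℕ) < i then h else σ))) k
    (10 ^ 9 * (k * (σ * gridSize m))) ?_ ?_ ?_ ?_ ?_ (hL := List.Subset.refl _) (hK := List.Subset.refl _)) le_rfl ?_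
  · exact (Nat.le_mul_of_pos_right _ (by omega)).trans hkN
  · rintro i hi s' ha hir ⟨T', hT', Y', ht', htr', hsize', hY'⟩
    have hup : Function.update (fun l => if l < i then h else σ) i h = fun l => if l < i + 1 then h else σ := by
      funext l
      rw [Function.update_apply]
      split_ifs <;> first | rfl | omega
    refine Wp.mono (Wp.split hW (i := ⟨i, hi⟩) (h := h) (σ := σ) (S := fun l => if l < i then h else σ) (T := T') (Y := Y') (XI := XI)
      hm2 hrows h6 hN hkN ?_ (he.agree ha) hir ((ha.reg _ (by decide)).trans hσ) hσh hh hσW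
      hsize' (fun l hl => ?_) ?_ hY' ht' htr') le_rfl ?_
    · have := Nat.mul_le_mul_right ((k + 1) * (2 * σ * 630)) (show i + 1 ≤ k from hi)
      rw [add_mul i 1, one_mul] at this
      linarith
    · split_ifs <;> omega
    · simp
    · rintro s'' - ⟨T'', hT'', Y'', h1, h2, h3, h4⟩
      rw [hup] at h3 h4
      exact ⟨T'', by linarith, Y'', h1, h2, h3, h4⟩
  · exact ⟨T, by omega, Y, ht, htr, by simpa using hsize, by simpa using hY⟩
  · intro s' ha
    simp [(he.agree ha).dim]
  · rintro i v s' ⟨T', hT', Y', ht', h⟩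
    exact ⟨T', hT', Y', by simpa using ht', h⟩
  · rintro s' - ⟨-, -, T', hT', Y', h1, h2, h3, h4⟩
    exact ⟨T', by linarith, Y', h1, h2, fun l hl => by rw [h3 l hl, if_pos hl], fun r l => by simpa using h4 r l⟩

include hW in
-- The cost of a level is proportional to its block side, so all levels from `2 ^ e` down cost at
-- most twice the first; this is the factor 2 in the makespan. At `e = 0` blocks are vertices and
-- every robot is at its goal.
theorem Wp.route {hm : ∀ l, 0 < m l} {XI XG : GridConfig m} (hk : 0 < k) (hm2 : ∀ l, 2 ≤ m l)
    (hrows : ∀ l, 2 ≤ gridSize m / m l) (h6 : 6 ≤ gridSize m) (hN : 2 * gridSize m + 2 ≤ W)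
    (hkN : k * gridSize m ≤ W) (e : ℕ) : ∀ {Y : GridConfig m} {T : ℕ} {s : State},
    T + 2 * (k * (k + 1) * (1260 * 2 ^ e)) ≤ W → Env hm XG s → s.reg sᵣ = 2 ^ e →
    (∀ l < k, s.arr sizeₐ l = 2 ^ e) → (∀ r l, (Y r l : ℕ) / 2 ^ e = XG r l / 2 ^ e) → s.reg tᵣ = T →
    Trace XI (s.arr outₐ) T Y →
    Wp W route (8 * 10 ^ 9 * (k ^ 2 * gridSize m * 2 ^ e)) (fun s' =>
      ∃ T' ≤ T + 2 * (k * (k + 1) * (1260 * 2 ^ e)), s'.reg tᵣ = T' ∧ Trace XI (s'.arr outₐ) T' XG) s := by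
  have hkk : 0 < k ^ 2 * gridSize m := Nat.mul_pos (Nat.pow_pos hk) (by omega)
  induction e with
  | zero =>
    intro Y T s hT he hσ hsize hY ht htr
    refine Wp.mono (Wp.loop_done hW (Q := fun s' => s' = s) (by decide) (by simp [hσ]) rfl) (by simp; omega) ?_
    rintro s' - rfl
    obtain rfl : Y = XG := by
      ext r l
      simpa using hY r l
    exact ⟨T, by omega, ht, htr⟩
  | succ e ih =>
    intro Y T s hT he hσ hsize hY ht htr
    have h2 : 2 ^ (e + 1) = 2 * 2 ^ e := by ring
    have hpos : 0 < 2 ^ e := Nat.pow_pos (by norm_num)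
    have hX : 2 ^ (e + 1) ≤ k * (k + 1) * (1260 * 2 ^ (e + 1)) := by
      have h3 : 1 ≤ k * (k + 1) := Nat.mul_pos hk (by omega)
      have := Nat.mul_le_mul_right (1260 * 2 ^ (e + 1)) h3
      omega
    -- One of the two copies of the cost of this level pays for all later levels.
    have hX2 : k * (k + 1) * (1260 * 2 ^ (e + 1)) = 2 * (k * (k + 1) * (1260 * 2 ^ e)) := by
      rw [h2]
      ring
    have hs₁ : 1 < s.reg sᵣ := by omega
    refine Wp.mono (Wp.loop_step hW (by decide) (by simp [hs₁]) (Wp.seq (Wp.agree (iᵣ :: MPP.split.wr) MPP.split.wa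
      (Wp.splitAll hW (Y := Y) (XI := XI) (XG := XG) (hm := hm) (T := T) hm2 hrows h6 hN hkN (by omega) he hσ h2
        hpos (by omega) hsize hY ht htr) (by decide) (List.Subset.refl _))
      (Q := fun s' => ∃ T' ≤ T + k * (k + 1) * (1260 * 2 ^ (e + 1)), ∃ Y', s'.reg tᵣ = T' ∧
        Trace XI (s'.arr outₐ) T' Y' ∧ (∀ l < k, s'.arr sizeₐ l = 2 ^ e) ∧
        (∀ r l, (Y' r l : ℕ) / 2 ^ e = XG r l / 2 ^ e) ∧ s'.reg sᵣ = 2 ^ e ∧ Env hm XG s')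
      (τ' := (sᵣ ≔ ʳsᵣ / 2).time) ?_) (τ' := 8 * 10 ^ 9 * (k ^ 2 * gridSize m * 2 ^ e)) ?_) ?_ fun _ _ h => h
    · rintro s₁ ⟨ha₁, T', hT', Y', h3, h4, h5, h6⟩
      have hσ₁ : s₁.reg sᵣ / 2 = 2 ^ e := by
        rw [ha₁.reg _ (by decide), hσ]
        omega
      have he₁ := he.agree ha₁
      refine Wp.block hW (by decide) ⟨by simp [hσ₁]; omega, T', hT', Y', by simpa using h3, h4, h5, h6, by simp [hσ₁], ?_⟩
      exact ⟨by simp [he₁.dim], by simp [he₁.size], he₁.side, he₁.goal, he₁.stride, he₁.table, he₁.order⟩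
    · rintro s₁ ⟨T', hT', Y', h3, h4, h5, h6, h7, h8⟩
      refine Wp.mono (ih (by omega) h8 h7 h5 h6 h3 h4) le_rfl ?_
      rintro s₂ - ⟨T'', hT'', h9⟩
      exact ⟨T'', by omega, h9⟩
    · have h3 : (sᵣ ≔ ʳsᵣ / 2).time = 4 := rfl
      have h4 : k * (2 ^ e * gridSize m) ≤ k ^ 2 * gridSize m * 2 ^ e := by
        rw [show k ^ 2 * gridSize m * 2 ^ e = k * (k * (2 ^ e * gridSize m)) by ring]
        exact Nat.le_mul_of_pos_left _ hk
      have h5 : k ≤ k * (2 ^ e * gridSize m) := Nat.le_mul_of_pos_right _ (Nat.mul_pos hpos (by omega))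
      rw [h3, h2]
      nlinarith

end Spec

/-! ### Setting up strides, the first block size and the ladder table -/

section Spec

variable {k : ℕ} {m : Fin k → ℕ}

theorem stride_le_gridSize (hm : ∀ l, 0 < m l) {d : ℕ} (hd : d ≤ k) : stride m d ≤ gridSize m := by
  rw [← stride_self]
  induction hd using Nat.decreasingInduction with
  | self => rfl
  | of_succ d hd ih =>
    refine le_trans ?_ ih
    rw [stride, side_of_lt m hd]
    exact Nat.le_mul_of_pos_right _ (hm _)

variable {W : ℕ} (hW : 1000 ≤ W)

include hW in
theorem Wp.initStrides {s : State} (hm : ∀ l, 0 < m l) (hN : gridSize m ≤ W) (hk : k ≤ W)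
    (hdim : s.reg kᵣ = k) (hside : s.arr sideₐ = side m) :
    Wp W initStrides ((k + 1) * 200 + 101)
      (fun s' => s'.reg nᵣ = gridSize m ∧ ∀ l < k, s'.arr strideₐ l = stride m l) s := by
  refine Wp.mono (Wp.assign hW (x := nᵣ) (e := 1) (by decide) (by simp; omega) (Wp.for hW [nᵣ] [strideₐ] (fun d s' =>
    s'.reg nᵣ = stride m d ∧ ∀ l < d, s'.arr strideₐ l = stride m l) k
    (.store strideₐ ʳdᵣ ʳnᵣ ;; nᵣ ≔ ʳnᵣ * .read sideₐ ʳdᵣ).time hk ?_ ?_ ?_ ?_)) ?_ ?_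
  · rintro d hd s' ha hdr ⟨h1, h2⟩
    refine Wp.block hW (by decide) ?_
    have h3 : s'.arr sideₐ d = side m d := by
      rw [ha.arr _ (by decide)]
      simp [hside]
    have h4 := stride_le_gridSize hm hd
    have h5 := stride_le_gridSize hm hd.le
    rw [stride] at h4
    simp [Prog.vc, h1, hdr, h3]
    refine ⟨by omega, by omega, rfl, fun l hl => ?_⟩
    rcases hl.lt_or_eq with hl | rfl
    · rw [Function.update_of_ne hl.ne, h2 l hl]
    · simp
  · simp [stride]
  · intro s' ha
    simp [ha.reg kᵣ (by decide), hdim]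
  · rintro d v s' ⟨h1, h2⟩
    exact ⟨by simpa using h1, h2⟩
  · have : (.store strideₐ ʳdᵣ ʳnᵣ ;; nᵣ ≔ ʳnᵣ * .read sideₐ ʳdᵣ : Prog).time + 110 ≤ 200 := by decide
    have := Nat.mul_le_mul_left (k + 1) this
    omega
  · rintro s' - ⟨-, -, h1, h2⟩
    exact ⟨by rw [h1, stride_self], h2⟩

include hW in
theorem Wp.initSize {M : ℕ} {s : State} (hM : ∀ l, m l ≤ M) (hM1 : 1 ≤ M) (hMW : 2 * M ≤ W) (hk : k ≤ W)
    (hdim : s.reg kᵣ = k) (hside : s.arr sideₐ = side m) :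
    Wp W initSize ((k + 1) * (M + 3) * 300) (fun s' => ∃ e, s'.reg sᵣ = 2 ^ e ∧ 2 ^ e ≤ 2 * M ∧
      (∀ l, m l ≤ 2 ^ e) ∧ ∀ l < k, s'.arr sizeₐ l = 2 ^ e) s := by
  refine Wp.mono (Wp.assign hW (x := sᵣ) (e := 1) (by decide) (by simp; omega) (Wp.seq (Wp.for hW [sᵣ] [] (fun d s' =>
    ∃ e, s'.reg sᵣ = 2 ^ e ∧ 2 ^ e ≤ 2 * M ∧ ∀ l : Fin k, l < d → m l ≤ 2 ^ e) k
    ((M + 1) * ((sᵣ ≔ ʳsᵣ * 2).time + 101)) hk ?_ ?_ ?_ ?_) (τ' := (k + 1) * ((Prog.store sizeₐ ʳdᵣ ʳsᵣ).time + 110)) ?_)) ?_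
    fun _ _ h => h
  · rintro d hd s' ha hdr ⟨e, h1, h2, h3⟩
    have h4 : s'.arr sideₐ d = m ⟨d, hd⟩ := by
      rw [ha.arr _ (by decide)]
      simp [hside, side_of_lt m hd]
    -- The exponent after coordinate `d`. Doubling takes place only while the power is below a side,
    -- which keeps it at most `2 * M`.
    set f := max e (Nat.clog 2 (m ⟨d, hd⟩)) with hf
    have hfM : f - e ≤ M := by
      have : Nat.clog 2 (m ⟨d, hd⟩) ≤ m ⟨d, hd⟩ :=
        Nat.clog_le_of_le_pow (Nat.lt_pow_self (by norm_num)).le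
      have := hM ⟨d, hd⟩
      omega
    have hlt : ∀ q < f - e, 2 ^ (e + q) < m ⟨d, hd⟩ := fun q hq => by
      refine Nat.pow_lt_of_lt_clog (by omega)
    refine Wp.mono (Wp.while hW (by decide) (I := fun q s₁ => s₁.reg sᵣ = 2 ^ (e + q) ∧ 2 ^ (e + q) ≤ 2 * M ∧
      s₁.reg dᵣ = d ∧ s₁.arr sideₐ d = m ⟨d, hd⟩)
      (n := f - e) (τ := (sᵣ ≔ ʳsᵣ * 2).time) ⟨h1, h2, hdr, h4⟩ ?_ ?_ ?_) (Nat.mul_le_mul_right _ (by omega)) ?_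
    · rintro q hq s₁ ⟨i1, i2, i3, i4⟩
      simp [i1, i3, i4, hlt q hq]
    · rintro s₁ ⟨i1, i2, i3, i4⟩
      simp [i1, i3, i4]
      rw [Nat.add_sub_cancel' (by omega)]
      exact (Nat.le_pow_clog (by norm_num) _).trans (Nat.pow_le_pow_right (by norm_num) (by omega))
    · rintro q hq s₁ ⟨i1, i2, i3, i4⟩
      have := hlt q hq
      have := hM ⟨d, hd⟩
      have h5 : 2 ^ (e + (q + 1)) = 2 ^ (e + q) * 2 := by ring
      refine Wp.block hW (by decide) ⟨by simp [i1]; omega, by simp [i1, h5], by omega, by simp [i3], by simpa using i4⟩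
    · rintro s₁ - ⟨i1, i2, i3, i4⟩
      rw [Nat.add_sub_cancel' (by omega)] at i1 i2
      have h5 : 2 ^ e ≤ 2 ^ f := Nat.pow_le_pow_right (by norm_num) (by omega)
      refine ⟨f, i1, i2, fun l hl => ?_⟩
      rcases Nat.lt_succ_iff_lt_or_eq.1 hl with hl | hl
      · exact (h3 l hl).trans h5
      · obtain rfl : l = ⟨d, hd⟩ := Fin.ext hl
        exact (Nat.le_pow_clog (by norm_num) _).trans (Nat.pow_le_pow_right (by norm_num) (by omega))
  · exact ⟨0, by simp, by omega, fun l hl => by omega⟩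
  · intro s' ha
    simp [ha.reg kᵣ (by decide), hdim]
  · rintro d v s' ⟨e, h1, h2⟩
    exact ⟨e, by simpa using h1, h2⟩
  · rintro s₁ ⟨ha₁, -, e, h1, h2, h3⟩
    refine Wp.mono (Wp.for hW [] [sizeₐ] (fun d s' => ∀ l < d, s'.arr sizeₐ l = 2 ^ e) k
      (Prog.store sizeₐ ʳdᵣ ʳsᵣ).time hk ?_ (fun l hl => by omega) ?_ fun _ _ _ h => h) le_rfl ?_
    · intro d hd s' ha hdr h
      have h4 : s'.reg sᵣ = 2 ^ e := (ha.reg _ (by decide)).trans h1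
      refine Wp.block hW (by decide) ?_
      simp [Prog.vc, h4, hdr]
      refine ⟨by omega, fun l hl => ?_⟩
      rcases hl.lt_or_eq with hl | rfl
      · rw [Function.update_of_ne hl.ne, h l hl]
      · simp
    · intro s' ha
      simp [ha.reg kᵣ (by decide), ha₁.reg kᵣ (by decide), hdim]
    · rintro s' - ⟨ha, -, h⟩
      exact ⟨e, (ha.reg _ (by decide)).trans h1, h2, fun l => h3 l l.is_lt, h⟩
  · have e1 : (sᵣ ≔ ʳsᵣ * 2).time = 4 := rfl
    have e2 : (Prog.store sizeₐ ʳdᵣ ʳsᵣ).time = 3 := rfl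
    rw [e1, e2]
    nlinarith

theorem loadTable_wr (f : ℕ → ℕ) (n : ℕ) : (loadTable f n).wr = [] := by
  induction n with
  | zero => rfl
  | succ n ih => simp [loadTable, Prog.wr, ih]

theorem loadTable_wa (f : ℕ → ℕ) (n : ℕ) : (loadTable f n).wa ⊆ [tableₐ] := by
  induction n with
  | zero => exact List.nil_subset _
  | succ n ih => simpa [loadTable, Prog.wa] using ih

include hW in
theorem Wp.loadTable {f : ℕ → ℕ} {n : ℕ} {s : State} (hn : n ≤ 1000) (hf : ∀ i < n, f i ≤ 1000) :
    Wp W (loadTable f n) (3 * n + 1) (fun s' => Agree [] [tableₐ] s s' ∧ ∀ i < n, s'.arr tableₐ i = f i) s := by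
  refine Wp.agree _ _ ?_ (by rw [loadTable_wr]; exact List.Subset.refl _) (loadTable_wa f n)
  induction n with
  | zero => exact Wp.block hW (p := .skip) rfl fun i hi => by omega
  | succ n ih =>
    refine Wp.mono (Wp.seq (ih (by omega) fun i hi => hf i (by omega)) (Q := fun s' => ∀ i < n + 1, s'.arr tableₐ i = f i)
      (τ' := (Prog.store tableₐ (.const n) (.const (f n))).time) ?_)
      (by simp [Prog.time, Term.cost]; omega) fun _ _ h => h
    intro s' h
    have hfn := hf n (by omega)
    refine Wp.block hW ?_ ?_
    · have hn' : n ≤ 1000 := by omega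
      simp [Prog.small, Term.small, Term.smallConsts, Term.cost, hn', hfn]
    · simp [Prog.vc]
      refine ⟨by omega, fun i hi => ?_⟩
      rcases hi.lt_or_eq with hi | rfl
      · rw [Function.update_of_ne hi.ne, h i hi]
      · simp

include hW in
theorem Wp.addDigits {hm : ∀ l, 0 < m l} {j : Fin k} {x : ℕ} {s : State} (hk : k ≤ W) (hN : gridSize m ≤ W)
    (hx : x < gridSize m)
    (hdim : s.reg kᵣ = k) (hside : s.arr sideₐ = side m) (hstride : ∀ l < k, s.arr strideₐ l = stride m l)
    (hj : s.reg jᵣ = j) (h0 : s.reg tmp₀ = x / m j) (h1 : s.reg tmp₁ = x % m j * stride m j) :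
    Wp W (.for dᵣ ʳkᵣ addDigit) ((k + 1) * 300) (fun s' => s'.reg tmp₁ = vertexCode (cellVertex hm j x)) s := by
  refine Wp.mono (Wp.for hW [tmp₀, tmp₁, tmp₂, tmp₃] [] (fun d s' => s'.reg tmp₀ = crossIndex m j x d ∧
    s'.reg tmp₁ = x % m j * stride m j + ∑ l ∈ Finset.range d, snakeDigit m j x l * stride m l) k
    MPP.addDigit.time hk ?_ ?_ ?_ ?_) (Nat.mul_le_mul_left _ (by decide)) ?_
  · rintro d hd s' ha hdr ⟨i0, i1⟩
    refine Wp.block hW (by decide) ?_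
    have e1 : s'.arr sideₐ d = side m d := by rw [ha.arr _ (by decide), hside]
    have e2 : s'.reg jᵣ = j := (ha.reg _ (by decide)).trans hj
    have e3 : s'.arr strideₐ d = stride m d := by rw [ha.arr _ (by decide), hstride d hd]
    have hci : crossIndex m j x d ≤ x := by
      rw [crossIndex_eq]
      exact (Nat.div_le_self _ _).trans (Nat.div_le_self _ _)
    have hsN : side m d ≤ gridSize m := by
      rw [side_of_lt m hd]
      exact side_le_gridSize hm _
    -- A partial sum is bounded by the number of the complete vertex, so the accumulated value fits.
    have hsum : x % m j * stride m j + ∑ l ∈ Finset.range (d + 1), snakeDigit m j x l * stride m l < gridSize m := by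
      refine lt_of_le_of_lt ?_ (vertexCode_lt (cellVertex hm j x))
      rw [vertexCode_cellVertex]
      exact Nat.add_le_add_left (Finset.sum_le_sum_of_subset (Finset.range_subset_range.2 hd)) _
    rw [Finset.sum_range_succ, ← add_assoc] at hsum ⊢
    have hsd : snakeDigit m j x d = if crossIndex m j x d / crossSide m j d % 2 = 0 then crossIndex m j x d % crossSide m j d
      else crossSide m j d - 1 - crossIndex m j x d % crossSide m j d := rfl
    have hcs : crossIndex m j x (d + 1) = crossIndex m j x d / crossSide m j d := rfl
    have b1 := Nat.mod_le (crossIndex m j x d) (crossSide m j d)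
    have b2 := Nat.div_le_self (crossIndex m j x d) (crossSide m j d)
    rw [hcs]
    by_cases hdj : d = j
    · have hc1 : crossSide m j d = 1 := if_pos hdj
      have hjr : s'.reg jᵣ = d := e2.trans hdj.symm
      rw [hc1, Nat.div_one]
      have hs0 : snakeDigit m j x d = 0 := by rw [hdj]; exact snakeDigit_self _ _
      rw [hs0, zero_mul, add_zero] at hsum ⊢
      rcases Nat.mod_two_eq_zero_or_one (crossIndex m j x d) with hpar | hpar <;>
        simp [addDigit, Prog.vc, hdr, e1, hjr, e3, i0, i1, hpar, Nat.mod_one] <;> omega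
    · have hc1 : crossSide m j d = side m d := if_neg hdj
      rw [hc1] at hsd b1 b2 ⊢
      rcases Nat.mod_two_eq_zero_or_one (crossIndex m j x d / side m d) with hpar | hpar
      · rw [hsd, if_pos hpar] at hsum ⊢
        simp [addDigit, Prog.vc, hdr, e1, e2, e3, i0, i1, hdj, hpar]
        omega
      · rw [hsd, if_neg (by omega)] at hsum ⊢
        simp [addDigit, Prog.vc, hdr, e1, e2, e3, i0, i1, hdj, hpar]
        omega
  · exact ⟨by rw [h0, crossIndex, side_val], by simp [h1]⟩
  · intro s' ha
    simp [ha.reg kᵣ (by decide), hdim]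
  · rintro d v s' ⟨h1, h2⟩
    exact ⟨by simpa using h1, by simpa using h2⟩
  · rintro s' - ⟨-, -, -, h⟩
    rw [h, vertexCode_cellVertex]

end Spec

/-! ### Enumerating the cells, and the whole program -/

section Spec

variable {k : ℕ} {m : Fin k → ℕ}

/-- The parts of the state that are needed to enumerate the cells. -/
structure GridEnv (m : Fin k → ℕ) (s : State) : Prop where
  dim : s.reg kᵣ = k
  size : s.reg nᵣ = gridSize m
  side : s.arr sideₐ = side m
  stride : ∀ l < k, s.arr strideₐ l = stride m l

theorem GridEnv.agree {s s' : State} {L K : List ℕ} (h : GridEnv m s) (ha : Agree L K s s')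
    (hL : kᵣ ∉ L ∧ nᵣ ∉ L := by decide) (hK : sideₐ ∉ K ∧ strideₐ ∉ K := by decide) : GridEnv m s' := by
  constructor
  · rw [ha.reg _ hL.1, h.dim]
  · rw [ha.reg _ hL.2, h.size]
  · rw [ha.arr _ hK.1, h.side]
  · rw [ha.arr _ hK.2]; exact h.stride

/-- The cells in directions before `j`, and those before `x` in direction `j`, have been enumerated. -/
def Enumerated (hm : ∀ l, 0 < m l) (j x : ℕ) (s : State) : Prop :=
  ∀ j' z, z < gridSize m → j' < j ∨ (j' = j ∧ z < x) →
    s.arr orderₐ (j' * gridSize m + z) = vertexCode (cellVertex hm j' z)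

theorem add_mul_injective {N a b x y : ℕ} (hx : x < N) (hy : y < N) (h : a * N + x = b * N + y) :
    a = b ∧ x = y := by
  have h1 := BlockClass.div_mod_of (r := a) hx
  have h2 := BlockClass.div_mod_of (r := b) hy
  rw [h] at h1
  exact ⟨h1.1.symm.trans h2.1, h1.2.symm.trans h2.2⟩

variable {W : ℕ} (hW : 1000 ≤ W)

include hW in
theorem Wp.enumerateCell {hm : ∀ l, 0 < m l} {j : Fin k} {x : ℕ} {s : State} (hk : k ≤ W) (hN : gridSize m ≤ W)
    (hx : x < gridSize m) (he : GridEnv m s) (hj : s.reg jᵣ = j) (hxr : s.reg xᵣ = x) (h : Enumerated hm j x s) :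
    Wp W enumerateCell ((k + 1) * 600) (Enumerated hm j (x + 1)) s := by
  have hsj : s.arr sideₐ j = m j := by rw [he.side, side_val]
  have hlt : x % m j * stride m j ≤ gridSize m := by
    refine le_trans ?_ (vertexCode_lt (cellVertex hm j x)).le
    rw [vertexCode_cellVertex]
    exact Nat.le_add_right _ _
  refine Wp.mono (Wp.assign hW (by decide) ?_ (Wp.assign hW (by decide) ?_ (Wp.seq (Wp.agree [dᵣ, tmp₀, tmp₁, tmp₂, tmp₃] []
    (Wp.addDigits hW (hm := hm) (j := j) hk hN hx ?_ ?_ ?_ ?_ ?_ ?_))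
    (τ' := (Prog.store orderₐ (ʳjᵣ * ʳnᵣ + ʳxᵣ) ʳtmp₁).time) ?_))) ?_ fun _ _ h => h
  · simp [hxr, hj, hsj]
    exact (Nat.div_le_self _ _).trans (by omega)
  · simp [hxr, hj, hsj, he.stride]
    omega
  · simp [he.dim]
  · simp [he.side]
  · simpa using he.stride
  · simp [hj]
  · simp [hxr, hj, hsj]
  · simp [hxr, hj, hsj, he.stride]
  · rintro s₁ ⟨ha, h1⟩
    have e1 : s₁.reg jᵣ = j := by rw [ha.reg _ (by decide)]; simp [hj]
    have e2 : s₁.reg xᵣ = x := by rw [ha.reg _ (by decide)]; simp [hxr]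
    have e3 : s₁.reg nᵣ = gridSize m := by rw [ha.reg _ (by decide)]; simp [he.size]
    have e4 : s₁.arr orderₐ = s.arr orderₐ := by rw [ha.arr _ (by decide)]; simp
    have h2 := vertexCode_lt (cellVertex hm j x)
    refine Wp.block hW (by decide) ⟨by simp [h1]; omega, fun j' z hz hjz => ?_⟩
    simp [e1, e2, e3, e4, h1]
    by_cases hjx : j' = j ∧ z = x
    · obtain ⟨rfl, rfl⟩ := hjx
      simp
    · rw [Function.update_of_ne fun e => hjx (add_mul_injective hz hx e)]
      exact h j' z hz (by omega)
  · have : (Prog.store orderₐ (ʳjᵣ * ʳnᵣ + ʳxᵣ) ʳtmp₁).time = 7 := rfl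
    omega

include hW in
theorem Wp.enumerateCells {hm : ∀ l, 0 < m l} {s : State} (hk : k ≤ W) (hN : gridSize m ≤ W) (he : GridEnv m s) :
    Wp W (.for jᵣ ʳkᵣ (.for xᵣ ʳnᵣ MPP.enumerateCell))
      ((k + 1) * ((gridSize m + 1) * ((k + 1) * 600 + 110) + 110))
      (fun s' => ∀ j : Fin k, ∀ z < gridSize m,
        s'.arr orderₐ (j * gridSize m + z) = vertexCode (cellVertex hm j z)) s := by
  refine Wp.mono (Wp.for hW (xᵣ :: MPP.enumerateCell.wr) MPP.enumerateCell.wa (fun j s' => Enumerated hm j 0 s') k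
    ((gridSize m + 1) * ((k + 1) * 600 + 110)) hk ?_ ?_ ?_ ?_ (hK := List.Subset.refl _)) le_rfl ?_
  · intro j hj s' ha hjr h
    refine Wp.mono (Wp.for hW MPP.enumerateCell.wr MPP.enumerateCell.wa (fun x s' => Enumerated hm j x s') (gridSize m)
      ((k + 1) * 600) hN ?_ h ?_ ?_ (hL := List.Subset.refl _) (hK := List.Subset.refl _)) le_rfl ?_
    · intro x hx s'' ha' hxr h'
      exact Wp.enumerateCell hW (j := ⟨j, hj⟩) hk hN hx ((he.agree ha).agree ha') ((ha'.reg _ (by decide)).trans hjr) hxr h'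
    · intro s'' ha'
      simp [((he.agree ha).agree ha').size]
    · exact fun _ _ _ h => h
    · rintro s'' - ⟨-, -, h'⟩ j' z hz hjz
      exact h' j' z hz (by omega)
  · intro j' z hz hjz
    omega
  · intro s' ha
    simp [(he.agree ha).dim]
  · exact fun _ _ _ h => h
  · rintro s' - ⟨-, -, h⟩ j z hz
    exact h j z hz (Or.inl j.is_lt)

include hW in
theorem Wp.copyInit {s : State} (hN : gridSize m ≤ W) (he : GridEnv m s) {XI : GridConfig m}
    (hI : ∀ r : Fin (gridSize m), s.arr initₐ r = vertexCode (XI r)) :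
    Wp W (.for xᵣ ʳnᵣ (.store outₐ ʳxᵣ (.read initₐ ʳxᵣ))) ((gridSize m + 1) * 200)
      (fun s' => Trace XI (s'.arr outₐ) 0 XI) s := by
  refine Wp.mono (Wp.for hW [] [outₐ] (fun x s' => ∀ r : Fin (gridSize m), r < x → s'.arr outₐ r = vertexCode (XI r))
    (gridSize m) (Prog.store outₐ ʳxᵣ (.read initₐ ʳxᵣ)).time hN ?_ (fun r hr => by omega)
    (fun s' ha => by simp [(he.agree ha).size]) fun _ _ _ h => h) (Nat.mul_le_mul_left _ (by decide)) ?_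
  · intro x hx s' ha hxr h
    have h1 : s'.arr initₐ x = vertexCode (XI ⟨x, hx⟩) := by rw [ha.arr _ (by decide), hI ⟨x, hx⟩]
    have h2 := vertexCode_lt (XI ⟨x, hx⟩)
    refine Wp.block hW (by decide) ?_
    simp [Prog.vc, hxr, h1]
    refine ⟨by omega, fun r hr => ?_⟩
    rcases hr.lt_or_eq with hr | rfl
    · rw [Function.update_of_ne hr.ne, h r hr]
    · simp
  · rintro s' - ⟨-, -, h⟩
    refine ⟨fun _ => XI, ⟨rfl, rfl, fun t ht => by omega⟩, fun t ht r => ?_⟩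
    obtain rfl : t = 0 := by omega
    simpa using h r r.is_lt

theorem tabulate_le {n B : ℕ} {f : Fin n → ℕ} (h : ∀ i, f i ≤ B) (i : ℕ) : tabulate f i ≤ B := by
  rw [tabulate]
  split_ifs
  · exact h _
  · exact Nat.zero_le _

/-- There is a second dimension, whose side is at least 2 and divides the number of rows. -/
theorem two_le_rows (hg : IsGrid m) (l : Fin k) : 2 ≤ gridSize m / m l := by
  have hpos : 0 < m l := lt_of_lt_of_le (by norm_num) (hg.2.1 l)
  have : Nontrivial (Fin k) := Fin.nontrivial_iff_two_le.2 hg.1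
  obtain ⟨l', hl'⟩ := exists_ne l
  rw [gridSize, ← Finset.mul_prod_erase _ _ (Finset.mem_univ l), Nat.mul_div_cancel_left _ hpos]
  refine (hg.2.1 l').trans (Nat.le_of_dvd (Finset.prod_pos fun i _ => lt_of_lt_of_le (by norm_num) (hg.2.1 i)) ?_)
  exact Finset.dvd_prod_of_mem m (Finset.mem_erase.2 ⟨hl', Finset.mem_univ _⟩)

include hW in
theorem Wp.solver (hg : IsGrid m) (XI XG : GridConfig m) {M : ℕ} (hM : ∀ l, m l ≤ M) (hM1 : 1 ≤ M)
    (hN : 2 * gridSize m + 2 ≤ W) (hMW : 2 * M ≤ W) (hkN : k * gridSize m ≤ W)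
    (hT : 10080 * (k ^ 2 * M) ≤ W) :
    Wp W solver (10 ^ 11 * (k ^ 2 * M * gridSize m)) (fun s' => ∃ T ≤ 10080 * (k ^ 2 * M), ∃ X,
      IsOutput s' T X ∧ IsSolution (gridGraph m) XI XG T X) (inputState m XI XG) := by
  obtain ⟨hk2, hm2, h6⟩ := hg
  have hm : ∀ l, 0 < m l := fun l => lt_of_lt_of_le (by norm_num) (hm2 l)
  have hkW : k ≤ W := (Nat.le_mul_of_pos_right k (by omega)).trans hkN
  set s₀ := inputState m XI XG with hs₀
  have hdim : s₀.reg kᵣ = k := by simp [hs₀, inputState]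
  have hside : s₀.arr sideₐ = side m := by simp [hs₀, inputState]
  have hinit : ∀ r : Fin (gridSize m), s₀.arr initₐ r = vertexCode (XI r) := fun r => by
    simp [hs₀, inputState, tabulate]
  have hgoal : ∀ r : Fin (gridSize m), s₀.arr goalₐ r = vertexCode (XG r) := fun r => by
    simp [hs₀, inputState, tabulate]
  have htime : s₀.reg tᵣ = 0 := by simp [hs₀, inputState]
  clear_value s₀
  refine Wp.mono (Wp.seq (Wp.agree MPP.initStrides.wr MPP.initStrides.wa (Wp.initStrides hW hm (by omega) hkW hdim hside)
    (List.Subset.refl _) (List.Subset.refl _)) (τ' := (k + 1) * (M + 3) * 300 + ((3 * 259 + 1) + ((gridSize m + 1) * 200 +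
      ((k + 1) * ((gridSize m + 1) * ((k + 1) * 600 + 110) + 110) + (8 * 10 ^ 9 * (k ^ 2 * gridSize m * (2 * M)) + 2))))) ?_) ?_
      fun _ _ h => h
  swap
  · have hN1 : 1 ≤ gridSize m := by omega
    have hk1 : 1 ≤ k := by omega
    -- Each term of the running time is a constant times a product of factors at most `k`, `k`, `M`
    -- and the number of vertices.
    have key : ∀ a b c d : ℕ, a ≤ k → b ≤ k → c ≤ M → d ≤ gridSize m → a * b * c * d ≤ k ^ 2 * M * gridSize m :=
      fun a b c d ha hb hc hd => by
        rw [sq]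
        gcongr
    have z1 := key 1 1 1 1 hk1 hk1 hM1 hN1
    have z2 := key k 1 1 1 le_rfl hk1 hM1 hN1
    have z3 := key k k 1 1 le_rfl le_rfl hM1 hN1
    have z4 := key k k 1 _ le_rfl le_rfl hM1 le_rfl
    have z5 := key k 1 1 _ le_rfl hk1 hM1 le_rfl
    have z6 := key 1 1 1 _ hk1 hk1 hM1 le_rfl
    have z7 := key k 1 M 1 le_rfl hk1 le_rfl hN1
    have z8 := key 1 1 M 1 hk1 hk1 le_rfl hN1
    linarith
  rintro s₁ ⟨ha₁, hn₁, hst₁⟩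
  have he₁ : GridEnv m s₁ := ⟨(ha₁.reg _ (by decide)).trans hdim, hn₁, (ha₁.arr _ (by decide)).trans hside, hst₁⟩
  refine Wp.seq (Wp.agree MPP.initSize.wr MPP.initSize.wa (Wp.initSize hW hM hM1 hMW hkW he₁.dim he₁.side)
    (List.Subset.refl _) (List.Subset.refl _)) ?_
  rintro s₂ ⟨ha₂, e, hσ₂, heM, hme, hsize₂⟩
  have he₂ := he₁.agree ha₂
  refine Wp.seq (Wp.loadTable hW (f := ladderTable) (n := 259) (by norm_num) fun i hi => (ladderTable_le i hi).trans (by norm_num)) ?_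
  rintro s₃ ⟨ha₃, htab₃⟩
  have he₃ := he₂.agree ha₃
  refine Wp.seq (Wp.agree [xᵣ] [outₐ] (Wp.copyInit hW (by omega) he₃ (XI := XI) fun r => ?_)) ?_
  · rw [ha₃.arr _ (by decide), ha₂.arr _ (by decide), ha₁.arr _ (by decide), hinit]
  rintro s₄ ⟨ha₄, htr₄⟩
  refine Wp.seq (Wp.agree (jᵣ :: xᵣ :: MPP.enumerateCell.wr) MPP.enumerateCell.wa
    (Wp.enumerateCells hW hkW (by omega) (hm := hm) (he₃.agree ha₄)) (by decide) (List.Subset.refl _)) ?_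
  rintro s₅ ⟨ha₅, hord₅⟩
  have he₅ := (he₃.agree ha₄).agree ha₅
  have henv : Env hm XG s₅ := by
    refine ⟨he₅.dim, he₅.size, he₅.side, fun r => ?_, he₅.stride, fun i hi => ?_, hord₅⟩
    · rw [ha₅.arr _ (by decide), ha₄.arr _ (by decide), ha₃.arr _ (by decide), ha₂.arr _ (by decide), ha₁.arr _ (by decide), hgoal]
    · rw [ha₅.arr _ (by decide), ha₄.arr _ (by decide), htab₃ i hi]
  -- The constant is 2 · 2 · 1260 · 2, from the geometric series, `k * (k + 1) ≤ 2 * k ^ 2`, and `2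
  -- ^ e ≤ 2 * M`.
  have hmk : 2 * (k * (k + 1) * (1260 * 2 ^ e)) ≤ 10080 * (k ^ 2 * M) := by
    have h1 : k * (k + 1) ≤ 2 * k ^ 2 := by nlinarith
    calc 2 * (k * (k + 1) * (1260 * 2 ^ e)) ≤ 2 * (2 * k ^ 2 * (1260 * (2 * M))) := by gcongr
      _ = _ := by ring
  refine Wp.seq (Wp.mono (Wp.route hW (by omega) hm2 (two_le_rows ⟨hk2, hm2, h6⟩) h6 hN hkN e (T := 0) (Y := XI) (XI := XI)
    (by omega) henv ?_ ?_ (fun r l => ?_) ?_ ?_) (τ' := 8 * 10 ^ 9 * (k ^ 2 * gridSize m * (2 * M))) (by gcongr) fun s' _ h => h) ?_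
  · rw [ha₅.reg _ (by decide), ha₄.reg _ (by decide), ha₃.reg _ (by decide), hσ₂]
  · rw [ha₅.arr _ (by decide), ha₄.arr _ (by decide), ha₃.arr _ (by decide)]
    exact hsize₂
  -- At the beginning one block contains the whole grid.
  · rw [Nat.div_eq_of_lt ((XI r l).is_lt.trans_le (hme l)), Nat.div_eq_of_lt ((XG r l).is_lt.trans_le (hme l))]
  · rw [ha₅.reg _ (by decide), ha₄.reg _ (by decide), ha₃.reg _ (by decide), ha₂.reg _ (by decide), ha₁.reg _ (by decide), htime]
  · rw [ha₅.arr _ (by decide)]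
    exact htr₄
  rintro s₆ ⟨T, hTle, ht₆, X, hX, hout⟩
  -- Register 0, which held the dimension, has to hold the makespan in the end.
  refine Wp.block hW (p := kᵣ ≔ ʳtᵣ) (by decide) ⟨by simp [ht₆]; omega, T, by omega, X, ⟨by simp [ht₆], fun t ht r => hout t ht r⟩, hX⟩

end Spec

/-! ### Bounds in terms of the number of vertices -/

section Spec

variable {k : ℕ} {m : Fin k → ℕ}

theorem bdd_inputState (hm : ∀ l, 0 < m l) (XI XG : GridConfig m) {W : ℕ} (hk : k ≤ W) (hN : gridSize m ≤ W) :
    Bdd W (inputState m XI XG) := by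
  have hcode : ∀ X : GridConfig m, ∀ i, tabulate (fun r => vertexCode (X r)) i ≤ W := fun X i =>
    tabulate_le (fun r => (vertexCode_lt _).le.trans hN) i
  constructor
  · intro x
    simp only [inputState]
    split_ifs
    exacts [hk, Nat.zero_le _]
  · intro a i
    simp only [inputState]
    split_ifs
    exacts [tabulate_le (fun l => (side_le_gridSize hm l).trans hN) i, hcode XI i, hcode XG i, Nat.zero_le _]

set_option exponentiation.threshold 1000 in
-- Since all sides are at least 2, `2 ^ k`, and so `k`, is at most the number N of vertices. With
-- 10080 ≤ 6^6 ≤ N^6 and `M ≤ N`, the makespan bound is at most N^9, which serves as bound `W` for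
-- all cells. The word bound is its hundredth power.
theorem solver_spec (hg : IsGrid m) (XI XG : GridConfig m) {M : ℕ} (hM : ∀ l, m l ≤ M) (hM1 : 1 ≤ M)
    (hMN : M ≤ gridSize m) : ∃ s t T X, Exec (gridSize m ^ (9 * 100)) solver (inputState m XI XG) s t ∧
      t ≤ 10 ^ 11 * (k ^ 2 * M * gridSize m) ∧ IsOutput s T X ∧ IsSolution (gridGraph m) XI XG T X ∧
      T ≤ 10080 * (k ^ 2 * M) := by
  have hm : ∀ l, 0 < m l := fun l => lt_of_lt_of_le (by norm_num) (hg.2.1 l)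
  have h6 := hg.2.2
  have hkN : k ≤ gridSize m := by
    have h1 : 2 ^ k ≤ gridSize m := by
      have := Finset.prod_le_prod' (s := Finset.univ) fun (l : Fin k) _ => hg.2.1 l
      simpa using this
    exact (Nat.lt_two_pow_self).le.trans h1
  set N := gridSize m with hN
  have p2 : N ^ 2 ≤ N ^ 9 := Nat.pow_le_pow_right (by omega) (by norm_num)
  have p4 : N ^ 4 ≤ N ^ 9 := Nat.pow_le_pow_right (by omega) (by norm_num)
  have q4 : 6 ^ 4 ≤ N ^ 4 := Nat.pow_le_pow_left h6 4
  have q2 : 6 * N ≤ N ^ 2 := by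
    rw [sq]
    exact Nat.mul_le_mul_right _ h6
  have hT : 10080 * (k ^ 2 * M) ≤ N ^ 9 := by
    calc 10080 * (k ^ 2 * M) ≤ 6 ^ 6 * (N ^ 2 * N) := by gcongr; norm_num
      _ ≤ N ^ 6 * (N ^ 2 * N) := by gcongr
      _ = N ^ 9 := by ring
  have hkN' : k * N ≤ N ^ 2 := by
    rw [sq]
    exact Nat.mul_le_mul_right _ hkN
  obtain ⟨s, t, h1, h2, -, T, h3, X, h4, h5⟩ := Wp.solver (W := N ^ 9) (by omega) hg XI XG hM hM1 (by omega) (by omega)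
    (hkN'.trans p2) hT (bdd_inputState hm XI XG (by omega) (by omega))
  rw [← pow_mul] at h1
  exact ⟨s, t, T, X, h1, h2, h4, h5, h3⟩

/-- The largest side is taken for `M`; similarity of the sides bounds it by `c` times the k-th root
of the number of vertices. -/
theorem solver_solves {c : ℝ} (hg : IsGrid m) (hs : SimilarSides c m) (XI XG : GridConfig m) :
    Solves (gridSize m ^ (9 * 100)) solver m XI XG
      (10 ^ 11 * c * ((k : ℝ) ^ 2 * (gridSize m : ℝ) ^ ((1 : ℝ) / k)))
      (10 ^ 11 * c * ((k : ℝ) ^ 2 * (gridSize m : ℝ) ^ (((k : ℝ) + 1) / k))) := by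
  have hm : ∀ l, 0 < m l := fun l => lt_of_lt_of_le (by norm_num) (hg.2.1 l)
  have hk : 0 < k := lt_of_lt_of_le (by norm_num) hg.1
  have : Nonempty (Fin k) := ⟨⟨0, hk⟩⟩
  obtain ⟨l₀, hl₀⟩ := Finite.exists_max m
  obtain ⟨s, t, T, X, h1, h2, h3, h4, h5⟩ := solver_spec hg XI XG hl₀ (hm l₀) (side_le_gridSize hm l₀)
  have hN : (0 : ℝ) < gridSize m := by exact_mod_cast gridSize_pos hm
  have hk' : (k : ℝ) ≠ 0 := by exact_mod_cast hk.ne'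
  have hpow : (gridSize m : ℝ) ^ (((k : ℝ) + 1) / k) = (gridSize m : ℝ) ^ ((1 : ℝ) / k) * gridSize m := by
    rw [add_div, div_self hk', add_comm, Real.rpow_add hN, Real.rpow_one]
  have hM := hs l₀
  have h2' : (t : ℝ) ≤ 10 ^ 11 * ((k : ℝ) ^ 2 * m l₀ * gridSize m) := by exact_mod_cast h2
  have h5' : (T : ℝ) ≤ 10080 * ((k : ℝ) ^ 2 * m l₀) := by exact_mod_cast h5
  refine ⟨s, t, T, X, h1, h2'.trans ?_, h3, h4, h5'.trans ?_⟩
  · rw [hpow]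
    calc 10 ^ 11 * ((k : ℝ) ^ 2 * m l₀ * gridSize m)
        ≤ 10 ^ 11 * ((k : ℝ) ^ 2 * (c * (gridSize m : ℝ) ^ ((1 : ℝ) / k)) * gridSize m) := by gcongr
      _ = _ := by ring
  · calc 10080 * ((k : ℝ) ^ 2 * m l₀) ≤ 10 ^ 11 * ((k : ℝ) ^ 2 * (c * (gridSize m : ℝ) ^ ((1 : ℝ) / k))) := by
          gcongr
          norm_num
      _ = _ := by ring

theorem Solves.mono {B : ℕ} {p : Prog} {XI XG : GridConfig m} {μ μ' τ τ' : ℝ} (h : Solves B p m XI XG μ τ)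
    (hμ : μ ≤ μ') (hτ : τ ≤ τ') : Solves B p m XI XG μ' τ' := by
  obtain ⟨s, t, T, X, h1, h2, h3, h4, h5⟩ := h
  exact ⟨s, t, T, X, h1, h2.trans hτ, h3, h4, h5.trans hμ⟩

end Spec

end MPP

theorem mainTheorem9 :
    ∃ (p : MPP.Prog) (w : ℕ), ∀ c : ℝ, 0 < c → ∃ C : ℝ, 0 < C ∧
      (∀ (m : Fin 2 → ℕ), MPP.IsGrid m → MPP.SimilarSides c m →
        ∀ XI XG : MPP.GridConfig m,
          MPP.Solves (MPP.gridSize m ^ w) p m XI XG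
            (C * √(MPP.gridSize m : ℝ))
            (C * (MPP.gridSize m : ℝ) ^ ((3 : ℝ) / 2))) ∧
      (∀ (m : Fin 3 → ℕ), MPP.IsGrid m → MPP.SimilarSides c m →
        ∀ XI XG : MPP.GridConfig m,
          MPP.Solves (MPP.gridSize m ^ w) p m XI XG
            (C * (MPP.gridSize m : ℝ) ^ ((1 : ℝ) / 3))
            (C * (MPP.gridSize m : ℝ) ^ ((4 : ℝ) / 3))) ∧
      (∀ (k : ℕ) (m : Fin k → ℕ), MPP.IsGrid m → MPP.SimilarSides c m →
        ∀ XI XG : MPP.GridConfig m,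
          MPP.Solves (MPP.gridSize m ^ w) p m XI XG
            (C * ((k : ℝ) ^ 2 * (MPP.gridSize m : ℝ) ^ ((1 : ℝ) / k)))
            (C * ((k : ℝ) ^ 2 * (MPP.gridSize m : ℝ) ^ (((k : ℝ) + 1) / k)))) := by
  -- For `k = 2` and `k = 3` the factor `k ^ 2` is 4 or 9, hence at most 10, which accounts for the
  -- step from `10 ^ 11` to `10 ^ 12`.
  have weaken : ∀ {c a x : ℝ}, 0 < c → 0 ≤ x → a ≤ 10 →
      10 ^ 11 * c * (a * x) ≤ 10 ^ 12 * c * x := fun {c a x} hc hx ha => by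
    have h1 := mul_le_mul_of_nonneg_right ha hx
    have h2 := mul_le_mul_of_nonneg_left h1 (by positivity : (0 : ℝ) ≤ 10 ^ 11 * c)
    linarith
  refine ⟨MPP.solver, 9 * 100, fun c hc => ⟨10 ^ 12 * c, by positivity, fun m hg hs XI XG => ?_,
    fun m hg hs XI XG => ?_, fun k m hg hs XI XG => ?_⟩⟩
  · have e : ((2 : ℕ) + 1 : ℝ) / (2 : ℕ) = 3 / 2 := by norm_num
    refine (MPP.solver_solves hg hs XI XG).mono ?_ ?_
    · rw [Real.sqrt_eq_rpow, Nat.cast_ofNat]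
      exact weaken (a := 2 ^ 2) hc (by positivity) (by norm_num)
    · rw [e, Nat.cast_ofNat]
      exact weaken (a := 2 ^ 2) hc (by positivity) (by norm_num)
  · have e : ((3 : ℕ) + 1 : ℝ) / (3 : ℕ) = 4 / 3 := by norm_num
    refine (MPP.solver_solves hg hs XI XG).mono ?_ ?_
    · rw [Nat.cast_ofNat]
      exact weaken (a := 3 ^ 2) hc (by positivity) (by norm_num)
    · rw [e, Nat.cast_ofNat]
      exact weaken (a := 3 ^ 2) hc (by positivity) (by norm_num)
  · refine (MPP.solver_solves hg hs XI XG).mono ?_ ?_ <;>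
      exact mul_le_mul_of_nonneg_right (by linarith) (by positivity)
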